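/- Let $a_1<\dots<a_n$ be distinct real numbers, $v_i=(a_i,1)\in\mathbb{R}^2$, let $\pi\colon[0,1]^n\to\mathbb{R}^2$ be the projection $\pi(x)=\sum_i x_iv_i$ and $Z=\pi([0,1]^n)$. For disjoint $A,B\subseteq[n]$ let $F_{A,B}$ be the face of $[0,1]^n$ given by $x_i=1$ for $i\in A$ and $x_i=0$ for $i\notin A\cup B$. A fine zonotopal tiling $\mathcal{T}$ of $Z$ is a collection of two-dimensional faces $F_{A,B}$ (so $|B|=2$) whose images under $\pi$ are parallelograms that form a polyhedral subdivision of $Z$, with $\pi(F\cap F')=\pi(F)\cap\pi(F')$ for any two faces $F,F'$ of the collection. A vertex of $\mathcal{T}$ is a set $S$ with $A\subseteq S\subseteq A\cup B$ for some $F_{A,B}\in\mathcal{T}$. A circuit is a pair $C=(C^+,C^-)$ of disjoint sets, with $C^+\cup C^-$ the support of a minimal linear dependence $\sum_i\alpha_iv_i=0$, $\alpha_i>0$ exactly on $C^+$ and $\alpha_i<0$ exactly on $C^-$; put $-C=(C^-,C^+)$. $\mathcal{T}$ orients $C$ positively if some vertex of $\mathcal{T}$ contains $C^+$ and misses $C^-$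 but no vertex contains $C^-$ and misses $C^+$, and negatively if it orients $-C$ positively. There is a flip along $C$ between $\mathcal{T}$ and $\mathcal{T}'$ if they orient $C$ oppositely and every circuit other than $\pm C$ equally. If $\mathcal{T}$ is the one that orients $C$ positively, then, with $\underline{C}=C^+\cup C^-$, the flip removes from $\mathcal{T}$ the faces $F_{A\cup\{j\},\underline{C}\setminus\{j\}}$ $(j\in C^+)$ and $F_{A,\underline{C}\setminus\{j\}}$ $(j\in C^-)$, for a set $A\subseteq[n]\setminus\underline{C}$, and adds the faces obtained by exchanging the roles of $C^+$ and $C^-$; its level is $|A|+1$. Two fine zonotopal tilings are $k$-equivalent if they are connected by a (possibly empty) sequence of flips, none of which is at level $k$. Let $1\le k\le n-1$. A hypertriangulation at level $k$ is a chain of $k$-element subsets of $[n]$ that starts at $\{1,\dots,k\}$, ends at $\{n-k+1,\dots,n\}$, and has steps of the form $I\cup\{i\}\to I\cup\{j\}$ with $i,j\notin I$, $i<j$. It is the cross-section of $\mathcal{T}$ at level $k$ if its steps are exactly the pairs $A\cup\{i\}\to A\cup\{j\}$ with $F_{A,\{i,j\}}\in\mathcal{T}$, $|A|=k-1$, $i<j$,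 and it is lifting if it is the cross-section at level $k$ of some fine zonotopal tiling. A flip between two lifting hypertriangulations inserts one set into the chain or removes one set from it. Then sending a fine zonotopal tiling to its cross-section at level $k$ induces a well-defined bijection from the set of classes of fine zonotopal tilings that are simultaneously $k$- and $(k-1)$-equivalent onto the set of lifting hypertriangulations at level $k$. Under this bijection, two lifting hypertriangulations are related by a flip if and only if some tiling in one of the two corresponding classes is related to some tiling in the other by a flip at level $k$ or at level $k-1$. Moreover, two fine zonotopal tilings are both $k$-equivalent and $(k-1)$-equivalent if and only if they are connected by a single sequence of flips none of which is at level $k$ or at level $k-1$. -/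

import Mathlib

noncomputable section

namespace ZonoHyper

/-! Throughout, `a : Fin n → ℝ` is a configuration of points `a 0 < a 1 < ... < a (n - 1)` on the
real line (dimension `d = 2`), and `[n]` is modelled by `Fin n`, i.e. `{0, ..., n - 1}`. -/

/-- The lifted vectors `v_i = (a_i, 1)` in the plane. -/
def vec {n : ℕ} (a : Fin n → ℝ) (i : Fin n) : ℝ × ℝ := (a i, 1)

/-- The linear projection `π : ℝⁿ → ℝ²` with `π (e_i) = v_i`. -/
def proj {n : ℕ} (a : Fin n → ℝ) : (Fin n → ℝ) →ₗ[ℝ] ℝ × ℝ :=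
  Fintype.linearCombination ℝ (vec a)

/-- The unit cube `[0,1]ⁿ`. -/
def unitCube (n : ℕ) : Set (Fin n → ℝ) := {x | ∀ i, 0 ≤ x i ∧ x i ≤ 1}

/-- The zonotope `Z_V`, the Minkowski sum of the segments `[0, v_i]`, as the image of the cube. -/
def zonotope {n : ℕ} (a : Fin n → ℝ) : Set (ℝ × ℝ) := proj a '' unitCube n

/-- The face `F_{A,B}` of the cube: `x_i = 1` for `i ∈ A` and `x_i = 0` for `i ∉ A ∪ B`. -/
def cubeFace {n : ℕ} (A B : Finset (Fin n)) : Set (Fin n → ℝ) :=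
  {x | x ∈ unitCube n ∧ (∀ i ∈ A, x i = 1) ∧ ∀ i, i ∉ A → i ∉ B → x i = 0}

/-- The image `Π_{A,B} = π (F_{A,B})`. -/
def tile {n : ℕ} (a : Fin n → ℝ) (A B : Finset (Fin n)) : Set (ℝ × ℝ) := proj a '' cubeFace A B

/-- A fine zonotopal tiling of the zonotope of the vectors `(a_i, 1)`: a collection of
two-dimensional faces `F_{A,B}` of the cube, recorded by the pairs `(A, B)`, whose images are
(nondegenerate) parallelograms that cover the zonotope and satisfy
`π (F₁ ∩ F₂) = π F₁ ∩ π F₂` for any two faces of the collection. As `F₁ ∩ F₂` is empty or a common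
face of `F₁` and `F₂`, proper if `F₁ ≠ F₂`, and `π` is injective on each of them, the last condition
says in particular that any two tiles meet in a common proper face, i.e. that the parallelograms
form a polyhedral subdivision. -/
@[ext]
structure FineZonotopalTiling {n : ℕ} (a : Fin n → ℝ) where
  /-- The pairs `(A, B)` of the faces `F_{A,B}` of the tiling. -/
  tiles : Finset (Finset (Fin n) × Finset (Fin n))
  disjoint_of_mem : ∀ t ∈ tiles, Disjoint t.1 t.2
  card_of_mem : ∀ t ∈ tiles, t.2.card = 2
  linearIndepOn_of_mem : ∀ t ∈ tiles, LinearIndepOn ℝ (vec a) (t.2 : Set (Fin n))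
  cover : ⋃ t ∈ tiles, tile a t.1 t.2 = zonotope a
  inter : ∀ s ∈ tiles, ∀ t ∈ tiles,
    proj a '' (cubeFace s.1 s.2 ∩ cubeFace t.1 t.2) = tile a s.1 s.2 ∩ tile a t.1 t.2

/-- The set `V(T)` of vertices of a tiling: all `S` with `A ⊆ S ⊆ A ∪ B` for some tile. -/
def FineZonotopalTiling.vertices {n : ℕ} {a : Fin n → ℝ} (T : FineZonotopalTiling a) :
    Set (Finset (Fin n)) :=
  {S | ∃ t ∈ T.tiles, t.1 ⊆ S ∧ S ⊆ t.1 ∪ t.2}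

/-- `(P, N)` is a circuit `(C⁺, C⁻)` of the vectors `v_i`. -/
def IsCircuit {n : ℕ} (a : Fin n → ℝ) (P N : Finset (Fin n)) : Prop :=
  Disjoint P N ∧ (P ∪ N).Nonempty ∧
    (∀ i ∈ P ∪ N, LinearIndepOn ℝ (vec a) ((P ∪ N).erase i : Set (Fin n))) ∧
    ∃ α : Fin n → ℝ, (∀ i ∈ P, 0 < α i) ∧ (∀ i ∈ N, α i < 0) ∧
      (∀ i, i ∉ P → i ∉ N → α i = 0) ∧ ∑ i, α i • vec a i = 0

/-- The tiling `T` orients the circuit `(P, N)` positively, `σ_T (P, N) = 1`: some vertex of `T`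
contains `P` and misses `N`, and no vertex contains `N` and misses `P`. It orients `(P, N)`
negatively, `σ_T (P, N) = -1`, if it orients `(N, P)` positively. -/
def Orients {n : ℕ} {a : Fin n → ℝ} (T : FineZonotopalTiling a) (P N : Finset (Fin n)) : Prop :=
  (∃ S ∈ T.vertices, P ⊆ S ∧ Disjoint N S) ∧ ¬ ∃ S ∈ T.vertices, N ⊆ S ∧ Disjoint P S

/-- There is a flip from `T` to `T'` along the circuit `C = (P, N)` that turns `σ(C) = 1` into
`σ(C) = -1`, and keeps the orientation of all circuits other than `C` and `-C`. (Flips in the other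
direction are obtained with `-C = (N, P)`.) -/
def IsFlipAlong {n : ℕ} {a : Fin n → ℝ} (T T' : FineZonotopalTiling a)
    (P N : Finset (Fin n)) : Prop :=
  IsCircuit a P N ∧ Orients T P N ∧ Orients T' N P ∧
    ∀ P' N', IsCircuit a P' N' → (P', N') ≠ (P, N) → (P', N') ≠ (N, P) →
      (Orients T P' N' ↔ Orients T' P' N')

/-- The tiles that a flip along `C = (P, N)` with base set `A` removes:
`Π_{A ∪ {j}, C \ {j}}` for `j ∈ P` and `Π_{A, C \ {j}}` for `j ∈ N`. -/
def exchangeTiles {n : ℕ} (A P N : Finset (Fin n)) :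
    Finset (Finset (Fin n) × Finset (Fin n)) :=
  P.image (fun j => (insert j A, (P ∪ N).erase j)) ∪ N.image (fun j => (A, (P ∪ N).erase j))

/-- There is a flip of level `l` from `T` to `T'`. The level is `|A| + 1`, where `A` is the base set
of the exchanged tiles. -/
def IsFlipAtLevel {n : ℕ} {a : Fin n → ℝ} (l : ℕ) (T T' : FineZonotopalTiling a) : Prop :=
  ∃ P N A : Finset (Fin n), IsFlipAlong T T' P N ∧ Disjoint A (P ∪ N) ∧
    T.tiles \ T'.tiles = exchangeTiles A P N ∧ T'.tiles \ T.tiles = exchangeTiles A N P ∧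
    A.card + 1 = l

theorem IsCircuit.swap {n : ℕ} {a : Fin n → ℝ} {P N : Finset (Fin n)} (h : IsCircuit a P N) :
    IsCircuit a N P := by
  obtain ⟨h1, h2, h3, α, hP, hN, h0, hs⟩ := h
  refine ⟨h1.symm, by rwa [Finset.union_comm], by rwa [Finset.union_comm N P], fun i => -α i,
    fun i hi => neg_pos.2 (hN i hi), fun i hi => neg_lt_zero.2 (hP i hi),
    fun i h h' => neg_eq_zero.2 (h0 i h' h), ?_⟩
  simp [Finset.sum_neg_distrib, hs]

theorem IsFlipAtLevel.symm {n : ℕ} {a : Fin n → ℝ} {l : ℕ} {T T' : FineZonotopalTiling a}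
    (h : IsFlipAtLevel l T T') : IsFlipAtLevel l T' T := by
  obtain ⟨P, N, A, ⟨hc, hT, hT', ho⟩, hd, h1, h2, hl⟩ := h
  exact ⟨N, P, A, ⟨hc.swap, hT', hT, fun P' N' hc' hne hne' => (ho P' N' hc' hne' hne).symm⟩,
    by rwa [Finset.union_comm], h2, h1, hl⟩

/-- `T` and `T'` can be connected by a (possibly empty) sequence of flips whose levels all avoid
the set `L`. -/
def ConnectedAvoiding {n : ℕ} {a : Fin n → ℝ} (L : Set ℕ) (T T' : FineZonotopalTiling a) : Prop :=
  Relation.ReflTransGen (fun U U' => ∃ l, l ∉ L ∧ IsFlipAtLevel l U U') T T'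

theorem ConnectedAvoiding.symm {n : ℕ} {a : Fin n → ℝ} {L : Set ℕ} {T T' : FineZonotopalTiling a}
    (h : ConnectedAvoiding L T T') : ConnectedAvoiding L T' T := by
  induction h with
  | refl => exact Relation.ReflTransGen.refl
  | tail _ hf ih =>
    obtain ⟨l, hl, hf⟩ := hf
    exact Relation.ReflTransGen.head ⟨l, hl, hf.symm⟩ ih

/-- `k`-equivalence: `T` and `T'` can be connected by a sequence of flips none of which happens at
level `k`. -/
def LevelEquiv {n : ℕ} {a : Fin n → ℝ} (k : ℕ) (T T' : FineZonotopalTiling a) : Prop :=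
  ConnectedAvoiding {k} T T'

/-- Simultaneous `k`- and `(k-1)`-equivalence (used for `1 ≤ k`). -/
def simulSetoid {n : ℕ} (a : Fin n → ℝ) (k : ℕ) : Setoid (FineZonotopalTiling a) where
  r T T' := LevelEquiv k T T' ∧ LevelEquiv (k - 1) T T'
  iseqv :=
    { refl := fun _ => ⟨Relation.ReflTransGen.refl, Relation.ReflTransGen.refl⟩
      symm := fun h => ⟨ConnectedAvoiding.symm h.1, ConnectedAvoiding.symm h.2⟩
      trans := fun h h' =>
        ⟨Relation.ReflTransGen.trans h.1 h'.1, Relation.ReflTransGen.trans h.2 h'.2⟩ }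

/-- A step `I ∪ {i} → I ∪ {j}` with `i < j` and `i, j ∉ I`: an edge of the hypersimplex, directed
so that the first coordinate of its image under `π` increases. -/
def MonotoneStep {n : ℕ} (S S' : Finset (Fin n)) : Prop :=
  ∃ (I : Finset (Fin n)) (i j : Fin n), i ∉ I ∧ j ∉ I ∧ i < j ∧ S = insert i I ∧ S' = insert j I

/-- Level-`k` hypertriangulations for `d = 2`: monotone paths on the hypersimplex `△_{k,n}`, that
is, chains of `k`-element subsets of `[n]` from the `k` smallest elements to the `k` largest
elements, with steps `I ∪ {i} → I ∪ {j}`, `i < j`. The list is the list of vertices of the path. -/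
def IsHypertriangulation {n : ℕ} (k : ℕ) (H : List (Finset (Fin n))) : Prop :=
  (∀ S ∈ H, S.card = k) ∧
    H.head? = some (Finset.univ.filter fun i : Fin n => i.val < k) ∧
    H.getLast? = some (Finset.univ.filter fun i : Fin n => n ≤ i.val + k) ∧
    H.IsChain MonotoneStep

/-- The path `H` is the cross-section of the tiling `T` at level `k` (for `1 ≤ k < n`). A face
`F_{A,B}` with `B = {i, j}`, `i < j`, meets the hyperplane `∑ x = k` in more than one point exactly
when `|A| = k - 1`, and then in the edge of the hypersimplex from `A ∪ {i}` to `A ∪ {j}`; these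
edges have to be precisely the edges of the path. -/
def IsCrossSection {n : ℕ} {a : Fin n → ℝ} (k : ℕ) (T : FineZonotopalTiling a)
    (H : List (Finset (Fin n))) : Prop :=
  ∀ S S' : Finset (Fin n), [S, S'] <:+: H ↔
    ∃ (A : Finset (Fin n)) (i j : Fin n), i < j ∧ (A, ({i, j} : Finset (Fin n))) ∈ T.tiles ∧
      A.card + 1 = k ∧ S = insert i A ∧ S' = insert j A

/-- Lifting hypertriangulations at level `k`: hypertriangulations that are cross-sections of fine
zonotopal tilings. -/
def LiftingHypertriangulation {n : ℕ} (a : Fin n → ℝ) (k : ℕ) : Type :=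
  {H : List (Finset (Fin n)) //
    IsHypertriangulation k H ∧ ∃ T : FineZonotopalTiling a, IsCrossSection k T H}

/-- `H'` arises from `H` by inserting one set into the chain. -/
def InsertsSet {n : ℕ} (H H' : List (Finset (Fin n))) : Prop :=
  ∃ (X Y : List (Finset (Fin n))) (S : Finset (Fin n)), H = X ++ Y ∧ H' = X ++ S :: Y

/-- A flip between lifting hypertriangulations: one set is inserted into, or removed from, the
chain, and both chains are lifting hypertriangulations. -/
def LiftingHypertriangulation.IsFlip {n : ℕ} {a : Fin n → ℝ} {k : ℕ}
    (H H' : LiftingHypertriangulation a k) : Prop :=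
  InsertsSet H.1 H'.1 ∨ InsertsSet H'.1 H.1

/-- Two classes of simultaneous `k`- and `(k-1)`-equivalence are related by a zonotopal flip at
level `l`: some tiling in one class admits a flip at level `l` to a tiling in the other. -/
def ClassFlip {n : ℕ} {a : Fin n → ℝ} {k : ℕ} (l : ℕ)
    (c c' : Quotient (simulSetoid a k)) : Prop :=
  ∃ T T' : FineZonotopalTiling a, Quotient.mk _ T = c ∧ Quotient.mk _ T' = c' ∧
    IsFlipAtLevel l T T'

end ZonoHyper

end

/-! A monotone path from the bottom to the top of the zonotope lists the vectors in the order of a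
permutation `w`; pushing it across a parallelogram whose sides stand at positions `q`, `q + 1` swaps
an ascent there. A fine zonotopal tiling is thus swept out by a word of ascent swaps from the
identity to the reversal. `tilingOf` builds the tiling of a word and `exists_eq_tilingOf` finds a
word for every tiling. The letter `q` gives a tile with `|A| = q`. Commuting distant letters does
not change the tiling, and a braid move on `q`, `q + 1` is a flip at level `q + 1`
(`isFlipAtLevel_braid`).

Put `k = κ + 1`. The cross-section at level `k` lists the sets of the first `k` values along the
word, so it amounts to `steps κ`, the pairs exchanged across the wall between the positions `κ` and
`κ + 1`. A braid move that avoids the letter `κ` is a flip at a level other than `k` and `k - 1`.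
Three facts carry the theorem.

Equal cross-sections imply connectedness. `weq_of_steps_eq` is a relative form of Matsumoto's
theorem: words with the same `steps κ` differ by commutations and braids without `κ`. `Compat`
decides from the wall swaps alone whether the letter of an ascent can come first; its transitivity
supplies the third pair needed for a braid.

Simultaneous equivalence implies equal cross-sections, although the two flip sequences may be
unrelated. A flip at level `k` trades an edge `P → Q` for `P → S → Q` (or back) with all consecutive
intersections equal; a flip at level `k - 1` does so with all consecutive unions equal. Hence the
sets where consecutive intersections change are invariants of `(k - 1)`-equivalence, those where
unions change are invariants of `k`-equivalence, and every inner set of the chain is of one of these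
kinds (`turns_of_monotoneStep`).

Flips of chains lift. If a set can be dropped, two consecutive wall swaps share a value;
`exists_braid_up'` and `exists_braid_down'` rearrange the word without braids at `κ` until these
swaps belong to one braid, whose flip at level `k` or `k - 1` drops the set. -/

namespace ZonoHyper

/-! ### Words of ascent swaps and their moves -/

/-- The transposition of the positions `q` and `q + 1`. -/
def adj (q : ℕ) : Equiv.Perm ℕ := Equiv.swap q (q + 1)

theorem adj_apply (q x : ℕ) : adj q x = if x = q then q + 1 else if x = q + 1 then q else x :=
  Equiv.swap_apply_def _ _ _

theorem mul_adj_apply (w : Equiv.Perm ℕ) (q x : ℕ) :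
    (w * adj q) x = if x = q then w (q + 1) else if x = q + 1 then w q else w x := by
  rw [Equiv.Perm.mul_apply, adj_apply]; split_ifs <;> rfl

theorem mul_adj_left (w : Equiv.Perm ℕ) (q : ℕ) : (w * adj q) q = w (q + 1) := by
  simp [mul_adj_apply]

theorem mul_adj_right (w : Equiv.Perm ℕ) (q : ℕ) : (w * adj q) (q + 1) = w q := by
  simp [mul_adj_apply]

theorem mul_adj_of_ne (w : Equiv.Perm ℕ) {q x : ℕ} (h : x ≠ q) (h' : x ≠ q + 1) :
    (w * adj q) x = w x := by
  simp [mul_adj_apply, h, h']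

theorem symm_mul_adj (w : Equiv.Perm ℕ) (q v : ℕ) :
    (w * adj q).symm v = adj q (w.symm v) := by
  rw [Equiv.symm_apply_eq, Equiv.Perm.mul_apply, adj, Equiv.swap_apply_self,
    Equiv.apply_symm_apply]

theorem mul_adj_comm (w : Equiv.Perm ℕ) {p q : ℕ} (h : p + 1 < q ∨ q + 1 < p) :
    w * adj p * adj q = w * adj q * adj p := by
  ext x
  simp only [mul_adj_apply]
  split_ifs <;> omega

theorem mul_adj_braid (w : Equiv.Perm ℕ) (q : ℕ) :
    w * adj q * adj (q + 1) * adj q = w * adj (q + 1) * adj q * adj (q + 1) := by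
  ext x
  simp only [mul_adj_apply]
  split_ifs <;> omega

/-- `u` is a sequence of swaps of adjacent entries at ascents that leads from `w` to a permutation
that is decreasing on `{0, ..., n - 1}`. -/
def IsPath (n : ℕ) : Equiv.Perm ℕ → List ℕ → Prop
  | w, [] => ∀ q, q + 1 < n → w (q + 1) < w q
  | w, q :: u => q + 1 < n ∧ w q < w (q + 1) ∧ IsPath n (w * adj q) u

/-- The pairs of values that are swapped at the positions `κ`, `κ + 1`. -/
def steps (κ : ℕ) : Equiv.Perm ℕ → List ℕ → List (ℕ × ℕ)
  | _, [] => []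
  | w, q :: u => (if q = κ then [(w q, w (q + 1))] else []) ++ steps κ (w * adj q) u

/-- Commutations, and braid moves that do not involve the letter `κ`. -/
inductive WEq (κ : ℕ) : List ℕ → List ℕ → Prop
  | refl (u) : WEq κ u u
  | symm {u v} : WEq κ u v → WEq κ v u
  | trans {u v x} : WEq κ u v → WEq κ v x → WEq κ u x
  | cons (q) {u v} : WEq κ u v → WEq κ (q :: u) (q :: v)
  | comm (p q u) : (p + 1 < q ∨ q + 1 < p) → WEq κ (p :: q :: u) (q :: p :: u)
  | braid (q u) : q ≠ κ → q + 1 ≠ κ →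
      WEq κ (q :: (q + 1) :: q :: u) ((q + 1) :: q :: (q + 1) :: u)

theorem isPath_comm {n p q : ℕ} (h : p + 1 < q ∨ q + 1 < p) {w : Equiv.Perm ℕ} {u : List ℕ}
    (hp : IsPath n w (p :: q :: u)) : IsPath n w (q :: p :: u) := by
  obtain ⟨h1, h2, h3, h4, h5⟩ := hp
  rw [mul_adj_of_ne _ (by omega) (by omega), mul_adj_of_ne _ (by omega) (by omega)] at h4
  refine ⟨h3, h4, h1, ?_, ?_⟩
  · rwa [mul_adj_of_ne _ (by omega) (by omega), mul_adj_of_ne _ (by omega) (by omega)]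
  · rwa [← mul_adj_comm w h]

/-- Both words make the same three comparisons among the values at `q`, `q + 1`, `q + 2`, in
opposite order. -/
theorem isPath_braid {n q : ℕ} {w : Equiv.Perm ℕ} {u : List ℕ} :
    IsPath n w (q :: (q + 1) :: q :: u) ↔ IsPath n w ((q + 1) :: q :: (q + 1) :: u) := by
  simp only [IsPath, mul_adj_braid, mul_adj_apply]
  have e1 : q + 1 + 1 ≠ q := by omega
  simp [e1, e1.symm]
  tauto

theorem steps_comm {κ p q : ℕ} (h : p + 1 < q ∨ q + 1 < p) (w : Equiv.Perm ℕ) (u : List ℕ) :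
    steps κ w (p :: q :: u) = steps κ w (q :: p :: u) := by
  simp only [steps, mul_adj_comm w h]
  rw [mul_adj_of_ne w (x := q) (by omega) (by omega), mul_adj_of_ne w (x := p) (by omega) (by omega),
    mul_adj_of_ne w (x := q + 1) (by omega) (by omega),
    mul_adj_of_ne w (x := p + 1) (by omega) (by omega)]
  split_ifs
  · omega
  all_goals simp

theorem steps_braid {κ q : ℕ} (h : q ≠ κ) (h' : q + 1 ≠ κ) (w : Equiv.Perm ℕ) (u : List ℕ) :
    steps κ w (q :: (q + 1) :: q :: u) = steps κ w ((q + 1) :: q :: (q + 1) :: u) := by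
  simp [steps, mul_adj_braid w q, h, h']

theorem WEq.isPath_iff {κ n : ℕ} {u v : List ℕ} (h : WEq κ u v) (w : Equiv.Perm ℕ) :
    IsPath n w u ↔ IsPath n w v := by
  induction h generalizing w with
  | refl => rfl
  | symm _ ih => exact (ih w).symm
  | trans _ _ ih ih' => exact (ih w).trans (ih' w)
  | cons q _ ih => simp only [IsPath, ih]
  | comm p q u h => exact ⟨isPath_comm h, isPath_comm h.symm⟩
  | braid q u => exact isPath_braid

theorem WEq.steps_eq {κ : ℕ} {u v : List ℕ} (h : WEq κ u v) (w : Equiv.Perm ℕ) :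
    steps κ w u = steps κ w v := by
  induction h generalizing w with
  | refl => rfl
  | symm _ ih => exact (ih w).symm
  | trans _ _ ih ih' => exact (ih w).trans (ih' w)
  | cons q _ ih => simp only [steps, ih]
  | comm p q u h => exact steps_comm h w u
  | braid q u h h' => exact steps_braid h h' w u

theorem WEq.length_eq {κ : ℕ} {u v : List ℕ} (h : WEq κ u v) : u.length = v.length := by
  induction h with
  | refl => rfl
  | symm _ ih => exact ih.symm
  | trans _ _ ih ih' => exact ih.trans ih'
  | cons q _ ih => simp [ih]
  | comm => rfl
  | braid => rfl

theorem WEq.append_left {κ : ℕ} {u v : List ℕ} (h : WEq κ u v) (α : List ℕ) :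
    WEq κ (α ++ u) (α ++ v) := by
  induction α with
  | nil => exact h
  | cons q α ih => exact ih.cons q

/-! ### Words with the same swaps at `κ` -/

/-- The first of the swaps `s` that involves `a` or `b` moves `a` to the right or `b` to the
left. -/
def Compat (a b : ℕ) : List (ℕ × ℕ) → Prop
  | [] => True
  | s :: r => s.1 ≠ b ∧ s.2 ≠ a ∧ (s.1 = a ∨ s.2 = b ∨ Compat a b r)

/-- In a braid the middle letter swaps the outer two of three values; transitivity supplies the
condition for that pair from the two neighbouring pairs. -/
theorem Compat.trans {a b c : ℕ} {r : List (ℕ × ℕ)} (h : Compat a b r) (h' : Compat b c r) :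
    Compat a c r := by
  induction r with
  | nil => trivial
  | cons s r ih =>
    obtain ⟨h1, h2, h3⟩ := h
    obtain ⟨h4, h5, h6⟩ := h'
    refine ⟨h4, h2, ?_⟩
    rcases h3 with h3 | h3 | h3
    · exact Or.inl h3
    · exact absurd h3 h5
    · rcases h6 with h6 | h6 | h6
      · exact absurd h6 h1
      · exact Or.inr (Or.inl h6)
      · exact Or.inr (Or.inr (ih h3 h6))

/-- An inverted pair of values in a block is compatible with the swaps between the blocks. -/
theorem compat_of_inverted {n κ a b : ℕ} (hab : a < b) {w : Equiv.Perm ℕ} {u : List ℕ}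
    (hu : IsPath n w u) (hpos : w.symm b < w.symm a) (hs : w.symm a ≤ κ ∨ κ < w.symm b) :
    Compat a b (steps κ w u) := by
  induction u generalizing w with
  | nil => trivial
  | cons q u ih =>
    obtain ⟨h1, h2, h3⟩ := hu
    have ha : ∀ x, w x = a ↔ x = w.symm a := fun x => (Equiv.eq_symm_apply w).symm
    have hb : ∀ x, w x = b ↔ x = w.symm b := fun x => (Equiv.eq_symm_apply w).symm
    have hIH := ih h3
    rw [symm_mul_adj, symm_mul_adj, adj_apply, adj_apply] at hIH
    by_cases hq : q = κ
    · subst hq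
      simp only [steps, if_true, List.singleton_append, Compat, ne_eq, ha, hb]
      -- With `b` before `a` on one side of the wall, `a` is nearer to it on the left and `b` on the
      -- right; so the swap cannot take `b` to the right or `a` to the left.
      refine ⟨by omega, by omega, ?_⟩
      by_cases c1 : q = w.symm a
      · exact Or.inl c1
      by_cases c2 : q + 1 = w.symm b
      · exact Or.inr (Or.inl c2)
      refine Or.inr (Or.inr (hIH ?_ ?_)) <;> split_ifs <;> omega
    · simp only [steps, if_neg hq, List.nil_append]
      -- Only ascents are swapped, so the inverted pair is not swapped back.
      have : ¬ (q = w.symm b ∧ q + 1 = w.symm a) := by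
        rintro ⟨e1, e2⟩
        rw [← hb] at e1
        rw [← ha] at e2
        omega
      refine hIH ?_ ?_ <;> split_ifs <;> omega

/-- The letter of an ascent that is compatible with the swaps at `κ` can be moved to the front. -/
theorem exists_weq_cons {n κ : ℕ} (N : ℕ) {w : Equiv.Perm ℕ} {u : List ℕ} (hN : u.length ≤ N)
    (hu : IsPath n w u) {q : ℕ} (hq : q + 1 < n) (hasc : w q < w (q + 1)) (hqκ : q ≠ κ)
    (hc : Compat (w q) (w (q + 1)) (steps κ w u)) : ∃ u', WEq κ u (q :: u') := by
  induction N generalizing w u q with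
  | zero =>
    obtain rfl : u = [] := List.length_eq_zero_iff.1 (by omega)
    have := hu q hq
    omega
  | succ N ih =>
    rcases u with _ | ⟨p, u⟩
    · have := hu q hq
      omega
    simp only [List.length_cons, Nat.add_le_add_iff_right] at hN
    obtain ⟨h1, h2, h3⟩ := hu
    rcases eq_or_ne p q with rfl | hpq
    · exact ⟨u, .refl _⟩
    by_cases hfar : p + 1 < q ∨ q + 1 < p
    · have e1 : (w * adj p) q = w q := mul_adj_of_ne _ (by omega) (by omega)
      have e2 : (w * adj p) (q + 1) = w (q + 1) := mul_adj_of_ne _ (by omega) (by omega)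
      have hc' : Compat (w q) (w (q + 1)) (steps κ (w * adj p) u) := by
        by_cases hp : p = κ
        · simp only [steps, hp, if_true, List.singleton_append, Compat, w.injective.eq_iff] at hc ⊢
          obtain ⟨_, _, hc | hc | hc⟩ := hc
          · omega
          · omega
          · exact hc
        · simpa [steps, hp] using hc
      obtain ⟨u', hu'⟩ := ih hN h3 hq (by rwa [e1, e2]) hqκ (by rwa [e1, e2])
      exact ⟨p :: u', (hu'.cons p).trans (.comm _ _ _ hfar)⟩
    -- A neighbour of `q` at the wall would move `w (q + 1)` to the right or `w q` to the left
    -- first, which `hc` forbids.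
    have hpκ : p ≠ κ := by
      rintro rfl
      simp only [steps, if_true, List.singleton_append, Compat, ne_eq, w.injective.eq_iff] at hc
      omega
    have hst : steps κ w (p :: u) = steps κ (w * adj p) u := by simp [steps, hpκ]
    rw [hst] at hc
    have hV : Compat (w p) (w (p + 1)) (steps κ (w * adj p) u) := by
      have s1 : (w * adj p).symm (w (p + 1)) = p := by simp [symm_mul_adj, adj_apply]
      have s2 : (w * adj p).symm (w p) = p + 1 := by simp [symm_mul_adj, adj_apply]
      exact compat_of_inverted h2 h3 (by omega) (by omega)
    -- In both cases the rest of the word is made to start with `q`, `p`. The pair for `q` is now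
    -- the outer pair of the three values, compatible by transitivity. The prefix `p q p` is then
    -- braided into `q p q`.
    obtain rfl | rfl : p = q + 1 ∨ q = p + 1 := by omega
    · have e1 : (w * adj (q + 1)) q = w q := mul_adj_of_ne _ (by omega) (by omega)
      have e2 : (w * adj (q + 1)) (q + 1) = w (q + 1 + 1) := mul_adj_left _ _
      have e3 : (w * adj (q + 1)) (q + 1 + 1) = w (q + 1) := mul_adj_right _ _
      obtain ⟨u2, hu2⟩ := ih hN h3 hq (by rw [e1, e2]; omega) hqκ
        (by rw [e1, e2]; exact hc.trans hV)
      obtain ⟨_, _, h4⟩ := (hu2.isPath_iff _).1 h3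
      have f1 : (w * adj (q + 1) * adj q) (q + 1) = w q := by rw [mul_adj_right, e1]
      have f2 : (w * adj (q + 1) * adj q) (q + 1 + 1) = w (q + 1) := by
        rw [mul_adj_of_ne _ (by omega) (by omega), e3]
      have hl := hu2.length_eq
      simp only [List.length_cons] at hl
      obtain ⟨u3, hu3⟩ := ih (by omega) h4 h1 (by rwa [f1, f2]) hpκ
        (by rw [f1, f2]; simpa [hu2.steps_eq, steps, hqκ] using hc)
      exact ⟨_, ((hu2.trans (hu3.cons q)).cons _).trans (WEq.braid q u3 hqκ hpκ).symm⟩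
    · have e0 : (w * adj p) p = w (p + 1) := mul_adj_left _ _
      have e1 : (w * adj p) (p + 1) = w p := mul_adj_right _ _
      have e2 : (w * adj p) (p + 1 + 1) = w (p + 1 + 1) := mul_adj_of_ne _ (by omega) (by omega)
      obtain ⟨u2, hu2⟩ := ih hN h3 hq (by rw [e1, e2]; omega) hqκ
        (by rw [e1, e2]; exact hV.trans hc)
      obtain ⟨_, _, h4⟩ := (hu2.isPath_iff _).1 h3
      have f1 : (w * adj p * adj (p + 1)) p = w (p + 1) := by
        rw [mul_adj_of_ne _ (by omega) (by omega), e0]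
      have f2 : (w * adj p * adj (p + 1)) (p + 1) = w (p + 1 + 1) := by rw [mul_adj_left, e2]
      have hl := hu2.length_eq
      simp only [List.length_cons] at hl
      obtain ⟨u3, hu3⟩ := ih (by omega) h4 h1 (by rwa [f1, f2]) hpκ
        (by rw [f1, f2]; simpa [hu2.steps_eq, steps, hqκ] using hc)
      exact ⟨_, ((hu2.trans (hu3.cons _)).cons _).trans (WEq.braid p u3 hpκ hqκ)⟩

/-- The criterion of `exists_weq_cons` is also necessary: after the first letter its two values are
inverted on one side of the wall, and `compat_of_inverted` applies. -/
theorem compat_head {n κ : ℕ} {w : Equiv.Perm ℕ} {q : ℕ} {u : List ℕ}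
    (hu : IsPath n w (q :: u)) (hqκ : q ≠ κ) :
    Compat (w q) (w (q + 1)) (steps κ w (q :: u)) := by
  obtain ⟨h1, h2, h3⟩ := hu
  have s1 : (w * adj q).symm (w (q + 1)) = q := by simp [symm_mul_adj, adj_apply]
  have s2 : (w * adj q).symm (w q) = q + 1 := by simp [symm_mul_adj, adj_apply]
  have := compat_of_inverted (κ := κ) h2 h3 (by omega) (by omega)
  simpa [steps, hqκ] using this

/-- Paths with the same swaps at `κ` are connected by moves that do not involve `κ`. -/
theorem weq_of_steps_eq {n κ : ℕ} (N : ℕ) {w : Equiv.Perm ℕ} {u v : List ℕ} (hN : u.length ≤ N)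
    (hu : IsPath n w u) (hv : IsPath n w v) (h : steps κ w u = steps κ w v) : WEq κ u v := by
  induction N generalizing w u v with
  | zero =>
    obtain rfl : u = [] := List.length_eq_zero_iff.1 (by omega)
    rcases v with _ | ⟨q, v⟩
    · exact .refl _
    · have := hu q hv.1
      have := hv.2.1
      omega
  | succ N ih =>
    rcases u with _ | ⟨p, u⟩
    · rcases v with _ | ⟨q, v⟩
      · exact .refl _
      · have := hu q hv.1
        have := hv.2.1
        omega
    rcases v with _ | ⟨q, v⟩
    · have := hv p hu.1
      have := hu.2.1
      omega
    have same : ∀ {p u v}, u.length ≤ N → IsPath n w (p :: u) → IsPath n w (p :: v) →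
        steps κ w (p :: u) = steps κ w (p :: v) → WEq κ (p :: u) (p :: v) := by
      intro p u v hN hu hv h
      exact (ih hN hu.2.2 hv.2.2 (List.append_cancel_left h)).cons p
    have hl := hN
    simp only [List.length_cons, Nat.add_le_add_iff_right] at hN
    -- Compatibility depends only on the common list of wall swaps, so a first letter other than `κ`
    -- of one word can be moved to the front of the other. If both words start with `κ`, it is
    -- cancelled.
    by_cases hq : q = κ
    · by_cases hp : p = κ
      · subst hp
        subst hq
        exact same hN hu hv h
      · have hc := compat_head hu hp
        rw [h] at hc
        obtain ⟨v', hv'⟩ := exists_weq_cons _ le_rfl hv hu.1 hu.2.1 hp hc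
        exact (same hN hu ((hv'.isPath_iff w).1 hv) (by rw [h, hv'.steps_eq])).trans hv'.symm
    · have hc := compat_head hv hq
      rw [← h] at hc
      obtain ⟨u', hu'⟩ := exists_weq_cons _ le_rfl hu hv.1 hv.2.1 hq hc
      have := hu'.length_eq
      simp only [List.length_cons] at this hl
      exact hu'.trans (same (by omega) ((hu'.isPath_iff w).1 hu) hv (by rw [← h, hu'.steps_eq]))

/-- When the next two values to be exchanged already stand at the wall, a first letter `κ - 1` or `κ
+ 1` would contradict `compat_head`. Every letter before the first `κ` therefore commutes with it.
-/
theorem exists_weq_cons_kappa {n κ : ℕ} {w : Equiv.Perm ℕ} {u : List ℕ} (hu : IsPath n w u)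
    {r : List (ℕ × ℕ)} (h : steps κ w u = (w κ, w (κ + 1)) :: r) :
    ∃ u', WEq κ u (κ :: u') := by
  induction u generalizing w with
  | nil => simp [steps] at h
  | cons p u ih =>
    rcases eq_or_ne p κ with rfl | hp
    · exact ⟨u, .refl _⟩
    have hc := compat_head hu hp
    rw [h] at hc
    simp only [Compat, ne_eq, w.injective.eq_iff] at hc
    have hst : steps κ w (p :: u) = steps κ (w * adj p) u := by simp [steps, hp]
    obtain ⟨u', hu'⟩ := ih hu.2.2 (by
      rw [mul_adj_of_ne _ (by omega) (by omega), mul_adj_of_ne _ (by omega) (by omega), ← h, hst])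
    exact ⟨_, (hu'.cons p).trans (.comm _ _ _ (by omega))⟩

/-- Values change sides only through the letter `κ`, so the first two to be exchanged start on their
own sides. -/
theorem steps_head {n κ : ℕ} {w : Equiv.Perm ℕ} {u : List ℕ} (hu : IsPath n w u) {i j : ℕ}
    {r : List (ℕ × ℕ)} (h : steps κ w u = (i, j) :: r) :
    i < j ∧ w.symm i ≤ κ ∧ κ < w.symm j ∧ w.symm j < n := by
  induction u generalizing w with
  | nil => simp [steps] at h
  | cons p u ih =>
    rcases eq_or_ne p κ with rfl | hp
    · simp only [steps, if_true, List.singleton_append, List.cons.injEq, Prod.mk.injEq] at h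
      obtain ⟨⟨rfl, rfl⟩, -⟩ := h
      exact ⟨hu.2.1, by simp, by simp, by simpa using hu.1⟩
    have := ih hu.2.2 (by simpa [steps, hp] using h)
    rw [symm_mul_adj, symm_mul_adj, adj_apply, adj_apply] at this
    have hpn := hu.1
    obtain ⟨h1, h2, h3, h4⟩ := this
    refine ⟨h1, ?_, ?_, ?_⟩
    · split_ifs at h2 <;> omega
    · split_ifs at h3 <;> omega
    · split_ifs at h4 <;> omega


/-! ### Bringing two consecutive swaps at `κ` into a braid -/

/-- Two consecutive swaps at `κ` that insert `y` between `i` and `l` can be arranged to be part of a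
braid. -/
theorem exists_braid_up {n κ : ℕ} (N : ℕ) {w : Equiv.Perm ℕ} {u : List ℕ} {l : ℕ}
    (hN : w.symm l < N) (hu : IsPath n w u) {r : List (ℕ × ℕ)}
    (h : steps κ w u = (w κ, w (κ + 1)) :: (w (κ + 1), l) :: r) :
    ∃ α β, WEq κ u (α ++ κ :: (κ + 1) :: κ :: β) ∧ steps κ w α = [] := by
  induction N generalizing w u with
  | zero => omega
  | succ N ih =>
  obtain ⟨u1, hu1⟩ := exists_weq_cons_kappa hu h
  have hp1 := (hu1.isPath_iff w).1 hu
  have hs1 : steps κ (w * adj κ) u1 = (w (κ + 1), l) :: r := by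
    have := hu1.steps_eq w
    rw [h] at this
    simpa [steps] using this.symm
  obtain ⟨hyl, -, hlκ, hln⟩ := steps_head hp1.2.2 hs1
  have hiy := hp1.2.1
  have hlw : ∀ x, w x = l ↔ x = w.symm l := fun x => (Equiv.eq_symm_apply w).symm
  have h1 : κ ≠ w.symm l := by rw [ne_eq, ← hlw]; omega
  have h2 : κ + 1 ≠ w.symm l := by rw [ne_eq, ← hlw]; omega
  rw [symm_mul_adj, adj_apply, if_neg h1.symm, if_neg h2.symm] at hlκ hln
  -- The braid needs `l` directly behind the pair at the wall. Otherwise one letter moves `l` a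
  -- place to the left, which drives the induction.
  by_cases hl2 : w.symm l = κ + 1 + 1
  · have hwl : w (κ + 1 + 1) = l := by rw [← hl2]; simp
    have e1 : (w * adj κ) (κ + 1) = w κ := mul_adj_right _ _
    have e2 : (w * adj κ) (κ + 1 + 1) = l := by rw [mul_adj_of_ne _ (by omega) (by omega), hwl]
    have e3 : (w * adj κ) κ = w (κ + 1) := mul_adj_left _ _
    obtain ⟨u2, hu2⟩ := exists_weq_cons (κ := κ) (q := κ + 1) _ le_rfl hp1.2.2 (by omega)
      (by rw [e1, e2]; omega) (by omega) (by
        rw [hs1, e1, e2]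
        refine ⟨?_, ?_, Or.inr (Or.inl rfl)⟩ <;> simp only <;> omega)
    have hp2 := (hu2.isPath_iff _).1 hp1.2.2
    have hs2 : steps κ (w * adj κ * adj (κ + 1)) u2 = (w (κ + 1), l) :: r := by
      have := hu2.steps_eq (w * adj κ)
      rw [hs1] at this
      simpa [steps] using this.symm
    obtain ⟨u3, hu3⟩ := exists_weq_cons_kappa (κ := κ) hp2.2.2 (r := r) (by
      rw [hs2, mul_adj_left, mul_adj_of_ne _ (by omega) (by omega), e2, e3])
    exact ⟨[], u3, hu1.trans ((hu2.trans (hu3.cons _)).cons _), rfl⟩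
  · obtain ⟨q, hq⟩ : ∃ q, w.symm l = q + 1 := ⟨w.symm l - 1, by omega⟩
    have hwq : w (q + 1) = l := by rw [← hq]; simp
    have hne : w q ≠ w κ ∧ w q ≠ w (κ + 1) ∧ w q ≠ l := by
      rw [← hwq]
      simp only [ne_eq, w.injective.eq_iff]
      omega
    -- If `l` were inverted with the value before it, that value would have to enter, or `l` move
    -- right, before `l` moves left; but the second wall swap moves `l` left.
    have hasc : w q < l := by
      by_contra hlt
      have := compat_of_inverted (κ := κ) (a := l) (b := w q) (by omega) hu (by simp; omega)
        (Or.inr (by simp; omega))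
      rw [h] at this
      obtain ⟨-, -, h1 | h1 | h1⟩ := this
      · simp only at h1
        omega
      · simp only at h1
        omega
      · exact h1.2.1 rfl
    obtain ⟨u2, hu2⟩ := exists_weq_cons (κ := κ) (q := q) _ le_rfl hu (by omega) (by rwa [hwq])
      (by omega) (by
        rw [hwq, h]
        refine ⟨?_, ?_, Or.inr (Or.inr ⟨?_, ?_, Or.inr (Or.inl rfl)⟩)⟩ <;> simp only <;> omega)
    have hp2 := (hu2.isPath_iff _).1 hu
    have e1 : (w * adj q) κ = w κ := mul_adj_of_ne _ (by omega) (by omega)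
    have e2 : (w * adj q) (κ + 1) = w (κ + 1) := mul_adj_of_ne _ (by omega) (by omega)
    have hqκ : q ≠ κ := by omega
    obtain ⟨α, β, hαβ, hα⟩ := ih (w := w * adj q) (u := u2)
      (by rw [symm_mul_adj, adj_apply]; split_ifs <;> omega) hp2.2.2 (by
        have := hu2.steps_eq w
        rw [h] at this
        rw [e1, e2]
        simpa [steps, hqκ] using this.symm)
    exact ⟨q :: α, β, hu2.trans (hαβ.cons _), by simpa [steps, hqκ] using hα⟩

/-- The first swap sends `w κ` to the right of the wall. Its next partner `x'` is then on the left
and is neither of the two values just exchanged, so it began strictly left of `κ`. -/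
theorem symm_lt_of_steps {n κ : ℕ} {w : Equiv.Perm ℕ} {u : List ℕ} {x' : ℕ} (hu : IsPath n w u)
    {r : List (ℕ × ℕ)} (h : steps κ w u = (w κ, w (κ + 1)) :: (x', w κ) :: r) :
    w.symm x' < κ ∧ x' < w κ ∧ w κ < w (κ + 1) ∧ κ + 1 < n := by
  obtain ⟨u1, hu1⟩ := exists_weq_cons_kappa hu h
  have hp1 := (hu1.isPath_iff w).1 hu
  have hs1 : steps κ (w * adj κ) u1 = (x', w κ) :: r := by
    have := hu1.steps_eq w
    rw [h] at this
    simpa [steps] using this.symm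
  obtain ⟨hyl, hlκ, -, -⟩ := steps_head hp1.2.2 hs1
  obtain ⟨hκn, hiy, -⟩ := id hp1
  have hlw : ∀ x, w x = x' ↔ x = w.symm x' := fun x => (Equiv.eq_symm_apply w).symm
  have h1 : κ ≠ w.symm x' := by rw [ne_eq, ← hlw]; omega
  have h2 : κ + 1 ≠ w.symm x' := by rw [ne_eq, ← hlw]; omega
  rw [symm_mul_adj, adj_apply, if_neg h1.symm, if_neg h2.symm] at hlκ
  exact ⟨by omega, hyl, hiy, hκn⟩

/-- Two consecutive swaps at `κ` that share the value `x`, which leaves first and enters last, can be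
arranged to be part of a braid. -/
theorem exists_braid_down {n κ : ℕ} (N : ℕ) {w : Equiv.Perm ℕ} {u : List ℕ} {x' : ℕ}
    (hN : κ < w.symm x' + N) (hu : IsPath n w u) {r : List (ℕ × ℕ)}
    (h : steps κ w u = (w κ, w (κ + 1)) :: (x', w κ) :: r) :
    ∃ p α β, κ = p + 1 ∧ WEq κ u (α ++ κ :: p :: κ :: β) ∧ steps κ w α = [] := by
  induction N generalizing w u with
  | zero =>
    have := symm_lt_of_steps hu h
    omega
  | succ N ih =>
  obtain ⟨hlκ, hyl, hiy, hκn⟩ := symm_lt_of_steps hu h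
  have hlw : ∀ x, w x = x' ↔ x = w.symm x' := fun x => (Equiv.eq_symm_apply w).symm
  -- Mirror image of `exists_braid_up`: `x'` must stand directly before the pair at the wall and is
  -- moved right until it does.
  by_cases hl2 : w.symm x' + 1 = κ
  · obtain ⟨p, rfl⟩ : ∃ p, κ = p + 1 := ⟨_, hl2.symm⟩
    have hwp : w p = x' := by rw [hlw]; omega
    have e1 : (w * adj (p + 1)) p = x' := by rw [mul_adj_of_ne _ (by omega) (by omega), hwp]
    have e2 : (w * adj (p + 1)) (p + 1) = w (p + 1 + 1) := mul_adj_left _ _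
    have e3 : (w * adj (p + 1)) (p + 1 + 1) = w (p + 1) := mul_adj_right _ _
    obtain ⟨u1, hu1⟩ := exists_weq_cons_kappa hu h
    have hp1 := (hu1.isPath_iff w).1 hu
    have hs1 : steps (p + 1) (w * adj (p + 1)) u1 = (x', w (p + 1)) :: r := by
      have := hu1.steps_eq w
      rw [h] at this
      simpa [steps] using this.symm
    obtain ⟨u2, hu2⟩ := exists_weq_cons (κ := p + 1) (q := p) _ le_rfl hp1.2.2 (by omega)
      (by rw [e1, e2]; omega) (by omega) (by
        rw [hs1, e1, e2]
        refine ⟨?_, ?_, Or.inl rfl⟩ <;> simp only <;> omega)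
    have hp2 := (hu2.isPath_iff _).1 hp1.2.2
    have hs2 : steps (p + 1) (w * adj (p + 1) * adj p) u2 = (x', w (p + 1)) :: r := by
      have := hu2.steps_eq (w * adj (p + 1))
      rw [hs1] at this
      simpa [steps] using this.symm
    obtain ⟨u3, hu3⟩ := exists_weq_cons_kappa (κ := p + 1) hp2.2.2 (r := r) (by
      rw [hs2, mul_adj_right, mul_adj_of_ne _ (x := p + 1 + 1) (by omega) (by omega), e1, e3])
    exact ⟨p, [], u3, rfl, hu1.trans ((hu2.trans (hu3.cons _)).cons _), rfl⟩
  · obtain ⟨q, hq⟩ : ∃ q, w.symm x' = q := ⟨_, rfl⟩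
    have hwq : w q = x' := by rw [← hq]; simp
    have hne : w (q + 1) ≠ w κ ∧ w (q + 1) ≠ w (κ + 1) ∧ w (q + 1) ≠ x' := by
      rw [← hwq]
      simp only [ne_eq, w.injective.eq_iff]
      omega
    have hasc : x' < w (q + 1) := by
      by_contra hlt
      have := compat_of_inverted (κ := κ) (a := w (q + 1)) (b := x') (by omega) hu (by simp; omega)
        (Or.inl (by simp; omega))
      rw [h] at this
      obtain ⟨-, -, h1 | h1 | h1⟩ := this
      · simp only at h1
        omega
      · simp only at h1
        omega
      · exact h1.1 rfl
    obtain ⟨u2, hu2⟩ := exists_weq_cons (κ := κ) (q := q) _ le_rfl hu (by omega) (by rwa [hwq])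
      (by omega) (by
        rw [hwq, h]
        refine ⟨?_, ?_, Or.inr (Or.inr ⟨?_, ?_, Or.inl rfl⟩)⟩ <;> simp only <;> omega)
    have hp2 := (hu2.isPath_iff _).1 hu
    have e1 : (w * adj q) κ = w κ := mul_adj_of_ne _ (by omega) (by omega)
    have e2 : (w * adj q) (κ + 1) = w (κ + 1) := mul_adj_of_ne _ (by omega) (by omega)
    have e3 : (w * adj q).symm x' = q + 1 := by rw [symm_mul_adj, hq, adj_apply, if_pos rfl]
    have hqκ : q ≠ κ := by omega
    have hs2 : steps κ (w * adj q) u2 = (w κ, w (κ + 1)) :: (x', w κ) :: r := by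
      have := hu2.steps_eq w
      rw [h] at this
      simpa [steps, hqκ] using this.symm
    obtain ⟨p, α, β, hp, hαβ, hα⟩ := ih (w := w * adj q) (u := u2) (by omega) hp2.2.2
      (by rw [e1, e2, hs2])
    exact ⟨p, q :: α, β, hp, hu2.trans (hαβ.cons _), by simpa [steps, hqκ] using hα⟩

/-- The permutation reached from `w` by the swaps `u`. -/
def run (w : Equiv.Perm ℕ) (u : List ℕ) : Equiv.Perm ℕ := u.foldl (fun w q => w * adj q) w

theorem steps_append (κ : ℕ) (w : Equiv.Perm ℕ) (α u : List ℕ) :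
    steps κ w (α ++ u) = steps κ w α ++ steps κ (run w α) u := by
  induction α generalizing w with
  | nil => simp [steps, run]
  | cons q α ih => simp [steps, run, ih]

theorem run_append (w : Equiv.Perm ℕ) (α u : List ℕ) : run w (α ++ u) = run (run w α) u := by
  simp [run]

theorem IsPath.of_append {n : ℕ} {w : Equiv.Perm ℕ} {α u : List ℕ} (h : IsPath n w (α ++ u)) :
    IsPath n (run w α) u := by
  induction α generalizing w with
  | nil => exact h
  | cons q α ih => exact ih h.2.2

/-- The letters up to the first of the two swaps are kept as a prefix; there the values `i`, `y`
stand at the wall and `exists_braid_up` applies. -/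
theorem exists_braid_up' {n κ : ℕ} {w : Equiv.Perm ℕ} {u : List ℕ} (hu : IsPath n w u) {i y l : ℕ}
    {s r : List (ℕ × ℕ)} (h : steps κ w u = s ++ (i, y) :: (y, l) :: r) :
    ∃ α β, WEq κ u (α ++ κ :: (κ + 1) :: κ :: β) ∧ steps κ w α = s := by
  induction u generalizing w s with
  | nil => simp [steps] at h
  | cons q u ih =>
    by_cases hq : q = κ
    · subst hq
      rcases s with _ | ⟨t, s⟩
      · have h' := h
        simp only [steps, if_true, List.singleton_append, List.nil_append, List.cons.injEq,
          Prod.mk.injEq] at h'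
        obtain ⟨⟨rfl, rfl⟩, -⟩ := h'
        exact exists_braid_up _ (Nat.lt_succ_self _) hu h
      · simp only [steps, if_true, List.cons_append, List.cons.injEq] at h
        obtain ⟨α, β, hαβ, hα⟩ := ih hu.2.2 h.2
        exact ⟨q :: α, β, hαβ.cons _, by simp [steps, hα, h.1]⟩
    · obtain ⟨α, β, hαβ, hα⟩ := ih hu.2.2 (by simpa [steps, hq] using h)
      exact ⟨q :: α, β, hαβ.cons _, by simp [steps, hα, hq]⟩

theorem exists_braid_down' {n κ : ℕ} {w : Equiv.Perm ℕ} {u : List ℕ} (hu : IsPath n w u)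
    {x x' y : ℕ} {s r : List (ℕ × ℕ)} (h : steps κ w u = s ++ (x, y) :: (x', x) :: r) :
    ∃ p α β, κ = p + 1 ∧ WEq κ u (α ++ κ :: p :: κ :: β) ∧ steps κ w α = s := by
  induction u generalizing w s with
  | nil => simp [steps] at h
  | cons q u ih =>
    by_cases hq : q = κ
    · subst hq
      rcases s with _ | ⟨t, s⟩
      · have h' := h
        simp only [steps, if_true, List.singleton_append, List.nil_append, List.cons.injEq,
          Prod.mk.injEq] at h'
        obtain ⟨⟨rfl, rfl⟩, -⟩ := h'
        exact exists_braid_down (q + 1) (by omega) hu h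
      · simp only [steps, if_true, List.cons_append, List.cons.injEq] at h
        obtain ⟨p, α, β, hp, hαβ, hα⟩ := ih hu.2.2 h.2
        exact ⟨p, q :: α, β, hp, hαβ.cons _, by simp [steps, hα, h.1]⟩
    · obtain ⟨p, α, β, hp, hαβ, hα⟩ := ih hu.2.2 (by simpa [steps, hq] using h)
      exact ⟨p, q :: α, β, hp, hαβ.cons _, by simp [steps, hα, hq]⟩

end ZonoHyper
-- The tiling of a word
noncomputable section
namespace ZonoHyper

open Finset

/-- The permutation preserves `{0, ..., n - 1}`. -/
def Fixes (n : ℕ) (w : Equiv.Perm ℕ) : Prop := ∀ x, w x < n ↔ x < n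

theorem fixes_one (n : ℕ) : Fixes n 1 := fun _ => Iff.rfl

theorem Fixes.mul_adj {n : ℕ} {w : Equiv.Perm ℕ} (hw : Fixes n w) {q : ℕ} (hq : q + 1 < n) :
    Fixes n (w * adj q) := by
  intro x
  rw [Equiv.Perm.mul_apply, hw, adj_apply]
  split_ifs <;> omega

theorem Fixes.symm_lt {n : ℕ} {w : Equiv.Perm ℕ} (hw : Fixes n w) (x : ℕ) :
    w.symm x < n ↔ x < n := by
  rw [← hw, Equiv.apply_symm_apply]

variable {n : ℕ}

/-- The set of the first `m` values of a permutation. -/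
def pre (n : ℕ) (w : Equiv.Perm ℕ) (m : ℕ) : Finset (Fin n) := univ.filter fun v => w.symm v < m

theorem mem_pre {w : Equiv.Perm ℕ} {m : ℕ} {v : Fin n} : v ∈ pre n w m ↔ w.symm v < m := by
  simp [pre]

/-- The tile of the swap of the positions `q` and `q + 1`. -/
def tileAt (n : ℕ) (w : Equiv.Perm ℕ) (q : ℕ) : Finset (Fin n) × Finset (Fin n) :=
  (pre n w q, univ.filter fun v => w.symm v = q ∨ w.symm v = q + 1)

theorem tileAt_snd {w : Equiv.Perm ℕ} {q : ℕ} {i j : Fin n} (hi : w q = i) (hj : w (q + 1) = j) :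
    (tileAt n w q).2 = {i, j} := by
  ext v
  simp only [tileAt, mem_filter, mem_univ, true_and, mem_insert, mem_singleton,
    Equiv.symm_apply_eq, hi, hj, Fin.ext_iff]

/-- The tiles of a sequence of swaps. -/
def tilesOf (n : ℕ) : Equiv.Perm ℕ → List ℕ → List (Finset (Fin n) × Finset (Fin n))
  | _, [] => []
  | w, q :: u => tileAt n w q :: tilesOf n (w * adj q) u

theorem tilesOf_append (w : Equiv.Perm ℕ) (α u : List ℕ) :
    tilesOf n w (α ++ u) = tilesOf n w α ++ tilesOf n (run w α) u := by
  induction α generalizing w with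
  | nil => simp [tilesOf, run]
  | cons q α ih => simp [tilesOf, run, ih]

theorem exists_swap {w : Equiv.Perm ℕ} (hw : Fixes n w) {q : ℕ} (hq : q + 1 < n) :
    ∃ i j : Fin n, w q = i ∧ w (q + 1) = j ∧ i ≠ j := by
  refine ⟨⟨w q, (hw q).2 (by omega)⟩, ⟨w (q + 1), (hw _).2 hq⟩, rfl, rfl, ?_⟩
  simp

/-- `x` arises from `y` by moving the amount `c` from the coordinate `i` to the coordinate `j`. -/
def Shift (i j : Fin n) (c : ℝ) (y x : Fin n → ℝ) : Prop :=
  x i = y i - c ∧ x j = y j + c ∧ ∀ v, v ≠ i → v ≠ j → x v = y v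

theorem Shift.sum_eq {i j : Fin n} {c : ℝ} {y x : Fin n → ℝ} (h : Shift i j c y x) (hij : i ≠ j)
    (b : Fin n → ℝ) : ∑ v, b v * x v = ∑ v, b v * y v + c * (b j - b i) := by
  have : ∀ v, b v * x v =
      b v * y v + ((if v = i then -(c * b i) else 0) + if v = j then c * b j else 0) := by
    intro v
    by_cases hi : v = i
    · subst hi
      rw [h.1, if_pos rfl, if_neg hij]
      ring
    by_cases hj : v = j
    · subst hj
      rw [h.2.1, if_pos rfl, if_neg hi]
      ring
    · rw [h.2.2 v hi hj, if_neg hi, if_neg hj]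
      ring
  simp only [this, sum_add_distrib, sum_ite_eq', mem_univ, if_true]
  ring

theorem Shift.sum_eq' {i j : Fin n} {c : ℝ} {y x : Fin n → ℝ} (h : Shift i j c y x) (hij : i ≠ j) :
    ∑ v, x v = ∑ v, y v := by
  have := h.sum_eq hij 1
  simpa using this

theorem Shift.eq {i j : Fin n} {c : ℝ} {y x x' : Fin n → ℝ} (h : Shift i j c y x)
    (h' : Shift i j c y x') : x = x' := by
  funext v
  by_cases hi : v = i
  · rw [hi, h.1, h'.1]
  by_cases hj : v = j
  · rw [hj, h.2.1, h'.2.1]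
  rw [h.2.2 v hi hj, h'.2.2 v hi hj]

theorem Shift.eq_of_zero {i j : Fin n} {y x : Fin n → ℝ} (h : Shift i j 0 y x) : y = x :=
  Shift.eq (i := i) (j := j) (c := 0) (y := y) ⟨by simp, by simp, fun _ _ _ => rfl⟩ h

/-- Truncation to the unit interval. -/
def clamp (t : ℝ) : ℝ := max 0 (min 1 t)

theorem clamp_nonneg (t : ℝ) : 0 ≤ clamp t := le_max_left _ _
theorem clamp_le_one (t : ℝ) : clamp t ≤ 1 := max_le zero_le_one (min_le_left _ _)
theorem clamp_of_one_le {t : ℝ} (h : 1 ≤ t) : clamp t = 1 := by simp [clamp, h]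
theorem clamp_of_nonpos {t : ℝ} (h : t ≤ 0) : clamp t = 0 := by
  rw [clamp, min_eq_right (by linarith), max_eq_left h]
theorem clamp_of_mem {t : ℝ} (h : 0 ≤ t) (h' : t ≤ 1) : clamp t = t := by
  rw [clamp, min_eq_right h', max_eq_right h]
theorem clamp_mono {s t : ℝ} (h : s ≤ t) : clamp s ≤ clamp t :=
  max_le_max le_rfl (min_le_min le_rfl h)

/-- The point at height `h` of the lift to the cube of the monotone path of a permutation. -/
def pathPoint (n : ℕ) (w : Equiv.Perm ℕ) (h : ℝ) : Fin n → ℝ := fun v => clamp (h - w.symm v)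

theorem pathPoint_mem (w : Equiv.Perm ℕ) (h : ℝ) : pathPoint n w h ∈ unitCube n :=
  fun _ => ⟨clamp_nonneg _, clamp_le_one _⟩

theorem pathPoint_of_lt {w : Equiv.Perm ℕ} {h : ℝ} {v : Fin n} {m : ℕ} (hm : (m : ℝ) ≤ h)
    (hv : w.symm v < m) : pathPoint n w h v = 1 := by
  apply clamp_of_one_le
  have : ((w.symm v + 1 : ℕ) : ℝ) ≤ m := Nat.cast_le.2 hv
  push_cast at this
  linarith

theorem pathPoint_of_le {w : Equiv.Perm ℕ} {h : ℝ} {v : Fin n} {m : ℕ} (hm : h ≤ (m : ℝ))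
    (hv : m ≤ w.symm v) : pathPoint n w h v = 0 := by
  apply clamp_of_nonpos
  have : (m : ℝ) ≤ (w.symm v : ℕ) := Nat.cast_le.2 hv
  linarith

theorem sum_clamp (n : ℕ) {h : ℝ} (h0 : 0 ≤ h) :
    ∑ p ∈ range n, clamp (h - p) = min h n := by
  induction n with
  | zero => simp [h0]
  | succ n ih =>
    rw [sum_range_succ, ih]
    push_cast
    rcases le_total h n with h1 | h1
    · rw [clamp_of_nonpos (by linarith), min_eq_left h1, min_eq_left (by linarith), add_zero]
    rcases le_total h (n + 1) with h2 | h2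
    · rw [clamp_of_mem (by linarith) (by linarith), min_eq_right h1, min_eq_left h2]
      ring
    · rw [clamp_of_one_le (by linarith), min_eq_right h1, min_eq_right h2]

theorem sum_pathPoint {w : Equiv.Perm ℕ} (hw : Fixes n w) {h : ℝ} (h0 : 0 ≤ h) (hn : h ≤ n) :
    ∑ v, pathPoint n w h v = h := by
  have h1 : ∑ v, pathPoint n w h v = ∑ v ∈ range n, clamp (h - (w.symm v : ℕ)) :=
    Fin.sum_univ_eq_sum_range (fun v => clamp (h - (w.symm v : ℕ))) n
  rw [h1, sum_equiv w.symm (t := range n) (g := fun p => clamp (h - (p : ℕ)))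
    (by simp [hw.symm_lt]) (by simp), sum_clamp n h0, min_eq_left hn]

/-- The two paths bound the parallelogram of the swap, between the heights `q` and `q + 2`. The
amount `d` is its width at height `h`, measured in units of `a j - a i`. -/
theorem pathPoint_mul_adj {w : Equiv.Perm ℕ} {q : ℕ} {i j : Fin n} (hi : w q = i)
    (hj : w (q + 1) = j) (h : ℝ) : ∃ d, 0 ≤ d ∧ Shift i j d (pathPoint n w h)
      (pathPoint n (w * adj q) h) ∧ (h ≤ q ∨ q + 2 ≤ h → d = 0) := by
  have si : w.symm i = q := by rw [← hi]; simp
  have sj : w.symm j = q + 1 := by rw [← hj]; simp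
  refine ⟨clamp (h - q) - clamp (h - (q + 1 : ℕ)), ?_, ⟨?_, ?_, ?_⟩, ?_⟩
  · rw [sub_nonneg]
    apply clamp_mono
    push_cast
    linarith
  · simp [pathPoint, symm_mul_adj, si, adj_apply]
  · simp [pathPoint, symm_mul_adj, sj, adj_apply]
  · intro v hvi hvj
    have h1 : w.symm v ≠ q := by rw [ne_eq, Equiv.symm_apply_eq, hi]; exact mt Fin.ext hvi
    have h2 : w.symm v ≠ q + 1 := by rw [ne_eq, Equiv.symm_apply_eq, hj]; exact mt Fin.ext hvj
    simp [pathPoint, symm_mul_adj, adj_apply, h1, h2]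
  · push_cast
    rintro (h1 | h1)
    · rw [clamp_of_nonpos (by linarith), clamp_of_nonpos (by linarith), sub_zero]
    · rw [clamp_of_one_le (by linarith), clamp_of_one_le (by linarith), sub_self]

theorem mem_face_iff {w : Equiv.Perm ℕ} {q : ℕ} {x : Fin n → ℝ} :
    x ∈ cubeFace (tileAt n w q).1 (tileAt n w q).2 ↔ x ∈ unitCube n ∧
      (∀ v : Fin n, w.symm v < q → x v = 1) ∧ ∀ v : Fin n, q + 1 < w.symm v → x v = 0 := by
  refine and_congr_right fun _ => and_congr ?_ ?_
  · simp [tileAt, mem_pre]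
  · refine forall_congr' fun v => ?_
    simp only [tileAt, mem_pre, mem_filter, mem_univ, true_and]
    constructor
    · intro h hv
      exact h (by omega) (by omega)
    · intro h h1 h2
      exact h (by omega)

/-- The points of the face of a swap lie between the lifts of the two paths. -/
theorem exists_shift_of_mem_face {w : Equiv.Perm ℕ} (hw : Fixes n w) {q : ℕ} (hq : q + 1 < n)
    {i j : Fin n} (hi : w q = i) (hj : w (q + 1) = j) (hij : i ≠ j) {x : Fin n → ℝ}
    (hx : x ∈ cubeFace (tileAt n w q).1 (tileAt n w q).2) :
    ∃ c d, 0 ≤ c ∧ 0 ≤ d ∧ Shift i j c (pathPoint n w (∑ v, x v)) x ∧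
      Shift i j d x (pathPoint n (w * adj q) (∑ v, x v)) := by
  rw [mem_face_iff] at hx
  obtain ⟨hc, h1, h0⟩ := hx
  have si : w.symm i = q := by rw [← hi]; simp
  have sj : w.symm j = q + 1 := by rw [← hj]; simp
  obtain ⟨i0, i1⟩ := hc i
  obtain ⟨j0, j1⟩ := hc j
  set h : ℝ := q + x i + x j with hh
  have hqn : ((q + 2 : ℕ) : ℝ) ≤ n := Nat.cast_le.2 hq
  push_cast at hqn
  have hq0 : (0 : ℝ) ≤ q := Nat.cast_nonneg q
  -- At a given height the path of `w` fills `i` first and only the excess goes to `j`.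
  have gi : pathPoint n w h i = min 1 (x i + x j) := by
    rw [pathPoint, si, clamp, show h - q = x i + x j by rw [hh]; ring,
      max_eq_right (le_min zero_le_one (by linarith))]
  have gj : pathPoint n w h j = max 0 (x i + x j - 1) := by
    rw [pathPoint, sj, clamp]
    push_cast
    rw [show h - (q + 1) = x i + x j - 1 by rw [hh]; ring, min_eq_right (by linarith)]
  have gij : pathPoint n w h i + pathPoint n w h j = x i + x j := by
    rw [gi, gj]
    rcases le_total 1 (x i + x j) with h' | h'
    · rw [min_eq_left h', max_eq_right (by linarith)]
      ring
    · rw [min_eq_right h', max_eq_left (by linarith)]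
      ring
  have gv : ∀ v, v ≠ i → v ≠ j → x v = pathPoint n w h v := by
    intro v hvi hvj
    have c1 : w.symm v ≠ q := by rw [ne_eq, Equiv.symm_apply_eq, hi]; exact mt Fin.ext hvi
    have c2 : w.symm v ≠ q + 1 := by rw [ne_eq, Equiv.symm_apply_eq, hj]; exact mt Fin.ext hvj
    rcases lt_or_ge (w.symm v) q with h' | h'
    · rw [h1 v h', pathPoint_of_lt (m := q) (by linarith) h']
    · rw [h0 v (by omega), pathPoint_of_le (m := q + 2) (by push_cast; linarith) (by omega)]
  have hs : Shift i j (pathPoint n w h i - x i) (pathPoint n w h) x :=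
    ⟨by ring, by linarith, gv⟩
  have hsum : ∑ v, x v = h := by
    rw [hs.sum_eq' hij, sum_pathPoint hw (by linarith) (by linarith)]
  rw [hsum]
  obtain ⟨d, -, hd, -⟩ := pathPoint_mul_adj hi hj h
  refine ⟨_, d - (pathPoint n w h i - x i), ?_, ?_, hs, ⟨?_, ?_, ?_⟩⟩
  · rw [gi, sub_nonneg]
    exact le_min i1 (by linarith)
  · have e1 := hd.1
    have : pathPoint n (w * adj q) h i = max 0 (x i + x j - 1) := by
      rw [pathPoint, symm_mul_adj, si, adj_apply, if_pos rfl, ← sj]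
      exact gj
    have h3 : max 0 (x i + x j - 1) ≤ x i := max_le i0 (by linarith)
    linarith
  · rw [hd.1]
    ring
  · rw [hd.2.1]
    linarith
  · intro v hvi hvj
    rw [hd.2.2 v hvi hvj, gv v hvi hvj]

theorem proj_apply (a x : Fin n → ℝ) : proj a x = (∑ v, a v * x v, ∑ v, x v) := by
  simp only [proj, Fintype.linearCombination_apply, vec]
  ext
  · simp [Prod.fst_sum, mul_comm]
  · simp [Prod.snd_sum]

theorem proj_eq_iff (a x y : Fin n → ℝ) : proj a x = proj a y ↔
    ∑ v, a v * x v = ∑ v, a v * y v ∧ ∑ v, x v = ∑ v, y v := by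
  rw [proj_apply, proj_apply, Prod.mk.injEq]

variable {a : Fin n → ℝ} (ha : StrictMono a)
include ha

/-- An ascent swap moves mass from `i` to the larger index `j`, and `a` increases: the path moves to
the right, strictly so at each height where its lift changes. -/
theorem sum_pathPoint_mul_adj {w : Equiv.Perm ℕ} (hw : Fixes n w) {q : ℕ} (hq : q + 1 < n)
    (hasc : w q < w (q + 1)) (h : ℝ) :
    ∑ v, a v * pathPoint n w h v ≤ ∑ v, a v * pathPoint n (w * adj q) h v ∧
    (∑ v, a v * pathPoint n w h v = ∑ v, a v * pathPoint n (w * adj q) h v →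
      pathPoint n w h = pathPoint n (w * adj q) h) := by
  obtain ⟨i, j, hi, hj, hij⟩ := exists_swap hw hq
  obtain ⟨d, hd, hs, -⟩ := pathPoint_mul_adj hi hj h
  have haij : 0 < a j - a i := sub_pos.2 (ha (by rw [Fin.lt_def, ← hi, ← hj]; exact hasc))
  rw [hs.sum_eq hij]
  refine ⟨by nlinarith, fun h0 => ?_⟩
  have : d = 0 := by
    have : d * (a j - a i) = 0 := by linarith
    rcases mul_eq_zero.1 this with h | h
    · exact h
    · exact absurd h haij.ne'
  subst this
  exact hs.eq_of_zero

/-- A point of the face is reached from the old path, and the new path from it, by nonnegative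
shifts from `i` to `j`. Such a shift keeps the abscissa only if it is zero. -/
theorem sum_le_of_mem_face {w : Equiv.Perm ℕ} (hw : Fixes n w) {q : ℕ} (hq : q + 1 < n)
    (hasc : w q < w (q + 1)) {x : Fin n → ℝ}
    (hx : x ∈ cubeFace (tileAt n w q).1 (tileAt n w q).2) :
    (∑ v, a v * pathPoint n w (∑ v, x v) v ≤ ∑ v, a v * x v ∧
    (∑ v, a v * pathPoint n w (∑ v, x v) v = ∑ v, a v * x v →
      pathPoint n w (∑ v, x v) = x)) ∧
    (∑ v, a v * x v ≤ ∑ v, a v * pathPoint n (w * adj q) (∑ v, x v) v ∧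
    (∑ v, a v * x v = ∑ v, a v * pathPoint n (w * adj q) (∑ v, x v) v →
      x = pathPoint n (w * adj q) (∑ v, x v))) := by
  obtain ⟨i, j, hi, hj, hij⟩ := exists_swap hw hq
  obtain ⟨c, d, hc, hd, hs, hs'⟩ := exists_shift_of_mem_face hw hq hi hj hij hx
  have haij : 0 < a j - a i := sub_pos.2 (ha (by rw [Fin.lt_def, ← hi, ← hj]; exact hasc))
  have key : ∀ {c : ℝ} {y z : Fin n → ℝ}, 0 ≤ c → Shift i j c y z →
      (∑ v, a v * y v ≤ ∑ v, a v * z v ∧ (∑ v, a v * y v = ∑ v, a v * z v → y = z)) := by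
    intro c y z hc hs
    rw [hs.sum_eq hij]
    refine ⟨by nlinarith, fun h0 => ?_⟩
    have : c = 0 := by
      have : c * (a j - a i) = 0 := by linarith
      rcases mul_eq_zero.1 this with h | h
      · exact h
      · exact absurd h haij.ne'
    subst this
    exact hs.eq_of_zero
  exact ⟨key hc hs, key hd hs'⟩

/-- Each swap moves the path to the right, so every later tile lies to the right of the current path
and meets it only in points with the same lift. -/
theorem sum_le_of_mem_tilesOf {w : Equiv.Perm ℕ} (hw : Fixes n w) {u : List ℕ}
    (hu : IsPath n w u) {t : Finset (Fin n) × Finset (Fin n)} (ht : t ∈ tilesOf n w u)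
    {x : Fin n → ℝ} (hx : x ∈ cubeFace t.1 t.2) :
    ∑ v, a v * pathPoint n w (∑ v, x v) v ≤ ∑ v, a v * x v ∧
    (∑ v, a v * pathPoint n w (∑ v, x v) v = ∑ v, a v * x v →
      pathPoint n w (∑ v, x v) = x) := by
  induction u generalizing w with
  | nil => simp [tilesOf] at ht
  | cons q u ih =>
    rcases List.mem_cons.1 ht with rfl | ht
    · exact (sum_le_of_mem_face ha hw hu.1 hu.2.1 hx).1
    · have h1 := ih (hw.mul_adj hu.1) hu.2.2 ht
      have h2 := sum_pathPoint_mul_adj ha hw hu.1 hu.2.1 (∑ v, x v)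
      refine ⟨h2.1.trans h1.1, fun h => ?_⟩
      rw [h2.2 (le_antisymm h2.1 (h ▸ h1.1)), h1.2 (le_antisymm h1.1 (h ▸ h2.1))]

/-- The faces of a sequence of swaps project injectively. -/
theorem eq_of_proj_eq {w : Equiv.Perm ℕ} (hw : Fixes n w) {u : List ℕ} (hu : IsPath n w u)
    {s t : Finset (Fin n) × Finset (Fin n)} (hs : s ∈ tilesOf n w u) (ht : t ∈ tilesOf n w u)
    {x y : Fin n → ℝ} (hx : x ∈ cubeFace s.1 s.2) (hy : y ∈ cubeFace t.1 t.2)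
    (hxy : proj a x = proj a y) : x = y := by
  induction u generalizing w with
  | nil => simp [tilesOf] at ht
  | cons q u ih =>
    -- The path after the first swap separates the first tile from all later ones. Points with a
    -- common image both lie over this path and so both equal its lift.
    have key : ∀ {t} {x y : Fin n → ℝ}, t ∈ tilesOf n (w * adj q) u →
        x ∈ cubeFace (tileAt n w q).1 (tileAt n w q).2 → y ∈ cubeFace t.1 t.2 →
        proj a x = proj a y → x = y := by
      intro t x y ht hx hy hxy
      rw [proj_eq_iff] at hxy
      have h1 := (sum_le_of_mem_face ha hw hu.1 hu.2.1 hx).2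
      have h2 := sum_le_of_mem_tilesOf ha (hw.mul_adj hu.1) hu.2.2 ht hy
      rw [← hxy.2, ← hxy.1] at h2
      rw [h1.2 (le_antisymm h1.1 h2.1), h2.2 (le_antisymm h2.1 h1.1)]
    rcases List.mem_cons.1 hs with rfl | hs <;> rcases List.mem_cons.1 ht with rfl | ht
    · rw [proj_eq_iff] at hxy
      obtain ⟨i, j, hi, hj, hij⟩ := exists_swap hw hu.1
      obtain ⟨c, d, hc, hd, h1, -⟩ := exists_shift_of_mem_face hw hu.1 hi hj hij hx
      obtain ⟨c', d', hc', hd', h2, -⟩ := exists_shift_of_mem_face hw hu.1 hi hj hij hy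
      have haij : 0 < a j - a i :=
        sub_pos.2 (ha (by rw [Fin.lt_def, ← hi, ← hj]; exact hu.2.1))
      have := hxy.1
      rw [h1.sum_eq hij, h2.sum_eq hij, hxy.2] at this
      have hcc : c = c' := mul_right_cancel₀ haij.ne' (by linarith)
      rw [← hxy.2, ← hcc] at h2
      exact h1.eq h2
    · exact key ht hx hy hxy
    · exact (key hs hy hx hxy.symm).symm
    · exact ih (hw.mul_adj hu.1) hu.2.2 hs ht

theorem exists_mem_face_of_between {w : Equiv.Perm ℕ} (hw : Fixes n w) {q : ℕ} (hq : q + 1 < n)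
    (hasc : w q < w (q + 1)) {h X : ℝ} (h1 : (q : ℝ) ≤ h) (h2 : h ≤ q + 2)
    (hX : ∑ v, a v * pathPoint n w h v ≤ X)
    (hX' : X ≤ ∑ v, a v * pathPoint n (w * adj q) h v) :
    (X, h) ∈ tile a (tileAt n w q).1 (tileAt n w q).2 := by
  obtain ⟨i, j, hi, hj, hij⟩ := exists_swap hw hq
  obtain ⟨d, hd, hs, -⟩ := pathPoint_mul_adj hi hj h
  have haij : 0 < a j - a i := sub_pos.2 (ha (by rw [Fin.lt_def, ← hi, ← hj]; exact hasc))
  have si : w.symm i = q := by rw [← hi]; simp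
  have sj : w.symm j = q + 1 := by rw [← hj]; simp
  set g := pathPoint n w h with hg
  -- The shift from `i` to `j` that carries the abscissa of the path point to `X`.
  set c := (X - ∑ v, a v * g v) / (a j - a i) with hc
  have hc0 : 0 ≤ c := div_nonneg (by linarith) haij.le
  have hcd : c ≤ d := by
    rw [hs.sum_eq hij] at hX'
    rw [hc, div_le_iff₀ haij]
    linarith
  set y : Fin n → ℝ := fun v => if v = i then g i - c else if v = j then g j + c else g v with hy
  have hgy : Shift i j c g y := ⟨by simp [hy], by simp [hy, hij.symm], fun v h1 h2 => by
    simp [hy, h1, h2]⟩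
  have g0 := pathPoint_mem (n := n) w h
  have g1 := pathPoint_mem (n := n) (w * adj q) h
  have hqn : ((q + 2 : ℕ) : ℝ) ≤ n := Nat.cast_le.2 hq
  push_cast at hqn
  have hq0 : (0 : ℝ) ≤ q := Nat.cast_nonneg q
  refine ⟨y, mem_face_iff.2 ⟨fun v => ?_, fun v hv => ?_, fun v hv => ?_⟩, ?_⟩
  · by_cases hvi : v = i
    · rw [hvi, hgy.1]
      have := (g1 i).1
      rw [hs.1] at this
      exact ⟨by linarith, by linarith [(g0 i).2]⟩
    by_cases hvj : v = j
    · rw [hvj, hgy.2.1]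
      have := (g1 j).2
      rw [hs.2.1] at this
      exact ⟨by linarith [(g0 j).1], by linarith⟩
    rw [hgy.2.2 v hvi hvj]
    exact g0 v
  · rw [hgy.2.2 v (by rintro rfl; omega) (by rintro rfl; omega)]
    exact pathPoint_of_lt h1 hv
  · rw [hgy.2.2 v (by rintro rfl; omega) (by rintro rfl; omega)]
    exact pathPoint_of_le (m := q + 2) (by push_cast; exact h2) (by omega)
  · rw [proj_apply, hgy.sum_eq hij, hgy.sum_eq' hij, hg, sum_pathPoint hw (by linarith)
      (by linarith), hc, div_mul_cancel₀ _ haij.ne']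
    simp [hg]

/-- Discrete intermediate value argument: the swap that takes the path at height `h` past `X` has a
tile containing the point. The second alternative is for points on the initial path, which no swap
has to pass. -/
theorem mem_tile_of_between {w : Equiv.Perm ℕ} (hw : Fixes n w) {u : List ℕ}
    (hu : IsPath n w u) {h X : ℝ} (hX : ∑ v, a v * pathPoint n w h v ≤ X)
    (hX' : X ≤ ∑ v, a v * pathPoint n (run w u) h v) :
    (∃ t ∈ tilesOf n w u, (X, h) ∈ tile a t.1 t.2) ∨ X = ∑ v, a v * pathPoint n w h v := by
  induction u generalizing w with
  | nil => exact Or.inr (le_antisymm hX' hX)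
  | cons q u ih =>
    rcases le_or_gt X (∑ v, a v * pathPoint n (w * adj q) h v) with h1 | h1
    · by_cases hq : (q : ℝ) ≤ h ∧ h ≤ q + 2
      · exact Or.inl ⟨_, List.mem_cons_self,
          exists_mem_face_of_between ha hw hu.1 hu.2.1 hq.1 hq.2 hX h1⟩
      · right
        obtain ⟨i, j, hi, hj, hij⟩ := exists_swap hw hu.1
        obtain ⟨d, -, hs, hd⟩ := pathPoint_mul_adj hi hj h
        rw [hs.sum_eq hij, hd (by
          by_contra hcon
          push Not at hcon
          exact hq ⟨hcon.1.le, hcon.2.le⟩)] at h1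
        linarith
    · rcases ih (hw.mul_adj hu.1) hu.2.2 h1.le hX' with ⟨t, ht, h2⟩ | h2
      · exact Or.inl ⟨t, List.mem_cons_of_mem _ ht, h2⟩
      · exact absurd h2 h1.ne'

omit ha in
theorem pathPoint_mem_face {w : Equiv.Perm ℕ} {q : ℕ} {h : ℝ} (h1 : (q : ℝ) ≤ h)
    (h2 : h ≤ q + 2) :
    pathPoint n w h ∈ cubeFace (tileAt n w q).1 (tileAt n w q).2 :=
  mem_face_iff.2 ⟨pathPoint_mem _ _, fun _ hv => pathPoint_of_lt h1 hv,
    fun _ hv => pathPoint_of_le (m := q + 2) (by push_cast; exact h2) (by omega)⟩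

omit ha in
theorem pathPoint_mem_face' {w : Equiv.Perm ℕ} {q : ℕ} {h : ℝ} (h1 : (q : ℝ) ≤ h)
    (h2 : h ≤ q + 2) :
    pathPoint n (w * adj q) h ∈ cubeFace (tileAt n w q).1 (tileAt n w q).2 :=
  mem_face_iff.2 ⟨pathPoint_mem _ _,
    fun v hv => pathPoint_of_lt h1 (by
      rw [symm_mul_adj, adj_apply]; split_ifs <;> omega),
    fun v hv => pathPoint_of_le (m := q + 2) (by push_cast; exact h2) (by
      rw [symm_mul_adj, adj_apply]; split_ifs <;> omega)⟩

omit ha in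
theorem pathPoint_mul_adj_of_not_mem {w : Equiv.Perm ℕ} (hw : Fixes n w) {q : ℕ}
    (hq : q + 1 < n) {h : ℝ} (h1 : h ≤ q ∨ q + 2 ≤ h) :
    pathPoint n (w * adj q) h = pathPoint n w h := by
  obtain ⟨i, j, hi, hj, hij⟩ := exists_swap hw hq
  obtain ⟨d, -, hs, hd⟩ := pathPoint_mul_adj hi hj h
  rw [hd h1] at hs
  exact hs.eq_of_zero.symm

omit ha in
/-- The part of the path of `w` near an ascent is covered by the later tiles. -/
theorem exists_face_of_ascent {w : Equiv.Perm ℕ} (hw : Fixes n w) {u : List ℕ}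
    (hu : IsPath n w u) {p : ℕ} (hp : p + 1 < n) (hasc : w p < w (p + 1)) {h : ℝ}
    (h1 : (p : ℝ) ≤ h) (h2 : h ≤ p + 2) :
    ∃ t ∈ tilesOf n w u, pathPoint n w h ∈ cubeFace t.1 t.2 := by
  induction u generalizing w with
  | nil => exact absurd (hu p hp) (by omega)
  | cons q u ih =>
    by_cases hq : (q : ℝ) ≤ h ∧ h ≤ q + 2
    · exact ⟨_, List.mem_cons_self, pathPoint_mem_face hq.1 hq.2⟩
    rw [not_and_or, not_le, not_le] at hq
    have hne : q ≠ p := by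
      rintro rfl
      rcases hq with h | h <;> linarith
    -- A swap beside `p` lowers the value at `p` or raises the one at `p + 1`, so the ascent at `p`
    -- survives every swap whose tile misses the height `h`.
    have hasc' : (w * adj q) p < (w * adj q) (p + 1) := by
      have h0 := hu.2.1
      simp only [mul_adj_apply]
      rcases lt_trichotomy (q + 1) p with h | h | h
      · rw [if_neg (by omega), if_neg (by omega), if_neg (by omega), if_neg (by omega)]
        exact hasc
      · subst h
        rw [if_neg (by omega), if_pos rfl, if_neg (by omega), if_neg (by omega)]
        omega
      · by_cases h' : q = p + 1
        · subst h'
          rw [if_neg (by omega), if_neg (by omega), if_pos rfl]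
          omega
        · rw [if_neg (by omega), if_neg (by omega), if_neg (by omega), if_neg (by omega)]
          exact hasc
    obtain ⟨t, ht, h3⟩ := ih (hw.mul_adj hu.1) hu.2.2 hasc'
    rw [pathPoint_mul_adj_of_not_mem hw hu.1 (by
      rcases hq with h | h
      · exact Or.inl h.le
      · exact Or.inr h.le)] at h3
    exact ⟨t, List.mem_cons_of_mem _ ht, h3⟩

omit ha in
/-- Among the points of the cube of given height, the point of the path of `w` minimizes any
function that increases along `w`. -/
theorem sum_pathPoint_le {w : Equiv.Perm ℕ} (hw : Fixes n w) {b : Fin n → ℝ}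
    (hb : ∀ v v' : Fin n, w.symm v < w.symm v' → b v < b v') {x : Fin n → ℝ}
    (hx : x ∈ unitCube n) {h : ℝ} (h0 : 0 ≤ h) (hn : h ≤ n) (hsum : ∑ v, x v = h) :
    ∑ v, b v * pathPoint n w h v ≤ ∑ v, b v * x v ∧
    (∑ v, b v * pathPoint n w h v = ∑ v, b v * x v → pathPoint n w h = x) := by
  rcases Nat.eq_zero_or_pos n with rfl | hpos
  · exact ⟨by simp, fun _ => Subsingleton.elim _ _⟩
  obtain ⟨p, hpn, hp1, hp2⟩ : ∃ p : ℕ, p < n ∧ (p : ℝ) ≤ h ∧ h ≤ p + 1 := by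
    rcases lt_or_eq_of_le hn with hlt | rfl
    · exact ⟨⌊h⌋₊, (Nat.floor_lt h0).2 hlt, Nat.floor_le h0, (Nat.lt_floor_add_one h).le⟩
    · refine ⟨n - 1, by omega, Nat.cast_le.2 (by omega), ?_⟩
      rw [← Nat.cast_add_one, Nat.sub_add_cancel hpos]
  -- `z` is the value being filled at height `h`. As the heights agree, subtracting the constant `b
  -- z` from `b` does not change the difference of the two sums, and it makes each term nonnegative.
  set z : Fin n := ⟨w p, (hw p).2 hpn⟩ with hz
  have sz : w.symm z = p := by simp [hz]
  set g := pathPoint n w h with hg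
  have hgsum : ∑ v, g v = h := sum_pathPoint hw h0 hn
  have hterm : ∀ v, 0 ≤ (b v - b z) * (x v - g v) := by
    intro v
    rcases lt_trichotomy (w.symm v) p with h' | h' | h'
    · have := hb v z (by rwa [sz])
      rw [hg, pathPoint_of_lt hp1 h']
      nlinarith [(hx v).2]
    · have : v = z := Fin.ext (w.symm.injective (by rw [h', sz]))
      simp [this]
    · have := hb z v (by rwa [sz])
      rw [hg, pathPoint_of_le (m := p + 1) (by push_cast; exact hp2) h']
      nlinarith [(hx v).1]
  have hS : ∑ v, (b v - b z) * (x v - g v) = ∑ v, b v * x v - ∑ v, b v * g v := by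
    have : ∀ v, (b v - b z) * (x v - g v) = b v * x v - b v * g v - b z * (x v - g v) :=
      fun v => by ring
    simp only [this, sum_sub_distrib, ← mul_sum, hsum, hgsum]
    ring
  have hS0 := sum_nonneg fun v (_ : v ∈ univ) => hterm v
  refine ⟨by linarith, fun heq => ?_⟩
  have hz0 := (sum_eq_zero_iff_of_nonneg fun v (_ : v ∈ univ) => hterm v).1 (by rw [hS, heq, sub_self])
  have hne : ∀ v, v ≠ z → g v = x v := by
    intro v hv
    have hvp : w.symm v ≠ w.symm z := fun h => hv (Fin.ext (w.symm.injective h))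
    have hbv : b v - b z ≠ 0 := by
      rcases lt_or_gt_of_ne hvp with h | h
      · exact (sub_neg.2 (hb _ _ h)).ne
      · exact (sub_pos.2 (hb _ _ h)).ne'
    rcases mul_eq_zero.1 (hz0 v (mem_univ v)) with h | h
    · exact absurd h hbv
    · linarith
  funext v
  by_cases hv : v = z
  · have h1 := add_sum_erase univ x (mem_univ z)
    have h2 := add_sum_erase univ g (mem_univ z)
    have h3 : ∑ v ∈ univ.erase z, g v = ∑ v ∈ univ.erase z, x v :=
      sum_congr rfl fun v hv => hne v (ne_of_mem_erase hv)
    rw [hv]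
    linarith
  · exact hne v hv

omit ha in
theorem run_fixes {w : Equiv.Perm ℕ} (hw : Fixes n w) {u : List ℕ} (hu : IsPath n w u) :
    Fixes n (run w u) := by
  induction u generalizing w with
  | nil => exact hw
  | cons q u ih => exact ih (hw.mul_adj hu.1) hu.2.2

omit ha in
theorem run_desc {w : Equiv.Perm ℕ} {u : List ℕ} (hu : IsPath n w u) {p q : ℕ} (hpq : p < q)
    (hq : q < n) : run w u q < run w u p := by
  have hu' : IsPath n (run w u) [] := by
    rw [← List.append_nil u] at hu
    exact hu.of_append
  induction q, hpq using Nat.le_induction with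
  | base => exact hu' p hq
  | succ q hq' ih => exact (hu' q hq).trans (ih (by omega))

omit ha in
theorem sum_mem_Icc {x : Fin n → ℝ} (hx : x ∈ unitCube n) : 0 ≤ ∑ v, x v ∧ ∑ v, x v ≤ n := by
  refine ⟨sum_nonneg fun v _ => (hx v).1, ?_⟩
  have := sum_le_sum fun v (_ : v ∈ univ) => (hx v).2
  simpa using this

/-- The identity path is the left boundary of the zonotope and the reversal path the right one, by
extremality applied to `a` and to `-a`. In between, `mem_tile_of_between` yields a tile. -/
theorem exists_tile_of_mem_unitCube (hn : 2 ≤ n) {u : List ℕ} (hu : IsPath n 1 u)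
    {x : Fin n → ℝ} (hx : x ∈ unitCube n) :
    ∃ t ∈ tilesOf n 1 u, proj a x ∈ tile a t.1 t.2 := by
  obtain ⟨h0, h1⟩ := sum_mem_Icc hx
  have hl := (sum_pathPoint_le (fixes_one n) (b := a)
    (fun v v' h => ha (by rw [Fin.lt_def]; exact h)) hx h0 h1 rfl).1
  have hfix := run_fixes (fixes_one n) hu
  have hr := (sum_pathPoint_le hfix (b := fun v => - a v) (fun v v' h => by
    apply neg_lt_neg
    apply ha
    have := run_desc hu h ((hfix.symm_lt _).2 v'.2)
    simpa using this) hx h0 h1 rfl).1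
  simp only [neg_mul, sum_neg_distrib, neg_le_neg_iff] at hr
  rw [proj_apply]
  rcases mem_tile_of_between ha (fixes_one n) hu hl hr with h | h
  · exact h
  -- On the left boundary any `p ≤ n - 2` with the height in `[p, p + 2]` serves, because the
  -- identity has an ascent everywhere.
  · obtain ⟨p, hpn, hp1, hp2⟩ : ∃ p : ℕ, p + 1 < n ∧ (p : ℝ) ≤ ∑ v, x v ∧ ∑ v, x v ≤ p + 2 := by
      rcases le_or_gt (∑ v, x v) ((n - 2 : ℕ) : ℝ) with hle | hlt
      · rcases lt_or_eq_of_le hle with hlt | heq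
        · refine ⟨⌊∑ v, x v⌋₊, ?_, Nat.floor_le h0, ?_⟩
          · have := (Nat.floor_lt h0).2 hlt
            omega
          · linarith [Nat.lt_floor_add_one (∑ v, x v)]
        · exact ⟨n - 2, by omega, heq.ge, by linarith⟩
      · refine ⟨n - 2, by omega, hlt.le, h1.trans ?_⟩
        rw [Nat.cast_sub hn]
        push_cast
        linarith
    obtain ⟨t, ht, hmem⟩ := exists_face_of_ascent (n := n) (fixes_one n) hu hpn (by simp) hp1 hp2
    refine ⟨t, ht, _, hmem, ?_⟩
    rw [proj_apply, ← h, sum_pathPoint (fixes_one n) h0 h1]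

omit ha in
theorem exists_of_mem_tilesOf {w : Equiv.Perm ℕ} (hw : Fixes n w) {u : List ℕ}
    (hu : IsPath n w u) {t : Finset (Fin n) × Finset (Fin n)} (ht : t ∈ tilesOf n w u) :
    ∃ w' : Equiv.Perm ℕ, ∃ q, Fixes n w' ∧ q + 1 < n ∧ w' q < w' (q + 1) ∧ t = tileAt n w' q := by
  induction u generalizing w with
  | nil => simp [tilesOf] at ht
  | cons q u ih =>
    rcases List.mem_cons.1 ht with rfl | ht
    · exact ⟨w, q, hw, hu.1, hu.2.1, rfl⟩
    · exact ih (hw.mul_adj hu.1) hu.2.2 ht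

theorem linearIndepOn_pair {i j : Fin n} (hij : i ≠ j) :
    LinearIndepOn ℝ (vec a) ({i, j} : Set (Fin n)) := by
  rw [LinearIndepOn.pair_iff _ hij]
  intro c d hcd
  simp only [vec, Prod.smul_mk, smul_eq_mul, mul_one, Prod.mk_add_mk, Prod.mk_eq_zero] at hcd
  have hne : a i - a j ≠ 0 := sub_ne_zero.2 (ha.injective.ne hij)
  have hd : d = -c := by linarith [hcd.2]
  have : c * (a i - a j) = 0 := by
    rw [hd] at hcd
    linarith [hcd.1]
  rcases mul_eq_zero.1 this with h | h
  · exact ⟨h, by rw [hd, h, neg_zero]⟩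
  · exact absurd h hne

/-- The fine zonotopal tiling of a sequence of swaps from the identity to the reversal. -/
def tilingOf (hn : 2 ≤ n) (u : List ℕ) (hu : IsPath n 1 u) : FineZonotopalTiling a where
  tiles := (tilesOf n 1 u).toFinset
  disjoint_of_mem t ht := by
    obtain ⟨w, q, hw, hq, -, rfl⟩ := exists_of_mem_tilesOf (fixes_one n) hu (List.mem_toFinset.1 ht)
    rw [disjoint_left]
    intro v hv
    simp only [tileAt, mem_pre, mem_filter, mem_univ, true_and] at hv ⊢
    omega
  card_of_mem t ht := by
    obtain ⟨w, q, hw, hq, -, rfl⟩ := exists_of_mem_tilesOf (fixes_one n) hu (List.mem_toFinset.1 ht)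
    obtain ⟨i, j, hi, hj, hij⟩ := exists_swap hw hq
    rw [tileAt_snd hi hj, card_pair hij]
  linearIndepOn_of_mem t ht := by
    obtain ⟨w, q, hw, hq, -, rfl⟩ := exists_of_mem_tilesOf (fixes_one n) hu (List.mem_toFinset.1 ht)
    obtain ⟨i, j, hi, hj, hij⟩ := exists_swap hw hq
    rw [tileAt_snd hi hj, coe_pair]
    exact linearIndepOn_pair ha hij
  cover := by
    apply Set.Subset.antisymm
    · refine Set.iUnion₂_subset fun t _ => ?_
      rintro _ ⟨x, hx, rfl⟩
      exact ⟨x, hx.1, rfl⟩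
    · rintro _ ⟨x, hx, rfl⟩
      obtain ⟨t, ht, h⟩ := exists_tile_of_mem_unitCube ha hn hu hx
      exact Set.mem_iUnion₂.2 ⟨t, List.mem_toFinset.2 ht, h⟩
  inter s hs t ht := by
    apply Set.Subset.antisymm
    · rintro _ ⟨x, hx, rfl⟩
      exact ⟨⟨x, hx.1, rfl⟩, ⟨x, hx.2, rfl⟩⟩
    · rintro _ ⟨⟨x, hx, rfl⟩, ⟨y, hy, hxy⟩⟩
      have := eq_of_proj_eq ha (fixes_one n) hu (List.mem_toFinset.1 ht) (List.mem_toFinset.1 hs)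
        hy hx hxy
      subst this
      exact ⟨y, ⟨hx, hy⟩, rfl⟩

end ZonoHyper
end
-- Every tiling is swept by a word
noncomputable section
namespace ZonoHyper

open Finset Filter Topology

variable {n : ℕ} {a : Fin n → ℝ}

theorem mem_or_mem_of_mem_cubeFace {A B : Finset (Fin n)} {x : Fin n → ℝ} (hx : x ∈ cubeFace A B)
    {v : Fin n} (hv : v ∉ B) : v ∈ A ∧ x v = 1 ∨ v ∉ A ∧ x v = 0 := by
  by_cases h : v ∈ A
  · exact Or.inl ⟨h, hx.2.1 v h⟩
  · exact Or.inr ⟨h, hx.2.2 v h hv⟩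

/-- The face fixes all coordinates outside its two free ones; at equal height these can only
exchange mass. -/
theorem exists_shift_of_mem_tiles (T : FineZonotopalTiling a)
    {t : Finset (Fin n) × Finset (Fin n)} (ht : t ∈ T.tiles) {x y : Fin n → ℝ}
    (hx : x ∈ cubeFace t.1 t.2) (hy : y ∈ cubeFace t.1 t.2) (h : ∑ v, x v = ∑ v, y v) :
    ∃ i j, i < j ∧ t.2 = {i, j} ∧ ∃ c, Shift i j c y x := by
  obtain ⟨i, j, hij, hB⟩ : ∃ i j, i < j ∧ t.2 = {i, j} := by
    obtain ⟨i, j, hne, hB⟩ := card_eq_two.1 (T.card_of_mem t ht)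
    rcases lt_or_gt_of_ne hne with h | h
    · exact ⟨i, j, h, hB⟩
    · exact ⟨j, i, h, by rw [hB, pair_comm]⟩
  refine ⟨i, j, hij, hB, y i - x i, by ring, ?_, ?_⟩
  · have hout : ∀ v ∈ univ, v ∉ ({i, j} : Finset (Fin n)) → x v - y v = 0 := by
      intro v _ hv
      rw [← hB] at hv
      rcases mem_or_mem_of_mem_cubeFace hx hv with ⟨h1, h2⟩ | ⟨h1, h2⟩ <;>
      rcases mem_or_mem_of_mem_cubeFace hy hv with ⟨h3, h4⟩ | ⟨h3, h4⟩
      · rw [h2, h4, sub_self]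
      · exact absurd h1 h3
      · exact absurd h3 h1
      · rw [h2, h4, sub_self]
    have h2 := sum_subset (subset_univ ({i, j} : Finset (Fin n))) hout
    rw [sum_pair hij.ne, sum_sub_distrib, h] at h2
    linarith
  · intro v hi hj
    have hv : v ∉ t.2 := by simp [hB, hi, hj]
    rcases mem_or_mem_of_mem_cubeFace hx hv with ⟨h1, h2⟩ | ⟨h1, h2⟩ <;>
    rcases mem_or_mem_of_mem_cubeFace hy hv with ⟨h3, h4⟩ | ⟨h3, h4⟩
    · rw [h2, h4]
    · exact absurd h1 h3
    · exact absurd h3 h1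
    · rw [h2, h4]

theorem isCompact_cubeFace (A B : Finset (Fin n)) : IsCompact (cubeFace A B) := by
  have hcube : unitCube n = Set.Icc 0 1 := by
    ext x
    simp only [unitCube, Set.mem_ofPred_eq, Set.mem_Icc, Pi.le_def, Pi.zero_apply, Pi.one_apply,
      forall_and]
  have : cubeFace A B =
      unitCube n ∩ ((⋂ i ∈ A, {x | x i = 1}) ∩ ⋂ i, ⋂ (_ : i ∉ A), ⋂ (_ : i ∉ B), {x | x i = 0}) := by
    ext x
    simp [cubeFace]
    tauto
  rw [this, hcube]
  refine isCompact_Icc.inter_right (IsClosed.inter ?_ ?_)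
  · exact isClosed_biInter fun i _ => isClosed_eq (continuous_apply i) continuous_const
  · exact isClosed_iInter fun i => isClosed_iInter fun _ => isClosed_iInter fun _ =>
      isClosed_eq (continuous_apply i) continuous_const

theorem isClosed_tile (A B : Finset (Fin n)) : IsClosed (tile a A B) :=
  ((isCompact_cubeFace A B).image (proj a).continuous_of_finiteDimensional).isClosed

/-- The points of the path of `w` lift uniquely to the faces of `T`. -/
def Carries (T : FineZonotopalTiling a) (w : Equiv.Perm ℕ) : Prop :=
  ∀ h : ℝ, 0 ≤ h → h ≤ n → ∀ t ∈ T.tiles, ∀ x ∈ cubeFace t.1 t.2,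
    proj a x = proj a (pathPoint n w h) → x = pathPoint n w h

/-- There is a tile to the right of every point of the path that is not on the right boundary. -/
theorem exists_tile_right {T : FineZonotopalTiling a} {w : Equiv.Perm ℕ}
    (hT : Carries T w) {h : ℝ} (h0 : 0 ≤ h) (hn : h ≤ n) {i j : Fin n}
    (hij : i ≠ j) (hi : 0 < pathPoint n w h i) (hj : pathPoint n w h j < 1) :
    ∃ t ∈ T.tiles, pathPoint n w h ∈ cubeFace t.1 t.2 ∧ ∃ c, 0 < c ∧ ∃ x ∈ cubeFace t.1 t.2,
      ∑ v, x v = ∑ v, pathPoint n w h v ∧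
      ∑ v, a v * x v = ∑ v, a v * pathPoint n w h v + c * (a j - a i) := by
  set g := pathPoint n w h with hg
  have g01 := pathPoint_mem (n := n) w h
  set y : ℝ → Fin n → ℝ := fun c v => if v = i then g i - c else if v = j then g j + c else g v
    with hy
  have hys : ∀ c, Shift i j c g (y c) := fun c =>
    ⟨by simp [hy], by simp [hy, hij.symm], fun v h1 h2 => by simp [hy, h1, h2]⟩
  have hycont : Continuous y := by
    refine continuous_pi fun v => ?_
    simp only [hy]
    split_ifs <;> fun_prop
  have hev : ∀ᶠ c in 𝓝[>] (0 : ℝ), ∃ t ∈ T.tiles, proj a (y c) ∈ tile a t.1 t.2 := by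
    filter_upwards [Ioo_mem_nhdsGT hi, Ioo_mem_nhdsGT (sub_pos.2 hj)] with c hc hc'
    have hmem : y c ∈ unitCube n := by
      intro v
      by_cases hvi : v = i
      · rw [hvi, (hys c).1]
        exact ⟨by linarith [hc.2], by linarith [hc.1, (g01 i).2]⟩
      by_cases hvj : v = j
      · rw [hvj, (hys c).2.1]
        exact ⟨by linarith [hc.1, (g01 j).1], by linarith [hc'.2]⟩
      rw [(hys c).2.2 v hvi hvj]
      exact g01 v
    have : proj a (y c) ∈ zonotope a := ⟨_, hmem, rfl⟩
    rw [← T.cover] at this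
    simpa using this
  -- There are finitely many tiles, so one contains points arbitrarily close on the right. Being
  -- closed, it contains the point itself, and `hT` identifies the lift.
  obtain ⟨t, ht, hfr⟩ : ∃ t ∈ T.tiles, ∃ᶠ c in 𝓝[>] (0 : ℝ), proj a (y c) ∈ tile a t.1 t.2 := by
    by_contra hcon
    simp only [not_exists, not_and, not_frequently] at hcon
    have := (eventually_all_finset T.tiles).2 hcon
    obtain ⟨c, ⟨t, ht, h1⟩, h2⟩ := (hev.and this).exists
    exact h2 t ht h1
  have hpc : Continuous fun c => proj a (y c) :=
    (proj a).continuous_of_finiteDimensional.comp hycont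
  have h0mem : proj a (y 0) ∈ tile a t.1 t.2 :=
    (isClosed_tile t.1 t.2).mem_of_frequently_of_tendsto hfr
      ((hpc.tendsto 0).mono_left nhdsWithin_le_nhds)
  rw [← (hys 0).eq_of_zero] at h0mem
  obtain ⟨x0, hx0, hx0g⟩ := h0mem
  obtain rfl := hT h h0 hn t ht x0 hx0 hx0g
  obtain ⟨c, ⟨x, hx, hxc⟩, hc⟩ := (hfr.and_eventually self_mem_nhdsWithin).exists
  rw [proj_eq_iff, (hys c).sum_eq hij, (hys c).sum_eq' hij] at hxc
  exact ⟨t, ht, hx0, c, hc, x, hx, hxc.2, hxc.1⟩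

variable (ha : StrictMono a)
include ha

theorem eq_of_mem_face (T : FineZonotopalTiling a)
    {t : Finset (Fin n) × Finset (Fin n)} (ht : t ∈ T.tiles) {x y : Fin n → ℝ}
    (hx : x ∈ cubeFace t.1 t.2) (hy : y ∈ cubeFace t.1 t.2) (hxy : proj a x = proj a y) :
    x = y := by
  rw [proj_eq_iff] at hxy
  obtain ⟨i, j, hij, -, c, hs⟩ := exists_shift_of_mem_tiles T ht hx hy hxy.2
  have h1 := hs.sum_eq hij.ne a
  have : c * (a j - a i) = 0 := by linarith [hxy.1]
  rcases mul_eq_zero.1 this with h | h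
  · subst h
    exact hs.eq_of_zero.symm
  · exact absurd h (sub_pos.2 (ha hij)).ne'

/-- The field `inter` provides a common point of both faces over the given image, and the projection
is injective on each face. -/
theorem eq_of_mem_faces (T : FineZonotopalTiling a)
    {s t : Finset (Fin n) × Finset (Fin n)} (hs : s ∈ T.tiles) (ht : t ∈ T.tiles)
    {x y : Fin n → ℝ} (hx : x ∈ cubeFace s.1 s.2) (hy : y ∈ cubeFace t.1 t.2)
    (hxy : proj a x = proj a y) : x = y := by
  have : proj a x ∈ tile a s.1 s.2 ∩ tile a t.1 t.2 := ⟨⟨x, hx, rfl⟩, ⟨y, hy, hxy.symm⟩⟩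
  rw [← T.inter s hs t ht] at this
  obtain ⟨z, ⟨hz, hz'⟩, h⟩ := this
  rw [eq_of_mem_face ha T hs hx hz h.symm, eq_of_mem_face ha T ht hy hz' (hxy.symm.trans h.symm)]

/-- Points of the left boundary have a single preimage in the whole cube, by the equality case of
`sum_pathPoint_le`. -/
theorem carries_one (T : FineZonotopalTiling a) : Carries T 1 := by
  intro h h0 hn t ht x hx hp
  rw [proj_eq_iff, sum_pathPoint (fixes_one n) h0 hn] at hp
  exact ((sum_pathPoint_le (fixes_one n) (b := a)
    (fun v v' h => ha (by rw [Fin.lt_def]; exact h)) hx.1 h0 hn hp.2).2 hp.1.symm).symm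

/-- The new path agrees with the old one outside the heights of the crossed tile, and inside them
its lift lies on the face of that tile. -/
theorem Carries.mul_adj {T : FineZonotopalTiling a} {w : Equiv.Perm ℕ} (hT : Carries T w)
    (hw : Fixes n w) {q : ℕ} (hq : q + 1 < n) (hmem : tileAt n w q ∈ T.tiles) :
    Carries T (w * adj q) := by
  intro h h0 hn t ht x hx hp
  by_cases h1 : (q : ℝ) ≤ h ∧ h ≤ q + 2
  · exact eq_of_mem_faces ha T ht hmem hx (pathPoint_mem_face' h1.1 h1.2) hp
  · rw [not_and_or, not_le, not_le] at h1
    rw [pathPoint_mul_adj_of_not_mem hw hq (by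
      rcases h1 with h | h
      · exact Or.inl h.le
      · exact Or.inr h.le)] at hp ⊢
    exact hT h h0 hn t ht x hx hp

/-- The tile to the right of an edge of the path. -/
theorem exists_tile_right_edge {T : FineZonotopalTiling a} {w : Equiv.Perm ℕ}
    (hT : Carries T w) (hw : Fixes n w) {m : ℕ} {z : Fin n} (hz : w m = z)
    {x y : Fin n} (hxy : x < y) (hx : w.symm x ≤ m) (hy : m ≤ w.symm y) :
    (∃ j : Fin n, z < j ∧ m < w.symm j ∧ (pre n w m, ({z, j} : Finset (Fin n))) ∈ T.tiles) ∨
    ∃ i : Fin n, i < z ∧ w.symm i < m ∧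
      ((pre n w m).erase i, ({i, z} : Finset (Fin n))) ∈ T.tiles := by
  have hmn : m < n := (hw m).1 (by rw [hz]; exact z.2)
  have sz : w.symm z = m := by rw [← hz]; simp
  have hmn' : ((m + 1 : ℕ) : ℝ) ≤ n := Nat.cast_le.2 hmn
  push_cast at hmn'
  have hm0 : (0 : ℝ) ≤ m := Nat.cast_nonneg m
  -- The midpoint of the edge: `z` has coordinate `1 / 2`, all others 0 or 1, so `z` must be a free
  -- coordinate of any face containing it.
  set h : ℝ := m + 1 / 2 with hh
  have g1 : ∀ v : Fin n, w.symm v < m → pathPoint n w h v = 1 :=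
    fun v hv => pathPoint_of_lt (by linarith) hv
  have g0 : ∀ v : Fin n, m < w.symm v → pathPoint n w h v = 0 :=
    fun v hv => pathPoint_of_le (m := m + 1) (by push_cast; linarith) hv
  have gz : ∀ v : Fin n, w.symm v = m → pathPoint n w h v = 1 / 2 := by
    intro v hv
    rw [pathPoint, hv, clamp_of_mem] <;> rw [hh] <;> ring_nf <;> norm_num
  have gpos : ∀ v : Fin n, 0 < pathPoint n w h v ↔ w.symm v ≤ m := by
    intro v
    rcases lt_trichotomy (w.symm v) m with h | h | h
    · simp [g1 v h, h.le]
    · simp [gz v h, h.le]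
    · simp [g0 v h, h]
  have glt : ∀ v : Fin n, pathPoint n w h v < 1 ↔ m ≤ w.symm v := by
    intro v
    rcases lt_trichotomy (w.symm v) m with h | h | h
    · simp [g1 v h, h]
    · rw [gz v h]
      norm_num [h.ge]
    · simp [g0 v h, h.le]
  obtain ⟨t, ht, hg, c, hc, x', hx', hs1, hs2⟩ := exists_tile_right hT (h := h) (by linarith)
    (by linarith) hxy.ne ((gpos x).2 hx) ((glt y).2 hy)
  obtain ⟨i, j, hij, hB, d, hd⟩ := exists_shift_of_mem_tiles T ht hx' hg hs1
  have hd0 : 0 < d := by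
    rw [hd.sum_eq hij.ne] at hs2
    have h1 := sub_pos.2 (ha hxy)
    have h2 := sub_pos.2 (ha hij)
    have : d * (a j - a i) = c * (a y - a x) := by linarith
    exact pos_of_mul_pos_left (this ▸ mul_pos hc h1) h2.le
  have hpi : w.symm i ≤ m := by
    rw [← gpos]
    linarith [hd.1, (hx'.1 i).1]
  have hpj : m ≤ w.symm j := by
    rw [← glt]
    linarith [hd.2.1, (hx'.1 j).2]
  have hA : ∀ v, v ∉ t.2 → (v ∈ t.1 ↔ w.symm v < m) := by
    intro v hv
    rcases mem_or_mem_of_mem_cubeFace hg hv with ⟨h1, h2⟩ | ⟨h1, h2⟩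
    · refine iff_of_true h1 ?_
      by_contra hcon
      have := (glt v).2 (not_lt.1 hcon)
      linarith
    · refine iff_of_false h1 ?_
      intro hcon
      have := (gpos v).2 hcon.le
      linarith
  have hdis := T.disjoint_of_mem t ht
  rw [disjoint_right] at hdis
  have hzB : z ∈ t.2 := by
    by_contra hcon
    rcases mem_or_mem_of_mem_cubeFace hg hcon with ⟨h1, h2⟩ | ⟨h1, h2⟩ <;>
    · rw [gz z sz] at h2
      norm_num at h2
  have hpos_inj : ∀ v : Fin n, w.symm v = m → v = z := fun v hv =>
    Fin.ext (w.symm.injective (hv.trans sz.symm))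
  have ht' : t = (t.1, t.2) := rfl
  -- If `z` is the smaller free index, the edge is the lower left side of the tile; otherwise it is
  -- the upper left side.
  rw [hB, mem_insert, mem_singleton] at hzB
  rcases hzB with rfl | rfl
  · left
    have hjm : m < w.symm j := lt_of_le_of_ne hpj fun h => hij.ne (hpos_inj j h.symm).symm
    refine ⟨j, hij, hjm, ?_⟩
    have : t.1 = pre n w m := by
      ext v
      rw [mem_pre]
      by_cases hv : v ∈ t.2
      · refine iff_of_false (hdis hv) ?_
        rw [hB, mem_insert, mem_singleton] at hv
        rcases hv with rfl | rfl <;> omega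
      · exact hA v hv
    rwa [← hB, ← this]
  · right
    have him : w.symm i < m := lt_of_le_of_ne hpi fun h => hij.ne (hpos_inj i h)
    refine ⟨i, hij, him, ?_⟩
    have : t.1 = (pre n w m).erase i := by
      ext v
      rw [mem_erase, mem_pre]
      by_cases hv : v ∈ t.2
      · refine iff_of_false (hdis hv) ?_
        rw [hB, mem_insert, mem_singleton] at hv
        rcases hv with rfl | rfl
        · simp
        · omega
      · rw [hA v hv]
        have : v ≠ i := by
          rintro rfl
          exact hv (by simp [hB])
        simp [this]
    rwa [← hB, ← this]

/-- A path that is not the right boundary can be moved across a tile. -/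
theorem exists_tileAt_mem {T : FineZonotopalTiling a} {w : Equiv.Perm ℕ}
    (hT : Carries T w) (hw : Fixes n w) {p : ℕ} (hp : p + 1 < n) (hasc : w p < w (p + 1)) :
    ∃ q, q + 1 < n ∧ w q < w (q + 1) ∧ tileAt n w q ∈ T.tiles := by
  classical
  have hex : ∃ m, ∃ y : Fin n, w m < y ∧ m < w.symm y :=
    ⟨p, ⟨w (p + 1), (hw _).2 hp⟩, hasc, by simp⟩
  -- Edge `m` of the path is the lower left side of the tile to its right.
  let P : ℕ → Prop := fun m => ∃ z j : Fin n, w m = z ∧ z < j ∧ m < w.symm j ∧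
    (pre n w m, ({z, j} : Finset (Fin n))) ∈ T.tiles
  have hPn : ∀ m, P m → m + 1 < n := by
    rintro m ⟨z, j, -, -, h, -⟩
    have := (hw.symm_lt j).2 j.2
    omega
  -- Take the first edge with a larger value later on. If it were an upper left side, the lower left
  -- side of the same tile would be an earlier such edge.
  have hP0 : P (Nat.find hex) := by
    obtain ⟨y, hy1, hy2⟩ := Nat.find_spec hex
    set m := Nat.find hex with hm
    have hmn : m < n := hy2.trans ((hw.symm_lt y).2 y.2)
    let z : Fin n := ⟨w m, (hw m).2 hmn⟩
    have sz : w.symm z = m := by simp [z]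
    rcases exists_tile_right_edge ha hT hw (z := z) rfl (x := z) (y := y) hy1 sz.le hy2.le with
      ⟨j, h1, h2, h3⟩ | ⟨i, h1, h2, -⟩
    · exact ⟨z, j, rfl, h1, h2, h3⟩
    · refine absurd ⟨z, ?_, ?_⟩ (Nat.find_min hex (hm ▸ h2))
      · simpa using h1
      · rwa [sz]
  have hbound : Nat.find hex ≤ n := by have := hPn _ hP0; omega
  -- The last lower left side; the next edge is then an upper left side. The two tiles overlap to
  -- the right of the vertex between the edges, which will force them to be equal.
  set m := Nat.findGreatest P n with hm
  have hPm : P m := Nat.findGreatest_spec hbound hP0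
  have hmax : ¬ P (m + 1) := fun h =>
    Nat.findGreatest_is_greatest (Nat.lt_succ_self m) (by have := hPn _ h; omega) h
  have hmn := hPn m hPm
  obtain ⟨z, j, hz, hzj, hmj, ht⟩ := hPm
  let z' : Fin n := ⟨w (m + 1), (hw _).2 hmn⟩
  have sz : w.symm z = m := by rw [← hz]; simp
  have sz' : w.symm z' = m + 1 := by simp [z']
  rcases exists_tile_right_edge ha hT hw (z := z') rfl hzj (by omega) hmj with
    ⟨j', h1, h2, h3⟩ | ⟨i, hi, him, ht'⟩
  · exact absurd ⟨z', j', rfl, h1, h2, h3⟩ hmax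
  have hD := sub_pos.2 (ha hzj)
  have hD' := sub_pos.2 (ha hi)
  set D := a j - a z
  set D' := a z' - a i
  have hshift : ∀ (i j : Fin n), i ≠ j → w.symm i < m + 1 → m + 1 ≤ w.symm j → ∀ c : ℝ, 0 ≤ c →
      c ≤ 1 → ∀ A B : Finset (Fin n), A = (pre n w (m + 1)).erase i → B = {i, j} →
      ∃ x ∈ cubeFace A B, Shift i j c (pathPoint n w ((m + 1 : ℕ) : ℝ)) x := by
    rintro i j hij hi hj c hc hc' A B rfl rfl
    have g1 : ∀ v : Fin n, w.symm v < m + 1 → pathPoint n w ((m + 1 : ℕ) : ℝ) v = 1 :=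
      fun v hv => pathPoint_of_lt le_rfl hv
    have g0 : ∀ v : Fin n, m + 1 ≤ w.symm v → pathPoint n w ((m + 1 : ℕ) : ℝ) v = 0 :=
      fun v hv => pathPoint_of_le le_rfl hv
    set g := pathPoint n w ((m + 1 : ℕ) : ℝ)
    refine ⟨fun v => if v = i then g i - c else if v = j then g j + c else g v,
      ⟨fun v => ?_, fun v hv => ?_, fun v hv hv' => ?_⟩,
      by simp, by simp [hij.symm], fun v h1 h2 => by simp [h1, h2]⟩
    · simp only
      split_ifs
      · rw [g1 i hi]
        exact ⟨by linarith, by linarith⟩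
      · rw [g0 j hj]
        exact ⟨by linarith, by linarith⟩
      · exact pathPoint_mem _ _ v
    · rw [mem_erase, mem_pre] at hv
      have : v ≠ j := by
        rintro rfl
        omega
      simp only [if_neg hv.1, if_neg this]
      exact g1 v hv.2
    · simp only [mem_insert, mem_singleton, not_or] at hv'
      simp only [if_neg hv'.1, if_neg hv'.2]
      rw [mem_erase, mem_pre] at hv
      exact g0 v (not_lt.1 fun h => hv ⟨hv'.1, h⟩)
  have hDD : 0 < D + D' := by linarith
  -- The two amounts make the horizontal displacements equal, `D' / (D + D') * D = D / (D + D') *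
  -- D'`. They lie strictly between 0 and 1, so `z` and `j` are free coordinates of both faces.
  obtain ⟨x, hx, hxs⟩ := hshift z j hzj.ne (by omega) hmj (D' / (D + D')) (by positivity)
    ((div_le_one hDD).2 (by linarith)) (pre n w m) {z, j} (by
      ext v
      rw [mem_erase, mem_pre, mem_pre]
      have : v = z ↔ w.symm v = m := by
        rw [← sz, w.symm.injective.eq_iff, Fin.ext_iff]
      rw [ne_eq, this]
      omega) rfl
  obtain ⟨x', hx', hxs'⟩ := hshift i z' hi.ne him sz'.ge (D / (D + D')) (by positivity)
    ((div_le_one hDD).2 (by linarith)) _ _ rfl rfl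
  have hxx : x = x' := by
    refine eq_of_mem_faces ha T ht ht' hx hx' ((proj_eq_iff _ _ _).2 ⟨?_, ?_⟩)
    · rw [hxs.sum_eq hzj.ne, hxs'.sum_eq hi.ne]
      congr 1
      change D' / (D + D') * D = D / (D + D') * D'
      ring
    · rw [hxs.sum_eq' hzj.ne, hxs'.sum_eq' hi.ne]
  rw [← hxx] at hx'
  have hc0 : 0 < D' / (D + D') := by positivity
  have hc1 : D' / (D + D') < 1 := (div_lt_one hDD).2 (by linarith)
  have hzB : z ∈ ({i, z'} : Finset (Fin n)) := by
    by_contra hcon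
    have h1 := hxs.1
    rw [pathPoint_of_lt (m := m + 1) le_rfl (by omega)] at h1
    rcases mem_or_mem_of_mem_cubeFace hx' hcon with h | h <;> linarith [h.2]
  have hjB : j ∈ ({i, z'} : Finset (Fin n)) := by
    by_contra hcon
    have h1 := hxs.2.1
    rw [pathPoint_of_le (m := m + 1) le_rfl hmj] at h1
    rcases mem_or_mem_of_mem_cubeFace hx' hcon with h | h <;> linarith [h.2]
  rw [mem_insert, mem_singleton] at hzB hjB
  have hzz' : z ≠ z' := by
    intro h
    rw [h] at sz
    omega
  obtain rfl : z = i := by tauto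
  obtain rfl : j = z' := by
    rcases hjB with h | h
    · exact absurd h hzj.ne'
    · exact h
  refine ⟨m, hmn, by rw [hz]; exact hzj, ?_⟩
  have : tileAt n w m = (pre n w m, {z, z'}) := Prod.ext rfl (tileAt_snd hz rfl)
  rwa [this]

omit ha in
-- The termination measure of the sweep: the swap lowers it by `w (q + 1) - w q`.
theorem sum_mul_adj_lt {w : Equiv.Perm ℕ} {q : ℕ} (hq : q + 1 < n) (hasc : w q < w (q + 1)) :
    ∑ p ∈ range n, p * (w * adj q) p < ∑ p ∈ range n, p * w p := by
  have : ∀ p : ℕ, (p : ℤ) * ((w * adj q) p : ℕ) = p * (w p : ℕ) +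
      ((if p = q then (q : ℤ) * (w (q + 1) - w q) else 0) +
        if p = q + 1 then -((q + 1 : ℤ) * (w (q + 1) - w q)) else 0) := by
    intro p
    rw [mul_adj_apply]
    by_cases h1 : p = q
    · subst h1
      simp
      ring
    by_cases h2 : p = q + 1
    · subst h2
      simp
      ring
    simp [h1, h2]
  have h1 := sum_congr rfl fun p (_ : p ∈ range n) => this p
  rw [sum_add_distrib, sum_add_distrib, sum_ite_eq', sum_ite_eq',
    if_pos (mem_range.2 (by omega)), if_pos (mem_range.2 hq)] at h1
  have h2 : (w q : ℤ) < w (q + 1) := Nat.cast_lt.2 hasc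
  rw [← Nat.cast_lt (α := ℤ), Nat.cast_sum, Nat.cast_sum]
  simp only [Nat.cast_mul]
  linarith

theorem exists_path_of_carries {T : FineZonotopalTiling a} (N : ℕ) {w : Equiv.Perm ℕ}
    (hN : ∑ p ∈ range n, p * w p < N) (hT : Carries T w) (hw : Fixes n w) :
    ∃ u, IsPath n w u ∧ ∀ t ∈ tilesOf n w u, t ∈ T.tiles := by
  induction N generalizing w with
  | zero => omega
  | succ N ih =>
    by_cases hex : ∃ p, p + 1 < n ∧ w p < w (p + 1)
    · obtain ⟨p, hp, hasc⟩ := hex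
      obtain ⟨q, hq, hq', hmem⟩ := exists_tileAt_mem ha hT hw hp hasc
      obtain ⟨u, hu, hu'⟩ := ih ((sum_mul_adj_lt hq hq').trans_le (by omega))
        (hT.mul_adj ha hw hq hmem) (hw.mul_adj hq)
      refine ⟨q :: u, ⟨hq, hq', hu⟩, fun t ht => ?_⟩
      rcases List.mem_cons.1 ht with rfl | ht
      · exact hmem
      · exact hu' t ht
    · refine ⟨[], fun q hq => ?_, by simp [tilesOf]⟩
      have h1 : ¬ w q < w (q + 1) := fun h => hex ⟨q, hq, h⟩
      have h2 : w q ≠ w (q + 1) := by simp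
      omega

/-- Every fine zonotopal tiling is swept by a sequence of swaps. -/
theorem exists_eq_tilingOf (hn : 2 ≤ n) (T : FineZonotopalTiling a) :
    ∃ u, ∃ hu : IsPath n 1 u, T = tilingOf ha hn u hu := by
  obtain ⟨u, hu, hsub⟩ := exists_path_of_carries ha _ (Nat.lt_succ_self _) (carries_one ha T)
    (fixes_one n)
  refine ⟨u, hu, FineZonotopalTiling.ext ?_⟩
  refine Subset.antisymm (fun t ht => ?_) fun t ht => hsub t (List.mem_toFinset.1 ht)
  have hdis := T.disjoint_of_mem t ht
  -- The centre of the face. A tile of the sweep covers its image, both lifts are equal, and the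
  -- coordinates `1 / 2` show which two are free.
  set x : Fin n → ℝ := fun v => if v ∈ t.1 then 1 else if v ∈ t.2 then 1 / 2 else 0 with hxdef
  have hx : x ∈ cubeFace t.1 t.2 := by
    refine ⟨fun v => ?_, fun v hv => if_pos hv, fun v hv hv' => ?_⟩
    · simp only [hxdef]
      split_ifs <;> norm_num
    · simp [hxdef, hv, hv']
  have hhalf : ∀ v ∈ t.2, x v = 1 / 2 := by
    intro v hv
    simp [hxdef, hv, disjoint_right.1 hdis hv]
  obtain ⟨d, hd, y, hy, hyx⟩ := exists_tile_of_mem_unitCube ha hn hu hx.1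
  have hdT := hsub d hd
  obtain rfl : y = x := eq_of_mem_faces ha T hdT ht hy hx hyx
  have hB : t.2 = d.2 := by
    refine eq_of_subset_of_card_le (fun v hv => ?_) ?_
    · by_contra hcon
      have := hhalf v hv
      rcases mem_or_mem_of_mem_cubeFace hy hcon with h | h <;>
      · rw [h.2] at this
        norm_num at this
    · rw [T.card_of_mem t ht, T.card_of_mem d hdT]
  have hA : t.1 = d.1 := by
    ext v
    by_cases hv : v ∈ t.2
    · exact iff_of_false (disjoint_right.1 hdis hv)
        (disjoint_right.1 (T.disjoint_of_mem d hdT) (hB ▸ hv))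
    · rcases mem_or_mem_of_mem_cubeFace hx hv with ⟨h1, h2⟩ | ⟨h1, h2⟩ <;>
      rcases mem_or_mem_of_mem_cubeFace hy (hB ▸ hv) with ⟨h3, h4⟩ | ⟨h3, h4⟩
      · exact iff_of_true h1 h3
      · linarith
      · linarith
      · exact iff_of_false h1 h3
  rw [show t = d from Prod.ext hA hB]
  exact List.mem_toFinset.2 hd

end ZonoHyper
end
-- Circuits, vertices and braids as flips
noncomputable section
namespace ZonoHyper

open Finset

variable {n : ℕ} {a : Fin n → ℝ}

theorem pre_succ {w : Equiv.Perm ℕ} {m : ℕ} {i : Fin n} (hi : w m = i) :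
    pre n w (m + 1) = insert i (pre n w m) := by
  ext v
  have : v = i ↔ w.symm v = m := by rw [Fin.ext_iff, ← hi, Equiv.symm_apply_eq]
  rw [mem_insert, mem_pre, mem_pre, this]
  omega

theorem pre_mul_adj (w : Equiv.Perm ℕ) {q m : ℕ} (h : m ≠ q + 1) :
    pre n (w * adj q) m = pre n w m := by
  ext v
  rw [mem_pre, mem_pre, symm_mul_adj, adj_apply]
  split_ifs <;> omega

theorem card_pre {w : Equiv.Perm ℕ} (hw : Fixes n w) {m : ℕ} (hm : m ≤ n) :
    (pre n w m).card = m := by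
  rw [← card_range m]
  refine card_bij (fun v _ => w.symm v) (fun v hv => ?_) (fun v _ v' _ h => ?_) fun p hp => ?_
  · simpa [mem_pre] using hv
  · exact Fin.ext (w.symm.injective h)
  · rw [mem_range] at hp
    exact ⟨⟨w p, (hw p).2 (by omega)⟩, by simpa [mem_pre] using hp, by simp⟩

theorem tileAt_eq {w : Equiv.Perm ℕ} {q : ℕ} {i j : Fin n} (hi : w q = i) (hj : w (q + 1) = j) :
    tileAt n w q = (pre n w q, {i, j}) :=
  Prod.ext rfl (tileAt_snd hi hj)

/-- Only ascents are swapped, so an inversion is never undone. -/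
theorem IsPath.symm_lt_of_inverted {w : Equiv.Perm ℕ} {u v : List ℕ}
    (h : IsPath n w (u ++ v)) {i j : ℕ} (hij : i < j) (hinv : w.symm j < w.symm i) :
    (run w u).symm j < (run w u).symm i := by
  induction u generalizing w with
  | nil => exact hinv
  | cons q u ih =>
    refine ih h.2.2 ?_
    have hasc := h.2.1
    have : ¬ (w.symm j = q ∧ w.symm i = q + 1) := by
      rintro ⟨h1, h2⟩
      rw [← h2, ← h1] at hasc
      simp only [Equiv.apply_symm_apply] at hasc
      omega
    rw [symm_mul_adj, symm_mul_adj, adj_apply, adj_apply]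
    split_ifs <;> omega

theorem snd_ne_of_inverted {w : Equiv.Perm ℕ} (hw : Fixes n w) {u : List ℕ}
    (h : IsPath n w u) {i j : Fin n} (hij : i < j) (hinv : w.symm j < w.symm i)
    {t : Finset (Fin n) × Finset (Fin n)} (ht : t ∈ tilesOf n w u) : t.2 ≠ {i, j} := by
  induction u generalizing w with
  | nil => simp [tilesOf] at ht
  | cons q u ih =>
    rcases List.mem_cons.1 ht with rfl | ht
    · intro hB
      have hi : i ∈ (tileAt n w q).2 := by simp [hB]
      have hj : j ∈ (tileAt n w q).2 := by simp [hB]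
      simp only [tileAt, mem_filter, mem_univ, true_and] at hi hj
      have h1 : w.symm j = q := by omega
      have h2 : w.symm i = q + 1 := by omega
      have hasc := h.2.1
      rw [← h2, ← h1] at hasc
      simp only [Equiv.apply_symm_apply, Fin.val_fin_lt] at hasc
      omega
    · exact ih (hw.mul_adj h.1) h.2.2
        (IsPath.symm_lt_of_inverted (u := [q]) h hij hinv) ht

/-- After the swap of a pair its values are inverted, so the same pair is never swapped again. -/
theorem nodup_map_snd {w : Equiv.Perm ℕ} (hw : Fixes n w) {u : List ℕ} (h : IsPath n w u) :
    ((tilesOf n w u).map Prod.snd).Nodup := by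
  induction u generalizing w with
  | nil => simp [tilesOf]
  | cons q u ih =>
    refine List.nodup_cons.2 ⟨fun hmem => ?_, ih (hw.mul_adj h.1) h.2.2⟩
    obtain ⟨t, ht, hB⟩ := List.mem_map.1 hmem
    obtain ⟨i, j, hi, hj, -⟩ := exists_swap hw h.1
    refine snd_ne_of_inverted (hw.mul_adj h.1) h.2.2 (i := i) (j := j) ?_ ?_ ht ?_
    · rw [Fin.lt_def, ← hi, ← hj]
      exact h.2.1
    · rw [← hi, ← hj]
      simp [symm_mul_adj, adj_apply]
    · rw [hB, tileAt_snd hi hj]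

theorem run_fixes_left {w : Equiv.Perm ℕ} (hw : Fixes n w) {u v : List ℕ}
    (h : IsPath n w (u ++ v)) : Fixes n (run w u) := by
  induction u generalizing w with
  | nil => exact hw
  | cons q u ih => exact ih (hw.mul_adj h.1) h.2.2

/-- The corners of a tile are initial sets of the path before or after its swap. Statements about
vertices thus become statements about the order of values along the word. -/
theorem exists_pre_of_mem_tilesOf {w : Equiv.Perm ℕ} (hw : Fixes n w) {u : List ℕ}
    (h : IsPath n w u) {t : Finset (Fin n) × Finset (Fin n)} (ht : t ∈ tilesOf n w u)
    {S : Finset (Fin n)} (h1 : t.1 ⊆ S) (h2 : S ⊆ t.1 ∪ t.2) :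
    ∃ u1 u2 m, u = u1 ++ u2 ∧ S = pre n (run w u1) m := by
  induction u generalizing w with
  | nil => simp [tilesOf] at ht
  | cons q u ih =>
    rcases List.mem_cons.1 ht with rfl | ht
    · obtain ⟨i, j, hi, hj, hij⟩ := exists_swap hw h.1
      rw [tileAt_eq hi hj] at h1 h2
      simp only at h1 h2
      have si : i ∉ pre n w q := by rw [mem_pre, ← hi]; simp
      have sj : j ∉ pre n w q := by rw [mem_pre, ← hj]; simp
      have e1 : pre n (w * adj q) (q + 1) = insert j (pre n w q) := by
        rw [pre_succ (i := j) (by rw [mul_adj_left, hj]), pre_mul_adj _ (by omega)]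
      have e2 : pre n w (q + 1) = insert i (pre n w q) := pre_succ hi
      have e3 : pre n w (q + 1 + 1) = insert j (insert i (pre n w q)) := by rw [pre_succ hj, e2]
      have hmem : ∀ v, v ∈ S ↔ v ∈ pre n w q ∨ (v = i ∧ i ∈ S) ∨ (v = j ∧ j ∈ S) := by
        intro v
        constructor
        · intro hv
          have := h2 hv
          simp only [mem_union, mem_insert, mem_singleton] at this
          rcases this with h | rfl | rfl <;> tauto
        · rintro (h | ⟨rfl, h⟩ | ⟨rfl, h⟩)
          · exact h1 h
          · exact h
          · exact h
      by_cases hiS : i ∈ S <;> by_cases hjS : j ∈ S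
      · refine ⟨[], q :: u, q + 1 + 1, rfl, ?_⟩
        rw [run, List.foldl_nil, e3]
        ext v
        rw [hmem]
        simp only [mem_insert, hiS, hjS]
        tauto
      · refine ⟨[], q :: u, q + 1, rfl, ?_⟩
        rw [run, List.foldl_nil, e2]
        ext v
        rw [hmem]
        simp only [mem_insert, hiS, hjS]
        tauto
      · refine ⟨[q], u, q + 1, rfl, ?_⟩
        rw [run, List.foldl_cons, List.foldl_nil, e1]
        ext v
        rw [hmem]
        simp only [mem_insert, hiS, hjS]
        tauto
      · refine ⟨[], q :: u, q, rfl, ?_⟩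
        rw [run, List.foldl_nil]
        ext v
        rw [hmem]
        simp only [hiS, hjS]
        tauto
    · obtain ⟨u1, u2, m, h3, h4⟩ := ih (hw.mul_adj h.1) h.2.2 ht
      exact ⟨q :: u1, u2, m, by rw [h3, List.cons_append], h4⟩

theorem isCircuit_of_lt (ha : StrictMono a) {x y z : Fin n} (hxy : x < y) (hyz : y < z) :
    IsCircuit a {y} {x, z} := by
  have hxz := hxy.trans hyz
  refine ⟨?_, ⟨y, by simp⟩, ?_, Pi.single y (a z - a x) + Pi.single x (a y - a z) +
    Pi.single z (a x - a y), ?_, ?_, ?_, ?_⟩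
  · simp [hxy.ne', hyz.ne]
  · have h3 : ({y} ∪ {x, z} : Finset (Fin n)) = {y, x, z} := rfl
    rw [h3]
    intro i hi
    simp only [mem_insert, mem_singleton] at hi
    rcases hi with rfl | rfl | rfl
    · rw [show ({i, x, z} : Finset (Fin n)).erase i = {x, z} by grind, coe_pair]
      exact linearIndepOn_pair ha hxz.ne
    · rw [show ({y, i, z} : Finset (Fin n)).erase i = {y, z} by grind, coe_pair]
      exact linearIndepOn_pair ha hyz.ne
    · rw [show ({y, x, i} : Finset (Fin n)).erase i = {y, x} by grind, coe_pair]
      exact linearIndepOn_pair ha hxy.ne'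
  · intro i hi
    obtain rfl := mem_singleton.1 hi
    simp [hxy.ne', hyz.ne, ha hxz]
  · intro i hi
    simp only [mem_insert, mem_singleton] at hi
    rcases hi with rfl | rfl
    · simp [hxy.ne, hxz.ne, ha hyz]
    · simp [hyz.ne', hxz.ne', ha hxy]
  · intro i h1 h2
    simp only [mem_insert, mem_singleton, not_or] at h1 h2
    simp [h1, h2]
  · simp only [Pi.add_apply, add_smul, sum_add_distrib, Pi.single_apply, ite_smul, zero_smul,
      sum_ite_eq', mem_univ, if_true, vec, Prod.smul_mk, smul_eq_mul, mul_one, Prod.mk_add_mk,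
      Prod.mk_eq_zero]
    constructor <;> ring

theorem card_le_two_of_linearIndepOn {s : Finset (Fin n)}
    (h : LinearIndepOn ℝ (vec a) (s : Set (Fin n))) : s.card ≤ 2 := by
  have h1 := LinearIndependent.fintype_card_le_finrank (R := ℝ) (b := fun i : s => vec a i) h
  rw [Module.finrank_prod, Module.finrank_self, Fintype.card_coe] at h1
  exact h1

theorem exists_lt_lt_of_card_eq_three {s : Finset (Fin n)} (hc : s.card = 3) :
    ∃ x y z, x < y ∧ y < z ∧ s = {x, y, z} := by
  obtain ⟨x, y, z, h1, h2, h3, hC⟩ := card_eq_three.1 hc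
  rcases lt_or_gt_of_ne h1 with h1 | h1 <;> rcases lt_or_gt_of_ne h2 with h2 | h2 <;>
    rcases lt_or_gt_of_ne h3 with h3 | h3
  · exact ⟨x, y, z, h1, h3, hC⟩
  · exact ⟨x, z, y, h2, h3, by rw [hC]; ext v; simp only [mem_insert, mem_singleton]; tauto⟩
  · exact absurd (h1.trans h3) h2.not_gt
  · exact ⟨z, x, y, h2, h1, by rw [hC]; ext v; simp only [mem_insert, mem_singleton]; tauto⟩
  · exact ⟨y, x, z, h1, h2, by rw [hC]; ext v; simp only [mem_insert, mem_singleton]; tauto⟩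
  · exact absurd (h3.trans h1) h2.not_gt
  · exact ⟨y, z, x, h3, h2, by rw [hC]; ext v; simp only [mem_insert, mem_singleton]; tauto⟩
  · exact ⟨z, y, x, h3, h1, by rw [hC]; ext v; simp only [mem_insert, mem_singleton]; tauto⟩

/-- Minimality in the plane bounds the support by three, and one or two of the vectors are
independent. For `x < y < z`, eliminating `α y` gives `α x * (a y - a x) = α z * (a z - a y)`: the
outer signs agree and the middle one is opposite. -/
theorem IsCircuit.eq_or_eq (ha : StrictMono a) {P N : Finset (Fin n)} (h : IsCircuit a P N) :
    ∃ x y z, x < y ∧ y < z ∧ (P = {y} ∧ N = {x, z} ∨ P = {x, z} ∧ N = {y}) := by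
  obtain ⟨hd, ⟨i0, hi0⟩, hind, α, hP, hN, h0, hs⟩ := h
  have hcard : (P ∪ N).card ≤ 3 := by
    have h1 := card_le_two_of_linearIndepOn (hind i0 hi0)
    have h3 := card_erase_of_mem hi0
    omega
  have hne : ∀ i ∈ P ∪ N, α i ≠ 0 := by
    intro i hi
    rcases mem_union.1 hi with h | h
    · exact (hP i h).ne'
    · exact (hN i h).ne
  have hsum : ∑ i ∈ P ∪ N, α i • vec a i = 0 := by
    rw [← hs]
    refine sum_subset (subset_univ _) fun i _ hi => ?_
    rw [mem_union, not_or] at hi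
    rw [h0 i hi.1 hi.2, zero_smul]
  have hmemP : ∀ i ∈ P ∪ N, 0 < α i → i ∈ P := by
    intro i hi hpos
    rcases mem_union.1 hi with h | h
    · exact h
    · exact absurd (hN i h) hpos.not_gt
  have hmemN : ∀ i ∈ P ∪ N, α i < 0 → i ∈ N := by
    intro i hi hpos
    rcases mem_union.1 hi with h | h
    · exact absurd (hP i h) hpos.not_gt
    · exact h
  have hpos : 0 < (P ∪ N).card := card_pos.2 ⟨i0, hi0⟩
  have hc : (P ∪ N).card = 1 ∨ (P ∪ N).card = 2 ∨ (P ∪ N).card = 3 := by omega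
  rcases hc with hc | hc | hc
  · obtain ⟨i, hi⟩ := card_eq_one.1 hc
    rw [hi, sum_singleton] at hsum
    simp only [vec, Prod.smul_mk, smul_eq_mul, mul_one, Prod.mk_eq_zero] at hsum
    exact absurd hsum.2 (hne i (by simp [hi]))
  · obtain ⟨i, j, hij, hi⟩ := card_eq_two.1 hc
    rw [hi, sum_pair hij] at hsum
    simp only [vec, Prod.smul_mk, smul_eq_mul, mul_one, Prod.mk_add_mk, Prod.mk_eq_zero] at hsum
    have h1 : α i * (a i - a j) = 0 := by
      have : α j = - α i := by linarith [hsum.2]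
      rw [this] at hsum
      linarith [hsum.1]
    rcases mul_eq_zero.1 h1 with h | h
    · exact absurd h (hne i (by simp [hi]))
    · exact absurd h (sub_ne_zero.2 (ha.injective.ne hij))
  · obtain ⟨x, y, z, hxy, hyz, hC⟩ : ∃ x y z, x < y ∧ y < z ∧ P ∪ N = {x, y, z} :=
      exists_lt_lt_of_card_eq_three hc
    have hxz := hxy.trans hyz
    rw [hC, sum_insert (by simp [hxy.ne, hxz.ne]), sum_pair hyz.ne] at hsum
    simp only [vec, Prod.smul_mk, smul_eq_mul, mul_one, Prod.mk_add_mk, Prod.mk_eq_zero] at hsum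
    obtain ⟨e1, e2⟩ := hsum
    have f1 : α x * (a y - a x) = α z * (a z - a y) := by
      have : α y = -(α x + α z) := by linarith
      rw [this] at e1
      linarith
    have p1 := sub_pos.2 (ha hxy)
    have p2 := sub_pos.2 (ha hyz)
    have hx : x ∈ P ∪ N := by simp [hC]
    have hy : y ∈ P ∪ N := by simp [hC]
    have hz : z ∈ P ∪ N := by simp [hC]
    refine ⟨x, y, z, hxy, hyz, ?_⟩
    have hfin : ∀ {Q R : Finset (Fin n)}, Disjoint Q R → Q ∪ R = {x, y, z} → x ∈ Q → z ∈ Q →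
        y ∈ R → Q = {x, z} ∧ R = {y} := by
      intro Q R hQR hU h1 h2 h3
      rw [disjoint_left] at hQR
      have hv : ∀ v, v ∈ Q ∨ v ∈ R ↔ v = x ∨ v = y ∨ v = z := by
        intro v
        rw [← mem_union, hU]
        simp
      constructor
      · ext v
        simp only [mem_insert, mem_singleton]
        constructor
        · intro hvQ
          rcases (hv v).1 (Or.inl hvQ) with rfl | rfl | rfl
          · exact Or.inl rfl
          · exact absurd h3 (hQR hvQ)
          · exact Or.inr rfl
        · rintro (rfl | rfl) <;> assumption
      · ext v
        simp only [mem_singleton]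
        constructor
        · intro hvR
          rcases (hv v).1 (Or.inr hvR) with rfl | rfl | rfl
          · exact absurd hvR (hQR h1)
          · rfl
          · exact absurd hvR (hQR h2)
        · rintro rfl
          assumption
    rcases lt_or_gt_of_ne (hne x hx) with hlt | hgt
    · have hz' : α z < 0 := by
        by_contra hcon
        nlinarith [mul_neg_of_neg_of_pos hlt p1, mul_nonneg (not_lt.1 hcon) p2.le]
      left
      exact (hfin hd.symm (by rw [union_comm, hC]) (hmemN x hx hlt) (hmemN z hz hz')
        (hmemP y hy (by linarith))).symm
    · have hz' : 0 < α z := by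
        by_contra hcon
        nlinarith [mul_pos hgt p1, mul_nonneg (neg_nonneg.2 (not_lt.1 hcon)) p2.le]
      right
      exact hfin hd hC (hmemP x hx hgt) (hmemP z hz hz') (hmemN y hy (by linarith))

theorem IsCircuit.eq_of_mem (ha : StrictMono a) {P N : Finset (Fin n)} (h : IsCircuit a P N)
    {x y z : Fin n} (hxz : x ≠ z) (hy : y ∈ P) (hx : x ∈ N) (hz : z ∈ N) :
    P = {y} ∧ N = {x, z} := by
  obtain ⟨x', y', z', h1, h2, ⟨rfl, rfl⟩ | ⟨rfl, rfl⟩⟩ := h.eq_or_eq ha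
  · grind
  · grind

/-- The tiles of a hexagon in the position in which `y` occurs alone. -/
theorem tilesOf_braid_left {w : Equiv.Perm ℕ} {q : ℕ} {x y z : Fin n} (hx : w q = x)
    (hy : w (q + 1) = y) (hz : w (q + 1 + 1) = z) (β : List ℕ) :
    tilesOf n w (q :: (q + 1) :: q :: β) = (pre n w q, {x, y}) ::
      (insert y (pre n w q), {x, z}) :: (pre n w q, {y, z}) ::
      tilesOf n (w * adj q * adj (q + 1) * adj q) β := by
  have e1 : (w * adj q) q = y := by rw [mul_adj_left, hy]
  have e2 : (w * adj q) (q + 1) = x := by rw [mul_adj_right, hx]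
  have e3 : (w * adj q) (q + 1 + 1) = z := by rw [mul_adj_of_ne _ (by omega) (by omega), hz]
  have f1 : (w * adj q * adj (q + 1)) q = y := by rw [mul_adj_of_ne _ (by omega) (by omega), e1]
  have f2 : (w * adj q * adj (q + 1)) (q + 1) = z := by rw [mul_adj_left, e3]
  rw [tilesOf, tilesOf, tilesOf, tileAt_eq hx hy, tileAt_eq e2 e3, tileAt_eq f1 f2, pre_succ e1,
    pre_mul_adj _ (by omega), pre_mul_adj _ (by omega), pre_mul_adj _ (by omega)]

/-- The tiles of a hexagon in the position in which `x` and `z` occur without `y`. -/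
theorem tilesOf_braid_right {w : Equiv.Perm ℕ} {q : ℕ} {x y z : Fin n} (hx : w q = x)
    (hy : w (q + 1) = y) (hz : w (q + 1 + 1) = z) (β : List ℕ) :
    tilesOf n w ((q + 1) :: q :: (q + 1) :: β) = (insert x (pre n w q), {y, z}) ::
      (pre n w q, {x, z}) :: (insert z (pre n w q), {x, y}) ::
      tilesOf n (w * adj q * adj (q + 1) * adj q) β := by
  have e1 : (w * adj (q + 1)) q = x := by rw [mul_adj_of_ne _ (by omega) (by omega), hx]
  have e2 : (w * adj (q + 1)) (q + 1) = z := by rw [mul_adj_left, hz]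
  have e3 : (w * adj (q + 1)) (q + 1 + 1) = y := by rw [mul_adj_right, hy]
  have f1 : (w * adj (q + 1) * adj q) q = z := by rw [mul_adj_left, e2]
  have f2 : (w * adj (q + 1) * adj q) (q + 1) = x := by rw [mul_adj_right, e1]
  have f3 : (w * adj (q + 1) * adj q) (q + 1 + 1) = y := by
    rw [mul_adj_of_ne _ (by omega) (by omega), e3]
  rw [tilesOf, tilesOf, tilesOf, tileAt_eq hy hz, tileAt_eq e1 e2, tileAt_eq f2 f3, pre_succ f1,
    pre_succ hx, pre_mul_adj _ (by omega), pre_mul_adj _ (by omega), pre_mul_adj _ (by omega),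
    mul_adj_braid]

theorem exchangeTiles_left {A : Finset (Fin n)} {x y z : Fin n} (hxy : x < y) (hyz : y < z) :
    exchangeTiles A {y} {x, z} = {(A, {x, y}), (insert y A, {x, z}), (A, {y, z})} := by
  have hxz := hxy.trans hyz
  have h1 : ({y} ∪ {x, z} : Finset (Fin n)).erase y = {x, z} := by grind
  have h2 : ({y} ∪ {x, z} : Finset (Fin n)).erase x = {y, z} := by grind
  have h3 : ({y} ∪ {x, z} : Finset (Fin n)).erase z = {x, y} := by grind
  rw [exchangeTiles, image_singleton, image_insert, image_singleton, h1, h2, h3]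
  ext t
  simp only [mem_union, mem_insert, mem_singleton]
  tauto

theorem exchangeTiles_right {A : Finset (Fin n)} {x y z : Fin n} (hxy : x < y) (hyz : y < z) :
    exchangeTiles A {x, z} {y} = {(insert x A, {y, z}), (A, {x, z}), (insert z A, {x, y})} := by
  have hxz := hxy.trans hyz
  have h1 : ({x, z} ∪ {y} : Finset (Fin n)).erase y = {x, z} := by grind
  have h2 : ({x, z} ∪ {y} : Finset (Fin n)).erase x = {y, z} := by grind
  have h3 : ({x, z} ∪ {y} : Finset (Fin n)).erase z = {x, y} := by grind
  rw [exchangeTiles, image_singleton, image_insert, image_singleton, h1, h2, h3]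
  ext t
  simp only [mem_union, mem_insert, mem_singleton]
  tauto

theorem subset_insert_cases {A S : Finset (Fin n)} {i j : Fin n} (h1 : A ⊆ S)
    (h2 : S ⊆ A ∪ {i, j}) :
    S = A ∨ S = insert i A ∨ S = insert j A ∨ S = insert i (insert j A) := by
  grind

/-- The two tilings of a hexagon share its six boundary vertices. They differ in the inner one,
which is `insert y A` here and `insert x (insert z A)` after the exchange. -/
theorem vertices_subset_left {T T' : FineZonotopalTiling a} {A : Finset (Fin n)} {x y z : Fin n}
    (hxy : x < y) (hyz : y < z)
    (h1 : T.tiles \ T'.tiles = exchangeTiles A {y} {x, z})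
    (h2 : T'.tiles \ T.tiles = exchangeTiles A {x, z} {y}) {S : Finset (Fin n)}
    (hS : S ∈ T.vertices) : S ∈ T'.vertices ∨ S = insert y A := by
  rw [exchangeTiles_left hxy hyz] at h1
  rw [exchangeTiles_right hxy hyz] at h2
  obtain ⟨t, ht, hS1, hS2⟩ := hS
  by_cases ht' : t ∈ T'.tiles
  · exact Or.inl ⟨t, ht', hS1, hS2⟩
  have m1 : (insert x A, {y, z}) ∈ T'.tiles := by
    have : (insert x A, {y, z}) ∈ T'.tiles \ T.tiles := by rw [h2]; simp
    exact (mem_sdiff.1 this).1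
  have m2 : (A, {x, z}) ∈ T'.tiles := by
    have : (A, {x, z}) ∈ T'.tiles \ T.tiles := by rw [h2]; simp
    exact (mem_sdiff.1 this).1
  have m3 : (insert z A, {x, y}) ∈ T'.tiles := by
    have : (insert z A, {x, y}) ∈ T'.tiles \ T.tiles := by rw [h2]; simp
    exact (mem_sdiff.1 this).1
  have v1 : A ∈ T'.vertices := ⟨_, m2, by grind⟩
  have v2 : insert x A ∈ T'.vertices := ⟨_, m1, by grind⟩
  have v3 : insert z A ∈ T'.vertices := ⟨_, m3, by grind⟩
  have v4 : insert x (insert y A) ∈ T'.vertices := ⟨_, m1, by grind⟩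
  have v5 : insert y (insert z A) ∈ T'.vertices := ⟨_, m3, by grind⟩
  have v6 : insert x (insert z (insert y A)) ∈ T'.vertices := ⟨_, m1, by grind⟩
  have v7 : insert x (insert z A) ∈ T'.vertices := ⟨_, m1, by grind⟩
  have : t ∈ T.tiles \ T'.tiles := mem_sdiff.2 ⟨ht, ht'⟩
  rw [h1] at this
  simp only [mem_insert, mem_singleton] at this
  rcases this with rfl | rfl | rfl
  · rcases subset_insert_cases hS1 hS2 with rfl | rfl | rfl | rfl
    · exact Or.inl v1
    · exact Or.inl v2
    · exact Or.inr rfl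
    · exact Or.inl v4
  · rcases subset_insert_cases hS1 hS2 with rfl | rfl | rfl | rfl
    · exact Or.inr rfl
    · exact Or.inl v4
    · rw [insert_comm]; exact Or.inl v5
    · exact Or.inl v6
  · rcases subset_insert_cases hS1 hS2 with rfl | rfl | rfl | rfl
    · exact Or.inl v1
    · exact Or.inr rfl
    · exact Or.inl v3
    · exact Or.inl v5

theorem vertices_subset_right {T T' : FineZonotopalTiling a} {A : Finset (Fin n)} {x y z : Fin n}
    (hxy : x < y) (hyz : y < z)
    (h1 : T.tiles \ T'.tiles = exchangeTiles A {y} {x, z})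
    (h2 : T'.tiles \ T.tiles = exchangeTiles A {x, z} {y}) {S : Finset (Fin n)}
    (hS : S ∈ T'.vertices) : S ∈ T.vertices ∨ S = insert x (insert z A) := by
  rw [exchangeTiles_left hxy hyz] at h1
  rw [exchangeTiles_right hxy hyz] at h2
  obtain ⟨t, ht, hS1, hS2⟩ := hS
  by_cases ht' : t ∈ T.tiles
  · exact Or.inl ⟨t, ht', hS1, hS2⟩
  have m1 : (A, {x, y}) ∈ T.tiles := by
    have : (A, {x, y}) ∈ T.tiles \ T'.tiles := by rw [h1]; simp
    exact (mem_sdiff.1 this).1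
  have m2 : (insert y A, {x, z}) ∈ T.tiles := by
    have : (insert y A, {x, z}) ∈ T.tiles \ T'.tiles := by rw [h1]; simp
    exact (mem_sdiff.1 this).1
  have m3 : (A, {y, z}) ∈ T.tiles := by
    have : (A, {y, z}) ∈ T.tiles \ T'.tiles := by rw [h1]; simp
    exact (mem_sdiff.1 this).1
  have v1 : A ∈ T.vertices := ⟨_, m1, by grind⟩
  have v2 : insert x A ∈ T.vertices := ⟨_, m1, by grind⟩
  have v3 : insert z A ∈ T.vertices := ⟨_, m3, by grind⟩
  have v4 : insert x (insert y A) ∈ T.vertices := ⟨_, m1, by grind⟩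
  have v5 : insert y (insert z A) ∈ T.vertices := ⟨_, m3, by grind⟩
  have v6 : insert x (insert z (insert y A)) ∈ T.vertices := ⟨_, m2, by grind⟩
  have : t ∈ T'.tiles \ T.tiles := mem_sdiff.2 ⟨ht, ht'⟩
  rw [h2] at this
  simp only [mem_insert, mem_singleton] at this
  rcases this with rfl | rfl | rfl
  · rcases subset_insert_cases hS1 hS2 with rfl | rfl | rfl | rfl
    · exact Or.inl v2
    · rw [insert_comm]; exact Or.inl v4
    · rw [insert_comm]; exact Or.inr rfl
    · rw [insert_comm z x, insert_comm y x, insert_comm y z]; exact Or.inl v6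
  · rcases subset_insert_cases hS1 hS2 with rfl | rfl | rfl | rfl
    · exact Or.inl v1
    · exact Or.inl v2
    · exact Or.inl v3
    · exact Or.inr rfl
  · rcases subset_insert_cases hS1 hS2 with rfl | rfl | rfl | rfl
    · exact Or.inl v3
    · exact Or.inr rfl
    · exact Or.inl v5
    · rw [insert_comm y z]; exact Or.inl v6

/-- Exchanging the tiles of a hexagon affects the vertices seen by no other circuit. -/
theorem exists_vertex_iff (ha : StrictMono a) {T T' : FineZonotopalTiling a} {A : Finset (Fin n)}
    {x y z : Fin n} (hxy : x < y) (hyz : y < z)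
    (h1 : T.tiles \ T'.tiles = exchangeTiles A {y} {x, z})
    (h2 : T'.tiles \ T.tiles = exchangeTiles A {x, z} {y}) {P N : Finset (Fin n)}
    (hC : IsCircuit a P N) (hne : (P, N) ≠ ({y}, {x, z})) (hne' : (P, N) ≠ ({x, z}, {y})) :
    (∃ S ∈ T.vertices, P ⊆ S ∧ Disjoint N S) ↔ ∃ S ∈ T'.vertices, P ⊆ S ∧ Disjoint N S := by
  have hxz := hxy.trans hyz
  have k1 := exchangeTiles_left (A := A) hxy hyz
  have k2 := exchangeTiles_right (A := A) hxy hyz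
  rw [← h1] at k1
  rw [← h2] at k2
  constructor
  · rintro ⟨S, hS, hP, hN⟩
    rcases vertices_subset_left hxy hyz h1 h2 hS with hS | rfl
    · exact ⟨S, hS, hP, hN⟩
    have m1 : (insert x A, {y, z}) ∈ T'.tiles := by
      have : (insert x A, {y, z}) ∈ T'.tiles \ T.tiles := by rw [k2]; simp
      exact (mem_sdiff.1 this).1
    have m3 : (insert z A, {x, y}) ∈ T'.tiles := by
      have : (insert z A, {x, y}) ∈ T'.tiles \ T.tiles := by rw [k2]; simp
      exact (mem_sdiff.1 this).1
    have m2 : (A, {x, z}) ∈ T'.tiles := by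
      have : (A, {x, z}) ∈ T'.tiles \ T.tiles := by rw [k2]; simp
      exact (mem_sdiff.1 this).1
    -- A neighbouring boundary vertex replaces the lost inner vertex, unless the circuit tests all
    -- of `x`, `y`, `z` with the excluded signs.
    by_cases hy : y ∈ P
    · by_cases hx : x ∈ N
      · by_cases hz : z ∈ N
        · obtain ⟨rfl, rfl⟩ := hC.eq_of_mem ha hxz.ne hy hx hz
          exact absurd rfl hne
        · exact ⟨insert z (insert y A), ⟨_, m3, by grind⟩, by grind,
            by rw [disjoint_left] at hN ⊢; grind⟩
      · exact ⟨insert x (insert y A), ⟨_, m1, by grind⟩, by grind,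
          by rw [disjoint_left] at hN ⊢; grind⟩
    · exact ⟨A, ⟨_, m2, by grind⟩, by grind, by rw [disjoint_left] at hN ⊢; grind⟩
  · rintro ⟨S, hS, hP, hN⟩
    rcases vertices_subset_right hxy hyz h1 h2 hS with hS | rfl
    · exact ⟨S, hS, hP, hN⟩
    have m1 : (A, {x, y}) ∈ T.tiles := by
      have : (A, {x, y}) ∈ T.tiles \ T'.tiles := by rw [k1]; simp
      exact (mem_sdiff.1 this).1
    have m2 : (insert y A, {x, z}) ∈ T.tiles := by
      have : (insert y A, {x, z}) ∈ T.tiles \ T'.tiles := by rw [k1]; simp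
      exact (mem_sdiff.1 this).1
    have m3 : (A, {y, z}) ∈ T.tiles := by
      have : (A, {y, z}) ∈ T.tiles \ T'.tiles := by rw [k1]; simp
      exact (mem_sdiff.1 this).1
    by_cases hy : y ∈ N
    · by_cases hx : x ∈ P
      · by_cases hz : z ∈ P
        · obtain ⟨rfl, rfl⟩ := hC.swap.eq_of_mem ha hxz.ne hy hx hz
          exact absurd rfl hne'
        · exact ⟨insert x A, ⟨_, m1, by grind⟩, by grind,
            by rw [disjoint_left] at hN ⊢; grind⟩
      · exact ⟨insert z A, ⟨_, m3, by grind⟩, by grind,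
          by rw [disjoint_left] at hN ⊢; grind⟩
    · exact ⟨insert x (insert y (insert z A)), ⟨_, m2, by grind⟩, by grind,
        by rw [disjoint_left] at hN ⊢; grind⟩

/-- A prefix either ends within `α`, before `i` and `j` can have been inverted, or contains the
letter `p`, after which `k` and `l` stay inverted. This excludes vertices of the opposite
orientation. -/
theorem run_prefix_cases {w : Equiv.Perm ℕ} {α β u1 u2 : List ℕ} {p : ℕ}
    (hu : IsPath n w (α ++ p :: β)) (h : α ++ p :: β = u1 ++ u2) {i j k l : ℕ}
    (hij : i < j) (hinv : (run w α).symm i < (run w α).symm j) (hkl : k < l)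
    (hinv' : (run w α * adj p).symm l < (run w α * adj p).symm k) :
    (run w u1).symm i < (run w u1).symm j ∨ (run w u1).symm l < (run w u1).symm k := by
  have hu' := hu
  rw [h] at hu'
  rcases List.append_eq_append_iff.1 h with ⟨γ, rfl, hγ⟩ | ⟨γ, rfl, hγ⟩
  · rcases γ with _ | ⟨r, γ⟩
    · left
      simpa using hinv
    · right
      rw [List.cons_append, List.cons.injEq] at hγ
      obtain ⟨rfl, rfl⟩ := hγ
      have := hu.of_append.2.2
      rw [run_append]
      exact this.symm_lt_of_inverted hkl hinv'
  · left
    by_contra hcon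
    have hne : (run w u1).symm i ≠ (run w u1).symm j := by
      rw [ne_eq, (run w u1).symm.injective.eq_iff]
      omega
    rw [List.append_assoc] at hu
    have := IsPath.symm_lt_of_inverted hu.of_append hij (by omega)
    rw [run_append] at hinv
    omega

set_option maxHeartbeats 1000000 in
theorem isFlipAtLevel_braid (ha : StrictMono a) (hn : 2 ≤ n) {α β : List ℕ} {q : ℕ}
    (hu : IsPath n 1 (α ++ q :: (q + 1) :: q :: β))
    (hu' : IsPath n 1 (α ++ (q + 1) :: q :: (q + 1) :: β)) :
    IsFlipAtLevel (q + 1) (tilingOf ha hn _ hu) (tilingOf ha hn _ hu') := by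
  set w := run 1 α with hw
  have hfix : Fixes n w := run_fixes_left (fixes_one n) hu
  have hp := hu.of_append
  have hp' := hu'.of_append
  rw [← hw] at hp hp'
  obtain ⟨x, y, hx, hy, -⟩ := exists_swap hfix hp.1
  obtain ⟨-, z, -, hz, -⟩ := exists_swap hfix hp'.1
  have hxy : x < y := by
    rw [Fin.lt_def, ← hx, ← hy]
    exact hp.2.1
  have hyz : y < z := by
    rw [Fin.lt_def, ← hz, ← hy]
    exact hp'.2.1
  have hxz := hxy.trans hyz
  set A := pre n w q with hA
  have sx : w.symm x = q := by rw [← hx]; simp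
  have sy : w.symm y = q + 1 := by rw [← hy]; simp
  have sz : w.symm z = q + 1 + 1 := by rw [← hz]; simp
  have hxA : x ∉ A := by rw [mem_pre]; omega
  have hyA : y ∉ A := by rw [mem_pre]; omega
  have hzA : z ∉ A := by rw [mem_pre]; omega
  have e1 : tilesOf n 1 (α ++ q :: (q + 1) :: q :: β) = tilesOf n 1 α ++ (A, {x, y}) ::
      (insert y A, {x, z}) :: (A, {y, z}) ::
      tilesOf n (w * adj q * adj (q + 1) * adj q) β := by
    rw [tilesOf_append, ← hw, tilesOf_braid_left hx hy hz]
  have e2 : tilesOf n 1 (α ++ (q + 1) :: q :: (q + 1) :: β) = tilesOf n 1 α ++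
      (insert x A, {y, z}) :: (A, {x, z}) :: (insert z A, {x, y}) ::
      tilesOf n (w * adj q * adj (q + 1) * adj q) β := by
    rw [tilesOf_append, ← hw, tilesOf_braid_right hx hy hz]
  have d1 := nodup_map_snd (fixes_one n) hu
  have d2 := nodup_map_snd (fixes_one n) hu'
  rw [e1] at d1
  rw [e2] at d2
  set D := tilesOf n 1 α
  set D' := tilesOf n (w * adj q * adj (q + 1) * adj q) β
  -- Each pair is swapped once, so the tiles outside the hexagon use no pair from `x`, `y`, `z`.
  have hDB : ∀ t ∈ D ++ D', t.2 ≠ {x, y} ∧ t.2 ≠ {x, z} ∧ t.2 ≠ {y, z} := by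
    intro t ht
    simp only [List.map_append, List.map_cons, List.nodup_append, List.nodup_cons,
      List.mem_cons] at d1
    obtain ⟨-, ⟨h1, h2, h3, -⟩, h4⟩ := d1
    rcases List.mem_append.1 ht with ht | ht
    · have hm := List.mem_map_of_mem (f := Prod.snd) ht
      exact ⟨h4 _ hm _ (by simp), h4 _ hm _ (by simp), h4 _ hm _ (by simp)⟩
    · have hm := List.mem_map_of_mem (f := Prod.snd) ht
      refine ⟨fun h => h1 (Or.inr (Or.inr (h ▸ hm))), fun h => h2 (Or.inr (h ▸ hm)),
        fun h => h3 (h ▸ hm)⟩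
  have mT : ∀ t, t ∈ (tilingOf ha hn _ hu).tiles ↔ t ∈ D ++ D' ∨
      t = (A, {x, y}) ∨ t = (insert y A, {x, z}) ∨ t = (A, {y, z}) := by
    intro t
    simp only [tilingOf, List.mem_toFinset, e1, List.mem_append, List.mem_cons]
    tauto
  have mT' : ∀ t, t ∈ (tilingOf ha hn _ hu').tiles ↔ t ∈ D ++ D' ∨
      t = (insert x A, {y, z}) ∨ t = (A, {x, z}) ∨ t = (insert z A, {x, y}) := by
    intro t
    simp only [tilingOf, List.mem_toFinset, e2, List.mem_append, List.mem_cons]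
    tauto
  have p1 : ({x, y} : Finset (Fin n)) ≠ {x, z} := fun h => by
    have : y ∈ ({x, z} : Finset (Fin n)) := h ▸ by simp
    simp [hxy.ne', hyz.ne] at this
  have p2 : ({x, y} : Finset (Fin n)) ≠ {y, z} := fun h => by
    have : x ∈ ({y, z} : Finset (Fin n)) := h ▸ by simp
    simp [hxy.ne, hxz.ne] at this
  have p3 : ({x, z} : Finset (Fin n)) ≠ {y, z} := fun h => by
    have : x ∈ ({y, z} : Finset (Fin n)) := h ▸ by simp
    simp [hxy.ne, hxz.ne] at this
  have q1 : A ≠ insert x A := fun h => hxA (h ▸ mem_insert_self _ _)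
  have q2 : A ≠ insert y A := fun h => hyA (h ▸ mem_insert_self _ _)
  have q3 : A ≠ insert z A := fun h => hzA (h ▸ mem_insert_self _ _)
  have hex : ∀ t : Finset (Fin n) × Finset (Fin n),
      (t = (A, {x, y}) ∨ t = (insert y A, {x, z}) ∨ t = (A, {y, z})) →
      ¬ (t = (insert x A, {y, z}) ∨ t = (A, {x, z}) ∨ t = (insert z A, {x, y})) := by
    rintro t (rfl | rfl | rfl) (h | h | h) <;> rw [Prod.mk.injEq] at h
    · exact q1 h.1
    · exact p1 h.2
    · exact q3 h.1
    · exact p3 h.2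
    · exact q2 h.1.symm
    · exact p1 h.2.symm
    · exact q1 h.1
    · exact p3 h.2.symm
    · exact q3 h.1
  have hDE : ∀ t ∈ D ++ D', ¬ (t = (A, {x, y}) ∨ t = (insert y A, {x, z}) ∨ t = (A, {y, z})) := by
    rintro t ht (rfl | rfl | rfl)
    · exact (hDB _ ht).1 rfl
    · exact (hDB _ ht).2.1 rfl
    · exact (hDB _ ht).2.2 rfl
  have hDE' : ∀ t ∈ D ++ D', ¬ (t = (insert x A, {y, z}) ∨ t = (A, {x, z}) ∨
      t = (insert z A, {x, y})) := by
    rintro t ht (rfl | rfl | rfl)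
    · exact (hDB _ ht).2.2 rfl
    · exact (hDB _ ht).2.1 rfl
    · exact (hDB _ ht).1 rfl
  have h1 : (tilingOf ha hn _ hu).tiles \ (tilingOf ha hn _ hu').tiles =
      exchangeTiles A {y} {x, z} := by
    rw [exchangeTiles_left hxy hyz]
    ext t
    rw [mem_sdiff, mT, mT']
    simp only [mem_insert, mem_singleton]
    have := hex t
    have := hDE t
    tauto
  have h2 : (tilingOf ha hn _ hu').tiles \ (tilingOf ha hn _ hu).tiles =
      exchangeTiles A {x, z} {y} := by
    rw [exchangeTiles_right hxy hyz]
    ext t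
    rw [mem_sdiff, mT, mT']
    simp only [mem_insert, mem_singleton]
    have := hex t
    have := hDE' t
    tauto
  refine ⟨{y}, {x, z}, A, ⟨isCircuit_of_lt ha hxy hyz, ⟨⟨insert y A, ⟨_, (mT _).2 (Or.inr
    (Or.inl rfl)), by grind⟩, by simp, ?_⟩, ?_⟩, ⟨⟨insert x (insert z A), ⟨_, (mT' _).2 (Or.inr
    (Or.inl rfl)), by grind⟩, by grind, ?_⟩, ?_⟩, ?_⟩, ?_, h1, h2, ?_⟩
  · rw [disjoint_left]
    simp only [mem_insert, mem_singleton, not_or]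
    rintro v (rfl | rfl)
    · exact ⟨hxy.ne, hxA⟩
    · exact ⟨hyz.ne', hzA⟩
  · rintro ⟨S, ⟨t, ht, hS1, hS2⟩, hNS, hPS⟩
    obtain ⟨u1, u2, m, hu12, rfl⟩ :=
      exists_pre_of_mem_tilesOf (fixes_one n) hu (List.mem_toFinset.1 ht) hS1 hS2
    have hyS : y ∉ pre n (run 1 u1) m := disjoint_singleton_left.1 hPS
    have hxS : x ∈ pre n (run 1 u1) m := hNS (by simp)
    have hzS : z ∈ pre n (run 1 u1) m := hNS (by simp)
    rw [mem_pre] at hyS hxS hzS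
    -- Such an initial set needs `x` and `z` both before `y`, but in this word `y` overtakes `x`
    -- before `z` overtakes `y`.
    have := run_prefix_cases hu hu12 (i := y) (j := z) hyz (by rw [← hw]; omega)
      (k := x) (l := y) hxy (by
        rw [← hw, symm_mul_adj, symm_mul_adj, sx, sy, adj_apply, adj_apply]
        simp)
    omega
  · simp [hxy.ne', hyz.ne, hyA]
  · rintro ⟨S, ⟨t, ht, hS1, hS2⟩, hNS, hPS⟩
    obtain ⟨u1, u2, m, hu12, rfl⟩ :=
      exists_pre_of_mem_tilesOf (fixes_one n) hu' (List.mem_toFinset.1 ht) hS1 hS2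
    have hyS : y ∈ pre n (run 1 u1) m := hNS (by simp)
    rw [disjoint_left] at hPS
    have hxS : x ∉ pre n (run 1 u1) m := hPS (by simp)
    have hzS : z ∉ pre n (run 1 u1) m := hPS (by simp)
    rw [mem_pre] at hyS hxS hzS
    -- Here `y` would have to precede both `x` and `z`, but in this word `z` overtakes `y` before
    -- `y` overtakes `x`.
    have := run_prefix_cases hu' hu12 (i := x) (j := y) hxy (by rw [← hw]; omega)
      (k := y) (l := z) hyz (by
        rw [← hw, symm_mul_adj, symm_mul_adj, sz, sy, adj_apply, adj_apply]
        simp)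
    omega
  · intro P' N' hC hne hne'
    have k1 := exists_vertex_iff ha hxy hyz h1 h2 hC hne hne'
    have k2 := exists_vertex_iff ha hxy hyz h1 h2 hC.swap
      (fun h => hne' (by simp_all)) (fun h => hne (by simp_all))
    rw [Orients, Orients, k1, k2]
  · rw [disjoint_right]
    simp only [mem_union, mem_insert, mem_singleton]
    rintro v (rfl | rfl | rfl) <;> assumption
  · rw [card_pre hfix (by have := hp.1; omega)]

/-- Moves of sequences of swaps that do not involve `κ` are flips at other levels. -/
theorem connectedAvoiding_of_weq (ha : StrictMono a) (hn : 2 ≤ n) {κ : ℕ} {u v : List ℕ}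
    (h : WEq κ u v) : ∀ (α U V : List ℕ), U = α ++ u → V = α ++ v → ∀ (hU : IsPath n 1 U)
    (hV : IsPath n 1 V),
    ConnectedAvoiding {κ + 1, κ} (tilingOf ha hn U hU) (tilingOf ha hn V hV) := by
  induction h with
  | refl u =>
    rintro α U V rfl rfl hU hV
    exact Relation.ReflTransGen.refl
  | symm _ ih =>
    intro α U V hU' hV' hU hV
    exact (ih α V U hV' hU' hV hU).symm
  | trans h _ ih ih' =>
    rintro α U V rfl rfl hU hV
    have hM := ((h.append_left α).isPath_iff 1).1 hU
    exact Relation.ReflTransGen.trans (ih α _ _ rfl rfl hU hM) (ih' α _ _ rfl rfl hM hV)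
  | cons q _ ih =>
    rintro α U V hU' hV' hU hV
    exact ih (α ++ [q]) U V (by simp [hU']) (by simp [hV']) hU hV
  | comm p q u h =>
    rintro α U V rfl rfl hU hV
    -- Distant letters do not affect each other's tiles, so the tiling is unchanged.
    have : tilingOf ha hn _ hU = tilingOf ha hn _ hV := by
      ext t
      have e1 : tileAt n (run 1 α * adj p) q = tileAt n (run 1 α) q := by
        simp only [tileAt, Prod.mk.injEq]
        refine ⟨pre_mul_adj _ (by omega), ?_⟩
        ext v
        simp only [mem_filter, mem_univ, true_and, symm_mul_adj, adj_apply]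
        split_ifs <;> omega
      have e2 : tileAt n (run 1 α * adj q) p = tileAt n (run 1 α) p := by
        simp only [tileAt, Prod.mk.injEq]
        refine ⟨pre_mul_adj _ (by omega), ?_⟩
        ext v
        simp only [mem_filter, mem_univ, true_and, symm_mul_adj, adj_apply]
        split_ifs <;> omega
      simp only [tilingOf, List.mem_toFinset, tilesOf_append, tilesOf, List.mem_append,
        List.mem_cons, mul_adj_comm _ h, e1, e2]
      tauto
    rw [this]
    exact Relation.ReflTransGen.refl
  | braid q u hq hq' =>
    rintro α U V rfl rfl hU hV
    refine Relation.ReflTransGen.single ⟨q + 1, ?_, isFlipAtLevel_braid ha hn hU hV⟩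
    simp only [Set.mem_insert_iff, Set.mem_singleton_iff]
    omega

end ZonoHyper
end
-- Cross-sections and their chains
noncomputable section
namespace ZonoHyper

open Finset

variable {n : ℕ} {a : Fin n → ℝ}

/-- The sum of the elements, which increases along monotone steps. -/
def weight (S : Finset (Fin n)) : ℕ := ∑ v ∈ S, (v : ℕ)

theorem MonotoneStep.weight_lt {S S' : Finset (Fin n)} (h : MonotoneStep S S') :
    weight S < weight S' := by
  obtain ⟨I, i, j, hi, hj, hij, rfl, rfl⟩ := h
  rw [weight, weight, sum_insert hi, sum_insert hj]
  have : (i : ℕ) < j := hij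
  omega

theorem pairwise_weight {H : List (Finset (Fin n))} (h : H.IsChain MonotoneStep) :
    H.Pairwise fun S S' => weight S < weight S' := by
  have h1 : H.IsChain fun S S' => weight S < weight S' := h.imp fun _ _ => MonotoneStep.weight_lt
  let R : Finset (Fin n) → Finset (Fin n) → Prop := fun S S' => weight S < weight S'
  have : Trans R R R := ⟨lt_trans⟩
  exact List.isChain_iff_pairwise (R := R).1 h1

theorem pair_infix_cons_cons {β : Type*} {u v p q : β} {l : List β} :
    [u, v] <:+: p :: q :: l ↔ (u = p ∧ v = q) ∨ [u, v] <:+: q :: l := by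
  rw [List.infix_cons_iff, List.cons_prefix_cons, List.cons_prefix_cons]
  simp

theorem not_pair_infix_singleton {β : Type*} {u v p : β} : ¬ [u, v] <:+: [p] := by
  intro h
  have := h.length_le
  simp at this

theorem pair_infix_append {β : Type*} {u v p q : β} {X Y : List β} :
    [u, v] <:+: X ++ p :: q :: Y ↔
      [u, v] <:+: X ++ [p] ∨ (u = p ∧ v = q) ∨ [u, v] <:+: q :: Y := by
  induction X with
  | nil => simp [pair_infix_cons_cons, not_pair_infix_singleton]
  | cons b X ih =>
    rcases X with _ | ⟨c, X⟩
    · simp [pair_infix_cons_cons, not_pair_infix_singleton]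
    · simp only [List.cons_append] at ih ⊢
      rw [pair_infix_cons_cons, ih, pair_infix_cons_cons]
      tauto

/-- A list that is increasing for `φ` is determined by its head and its consecutive pairs. -/
theorem eq_of_pair_infix_iff {β : Type*} (φ : β → ℕ) {l l' : List β}
    (hl : l.Pairwise fun x y => φ x < φ y) (hl' : l'.Pairwise fun x y => φ x < φ y)
    (hh : l.head? = l'.head?) (h : ∀ u v, [u, v] <:+: l ↔ [u, v] <:+: l') : l = l' := by
  induction l generalizing l' with
  | nil =>
    rcases l' with _ | ⟨b, l'⟩
    · rfl
    · simp at hh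
  | cons b l ih =>
    rcases l' with _ | ⟨b', l'⟩
    · simp at hh
    obtain rfl : b = b' := by simpa using hh
    rw [List.pairwise_cons] at hl hl'
    have key : ∀ {l l' : List β}, (∀ x ∈ l', φ b < φ x) →
        (∀ u v, [u, v] <:+: b :: l → [u, v] <:+: b :: l') → ∀ c, l.head? = some c →
        l'.head? = some c := by
      intro l l' hl' h c hc
      rcases l with _ | ⟨c', l⟩
      · simp at hc
      obtain rfl : c' = c := by simpa using hc
      have h1 := h b c' (pair_infix_cons_cons.2 (Or.inl ⟨rfl, rfl⟩))
      rcases l' with _ | ⟨d, l'⟩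
      · exact absurd h1 not_pair_infix_singleton
      rcases pair_infix_cons_cons.1 h1 with h2 | h2
      · simp [h2.2]
      · have := hl' b (h2.subset (by simp))
        omega
    have hhead : l.head? = l'.head? := by
      ext c
      exact ⟨key hl'.1 (fun u v => (h u v).1) c, key hl.1 (fun u v => (h u v).2) c⟩
    have key2 : ∀ {l l' : List β}, (∀ x ∈ l, φ b < φ x) →
        (∀ u v, [u, v] <:+: b :: l → [u, v] <:+: b :: l') → ∀ u v, [u, v] <:+: l →
        [u, v] <:+: l' := by
      intro l l' hl h u v huv
      have h1 := h u v (List.infix_cons_iff.2 (Or.inr huv))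
      rcases List.infix_cons_iff.1 h1 with h2 | h2
      · obtain ⟨rfl, -⟩ := List.cons_prefix_cons.1 h2
        have := hl u (huv.subset (by simp))
        omega
      · exact h2
    rw [ih hl.2 hl'.2 hhead fun u v => ⟨key2 hl.1 (fun u v => (h u v).1) u v,
      key2 hl'.1 (fun u v => (h u v).2) u v⟩]

/-- The relation that the diagonals of the tiles at level `k` define. -/
def Edge (k : ℕ) (T : FineZonotopalTiling a) (S S' : Finset (Fin n)) : Prop :=
  ∃ (A : Finset (Fin n)) (i j : Fin n), i < j ∧ (A, ({i, j} : Finset (Fin n))) ∈ T.tiles ∧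
    A.card + 1 = k ∧ S = insert i A ∧ S' = insert j A

/-- A cross-section prescribes only consecutive pairs. The first set is common and the weights
increase, so no set repeats and the pairs determine the list. -/
theorem crossSection_unique {k : ℕ} {T : FineZonotopalTiling a} {H H' : List (Finset (Fin n))}
    (h : IsHypertriangulation k H) (h' : IsHypertriangulation k H') (hT : IsCrossSection k T H)
    (hT' : IsCrossSection k T H') : H = H' :=
  eq_of_pair_infix_iff weight (pairwise_weight h.2.2.2) (pairwise_weight h'.2.2.2)
    (h.2.1.trans h'.2.1.symm) fun u v => (hT u v).trans (hT' u v).symm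

/-- The sets of the first `κ + 1` values along a sequence of swaps. -/
def levels (n κ : ℕ) : Equiv.Perm ℕ → List ℕ → List (Finset (Fin n))
  | w, [] => [pre n w (κ + 1)]
  | w, q :: u => (if q = κ then [pre n w (κ + 1)] else []) ++ levels n κ (w * adj q) u

theorem exists_levels_eq_cons (κ : ℕ) (w : Equiv.Perm ℕ) (u : List ℕ) :
    ∃ l, levels n κ w u = pre n w (κ + 1) :: l := by
  induction u generalizing w with
  | nil => exact ⟨[], rfl⟩
  | cons q u ih =>
    by_cases hq : q = κ
    · exact ⟨levels n κ (w * adj q) u, by simp [levels, hq]⟩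
    · obtain ⟨l, hl⟩ := ih (w * adj q)
      refine ⟨l, ?_⟩
      rw [levels, if_neg hq, List.nil_append, hl, pre_mul_adj _ (by omega)]

theorem getLast?_levels (κ : ℕ) (w : Equiv.Perm ℕ) (u : List ℕ) :
    (levels n κ w u).getLast? = some (pre n (run w u) (κ + 1)) := by
  induction u generalizing w with
  | nil => rfl
  | cons q u ih =>
    rw [levels, List.getLast?_append, ih]
    rfl

theorem card_of_mem_levels {κ : ℕ} (hκ : κ < n) {w : Equiv.Perm ℕ} (hw : Fixes n w) {u : List ℕ}
    (hu : IsPath n w u) : ∀ S ∈ levels n κ w u, S.card = κ + 1 := by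
  induction u generalizing w with
  | nil =>
    intro S hS
    rw [List.mem_singleton.1 hS, card_pre hw hκ]
  | cons q u ih =>
    intro S hS
    rcases List.mem_append.1 hS with h | h
    · split_ifs at h
      · rw [List.mem_singleton.1 h, card_pre hw hκ]
      · simp at h
    · exact ih (hw.mul_adj hu.1) hu.2.2 S h

theorem pre_mul_adj_self {w : Equiv.Perm ℕ} {κ : ℕ} {j : Fin n} (hj : w (κ + 1) = j) :
    pre n (w * adj κ) (κ + 1) = insert j (pre n w κ) := by
  rw [pre_succ (i := j) (by rw [mul_adj_left, hj]), pre_mul_adj _ (by omega)]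

theorem isChain_levels (κ : ℕ) {w : Equiv.Perm ℕ} (hw : Fixes n w) {u : List ℕ}
    (hu : IsPath n w u) : (levels n κ w u).IsChain MonotoneStep := by
  induction u generalizing w with
  | nil => exact List.isChain_singleton _
  | cons q u ih =>
    have h1 := ih (hw.mul_adj hu.1) hu.2.2
    by_cases hq : q = κ
    · subst hq
      obtain ⟨l, hl⟩ := exists_levels_eq_cons (n := n) q (w * adj q) u
      rw [levels, if_pos rfl]
      rw [hl] at h1 ⊢
      rw [List.singleton_append, List.isChain_cons_cons]
      refine ⟨?_, h1⟩
      obtain ⟨i, j, hi, hj, hij⟩ := exists_swap hw hu.1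
      refine ⟨pre n w q, i, j, ?_, ?_, ?_, pre_succ hi, pre_mul_adj_self hj⟩
      · rw [mem_pre, ← hi]; simp
      · rw [mem_pre, ← hj]; simp
      · rw [Fin.lt_def, ← hi, ← hj]; exact hu.2.1
    · rwa [levels, if_neg hq, List.nil_append]

theorem pair_infix_levels {κ : ℕ} {w : Equiv.Perm ℕ} (hw : Fixes n w) {u : List ℕ}
    (hu : IsPath n w u) {S S' : Finset (Fin n)} : [S, S'] <:+: levels n κ w u ↔
      ∃ (A : Finset (Fin n)) (i j : Fin n), i < j ∧ (A, ({i, j} : Finset (Fin n))) ∈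
        tilesOf n w u ∧ A.card + 1 = κ + 1 ∧ S = insert i A ∧ S' = insert j A := by
  induction u generalizing w with
  | nil => simp [levels, tilesOf, not_pair_infix_singleton]
  | cons q u ih =>
    have hIH := ih (hw.mul_adj hu.1) hu.2.2
    obtain ⟨i, j, hi, hj, -⟩ := exists_swap hw hu.1
    have hij : i < j := by rw [Fin.lt_def, ← hi, ← hj]; exact hu.2.1
    have hcard : (pre n w q).card = q := card_pre hw (by have := hu.1; omega)
    simp only [tilesOf, List.mem_cons, tileAt_eq hi hj]
    by_cases hq : q = κ
    · subst hq
      obtain ⟨l, hl⟩ := exists_levels_eq_cons (n := n) q (w * adj q) u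
      rw [levels, if_pos rfl, hl, List.singleton_append, pair_infix_cons_cons, ← hl, hIH,
        pre_mul_adj_self hj, pre_succ hi]
      constructor
      · rintro (⟨rfl, rfl⟩ | ⟨A, i', j', h1, h2, h3⟩)
        · exact ⟨_, i, j, hij, Or.inl rfl, by rw [hcard], rfl, rfl⟩
        · exact ⟨A, i', j', h1, Or.inr h2, h3⟩
      · rintro ⟨A, i', j', h1, h2 | h2, h3, h4, h5⟩
        · left
          rw [Prod.mk.injEq] at h2
          obtain ⟨rfl, h2⟩ := h2
          have hi' : i' = i ∨ i' = j := by
            have : i' ∈ ({i, j} : Finset (Fin n)) := h2 ▸ by simp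
            simpa using this
          have hj' : j' = i ∨ j' = j := by
            have : j' ∈ ({i, j} : Finset (Fin n)) := h2 ▸ by simp
            simpa using this
          obtain rfl : i' = i := by omega
          obtain rfl : j' = j := by omega
          exact ⟨h4, h5⟩
        · exact Or.inr ⟨A, i', j', h1, h2, h3, h4, h5⟩
    · rw [levels, if_neg hq, List.nil_append, hIH]
      constructor
      · rintro ⟨A, i', j', h1, h2, h3⟩
        exact ⟨A, i', j', h1, Or.inr h2, h3⟩
      · rintro ⟨A, i', j', h1, h2 | h2, h3, h4⟩
        · rw [Prod.mk.injEq] at h2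
          rw [h2.1, hcard] at h3
          omega
        · exact ⟨A, i', j', h1, h2, h3, h4⟩

/-- A permutation of `{0, ..., n - 1}` that decreases there is the reversal: its value at each
position is squeezed between two bounds. -/
theorem run_symm_add {u : List ℕ} (hu : IsPath n 1 u) (v : Fin n) :
    (run 1 u).symm v + v + 1 = n := by
  have hfix := run_fixes (fixes_one n) hu
  have h1 : ∀ p, p < n → run 1 u p + p + 1 ≤ n := by
    intro p
    induction p with
    | zero =>
      intro hp
      have := (hfix 0).2 hp
      omega
    | succ p ih =>
      intro hp
      have h2 := run_desc hu (lt_add_one p) hp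
      have h3 := ih (by omega)
      omega
  have h2 : ∀ d p, p + d + 1 = n → d ≤ run 1 u p := by
    intro d
    induction d with
    | zero => intros; omega
    | succ d ih =>
      intro p hp
      have h3 := ih (p + 1) (by omega)
      have h4 := run_desc hu (lt_add_one p) (by omega)
      omega
  have hv : (run 1 u).symm v < n := (hfix.symm_lt _).2 v.2
  have h3 := h1 _ hv
  have h4 := h2 (n - 1 - (run 1 u).symm v) ((run 1 u).symm v) (by omega)
  rw [Equiv.apply_symm_apply] at h3 h4
  omega

theorem isHypertriangulation_levels {κ : ℕ} (hκ : κ < n) {u : List ℕ} (hu : IsPath n 1 u) :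
    IsHypertriangulation (κ + 1) (levels n κ 1 u) := by
  refine ⟨card_of_mem_levels hκ (fixes_one n) hu, ?_, ?_, isChain_levels κ (fixes_one n) hu⟩
  · obtain ⟨l, hl⟩ := exists_levels_eq_cons (n := n) κ 1 u
    rw [hl, List.head?_cons]
    congr 1
  · rw [getLast?_levels]
    congr 1
    ext v
    have := run_symm_add hu v
    simp only [mem_pre, mem_filter, mem_univ, true_and]
    omega

theorem isCrossSection_levels (ha : StrictMono a) (hn : 2 ≤ n) {κ : ℕ} {u : List ℕ}
    (hu : IsPath n 1 u) : IsCrossSection (κ + 1) (tilingOf ha hn u hu) (levels n κ 1 u) := by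
  intro S S'
  rw [pair_infix_levels (fixes_one n) hu]
  simp only [tilingOf, List.mem_toFinset]

/-- The differences of consecutive sets of a list. -/
def diffs : List (Finset (Fin n)) → List (Finset ℕ × Finset ℕ)
  | [] => []
  | [_] => []
  | S :: S' :: l =>
    ((S \ S').map Fin.valEmbedding, (S' \ S).map Fin.valEmbedding) :: diffs (S' :: l)

theorem diffs_append (X Y : List (Finset (Fin n))) (P Q : Finset (Fin n)) :
    diffs (X ++ P :: Q :: Y) = diffs (X ++ [P]) ++
      ((P \ Q).map Fin.valEmbedding, (Q \ P).map Fin.valEmbedding) :: diffs (Q :: Y) := by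
  induction X with
  | nil => simp [diffs]
  | cons b X ih =>
    rcases X with _ | ⟨c, X⟩
    · simp [diffs]
    · simp only [List.cons_append, diffs] at ih ⊢
      rw [ih]

theorem eq_of_diffs_eq {l l' : List (Finset (Fin n))} (hh : l.head? = l'.head?)
    (h : diffs l = diffs l') : l = l' := by
  induction l generalizing l' with
  | nil =>
    rcases l' with _ | ⟨b, l'⟩
    · rfl
    · simp at hh
  | cons b l ih =>
    rcases l' with _ | ⟨b', l'⟩
    · simp at hh
    obtain rfl : b = b' := by simpa using hh
    rcases l with _ | ⟨c, l⟩ <;> rcases l' with _ | ⟨c', l'⟩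
    · rfl
    · simp [diffs] at h
    · simp [diffs] at h
    · simp only [diffs, List.cons.injEq, Prod.mk.injEq, Finset.map_inj] at h
      obtain ⟨⟨h1, h2⟩, h3⟩ := h
      obtain rfl : c = c' := by
        ext v
        have e1 : v ∈ b \ c ↔ v ∈ b \ c' := by rw [h1]
        have e2 : v ∈ c \ b ↔ v ∈ c' \ b := by rw [h2]
        rw [mem_sdiff, mem_sdiff] at e1 e2
        tauto
      rw [ih (l' := c :: l') rfl h3]

theorem insert_sdiff_insert_of_ne {A : Finset (Fin n)} {i j : Fin n} (hi : i ∉ A) (hij : i ≠ j) :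
    insert i A \ insert j A = {i} := by
  ext v
  simp only [mem_sdiff, mem_insert, mem_singleton]
  constructor
  · tauto
  · rintro rfl
    tauto

/-- The passage between geometry and words: as its first set is known, the chain carries the same
information as the list of wall swaps. -/
theorem diffs_levels (κ : ℕ) {w : Equiv.Perm ℕ} (hw : Fixes n w) {u : List ℕ}
    (hu : IsPath n w u) :
    diffs (levels n κ w u) = (steps κ w u).map fun s => ({s.1}, {s.2}) := by
  induction u generalizing w with
  | nil => rfl
  | cons q u ih =>
    have hIH := ih (hw.mul_adj hu.1) hu.2.2
    by_cases hq : q = κ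
    · subst hq
      obtain ⟨l, hl⟩ := exists_levels_eq_cons (n := n) q (w * adj q) u
      obtain ⟨i, j, hi, hj, hij⟩ := exists_swap hw hu.1
      have hiA : i ∉ pre n w q := by rw [mem_pre, ← hi]; simp
      have hjA : j ∉ pre n w q := by rw [mem_pre, ← hj]; simp
      rw [levels, if_pos rfl, steps, if_pos rfl, hl, List.singleton_append, diffs, ← hl, hIH,
        pre_mul_adj_self hj, pre_succ hi, insert_sdiff_insert_of_ne hiA hij,
        insert_sdiff_insert_of_ne hjA hij.symm, hi, hj]
      simp
    · rw [levels, if_neg hq, steps, if_neg hq, List.nil_append, List.nil_append, hIH]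

theorem singletons_injective :
    Function.Injective fun s : ℕ × ℕ => (({s.1}, {s.2}) : Finset ℕ × Finset ℕ) := by
  rintro ⟨x, y⟩ ⟨x', y'⟩ h
  simpa using h

/-- Tilings with the same cross-section are connected by flips at other levels. -/
theorem connectedAvoiding_of_crossSection (ha : StrictMono a) (hn : 2 ≤ n) {κ : ℕ} (hκ : κ < n)
    {T T' : FineZonotopalTiling a} {H : List (Finset (Fin n))}
    (hH : IsHypertriangulation (κ + 1) H) (hT : IsCrossSection (κ + 1) T H)
    (hT' : IsCrossSection (κ + 1) T' H) : ConnectedAvoiding {κ + 1, κ} T T' := by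
  obtain ⟨u, hu, rfl⟩ := exists_eq_tilingOf ha hn T
  obtain ⟨v, hv, rfl⟩ := exists_eq_tilingOf ha hn T'
  have h1 := crossSection_unique hH (isHypertriangulation_levels hκ hu) hT
    (isCrossSection_levels ha hn hu)
  have h2 := crossSection_unique hH (isHypertriangulation_levels hκ hv) hT'
    (isCrossSection_levels ha hn hv)
  have h3 := diffs_levels κ (fixes_one n) hu
  rw [← h1, h2, diffs_levels κ (fixes_one n) hv] at h3
  have h4 := singletons_injective.list_map h3
  exact connectedAvoiding_of_weq ha hn (weq_of_steps_eq _ le_rfl hu hv h4.symm) [] _ _ rfl rfl hu hv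

theorem MonotoneStep.exists_sdiff {S S' : Finset (Fin n)} (h : MonotoneStep S S') :
    ∃ i j : Fin n, i < j ∧ S \ S' = {i} ∧ S' \ S = {j} ∧ i ∈ S ∧ j ∉ S ∧
      ∀ v, v ∈ S' ↔ v = j ∨ v ∈ S ∧ v ≠ i := by
  obtain ⟨I, i, j, hi, hj, hij, rfl, rfl⟩ := h
  refine ⟨i, j, hij, insert_sdiff_insert_of_ne hi hij.ne, insert_sdiff_insert_of_ne hj hij.ne',
    mem_insert_self _ _, by simp [hij.ne', hj], fun v => ?_⟩
  simp only [mem_insert]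
  constructor
  · rintro (h | h)
    · exact Or.inl h
    · exact Or.inr ⟨Or.inr h, fun h' => hi (h' ▸ h)⟩
  · rintro (h | ⟨h | h, h'⟩)
    · exact Or.inl h
    · exact absurd h h'
    · exact Or.inr h

/-- For values `x`, `y`, `z` the braid contracts the wall swaps `(x, y)`, `(y, z)` to `(x, z)`: the
intermediate set containing `y` disappears. -/
theorem steps_braid_up {κ : ℕ} (w : Equiv.Perm ℕ) (β : List ℕ) :
    steps κ w (κ :: (κ + 1) :: κ :: β) = (w κ, w (κ + 1)) :: (w (κ + 1), w (κ + 1 + 1)) ::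
      steps κ (w * adj κ * adj (κ + 1) * adj κ) β ∧
    steps κ w ((κ + 1) :: κ :: (κ + 1) :: β) = (w κ, w (κ + 1 + 1)) ::
      steps κ (w * adj κ * adj (κ + 1) * adj κ) β := by
  have e : κ ≠ κ + 1 + 1 := by omega
  refine ⟨by simp [steps, mul_adj_apply, e, e.symm], ?_⟩
  rw [mul_adj_braid]
  simp [steps, mul_adj_apply, e]

/-- With the wall between the last two of the three positions, `(y, z)`, `(x, y)` is contracted to
`(x, z)`. -/
theorem steps_braid_down {p : ℕ} (w : Equiv.Perm ℕ) (β : List ℕ) :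
    steps (p + 1) w ((p + 1) :: p :: (p + 1) :: β) =
      (w (p + 1), w (p + 1 + 1)) :: (w p, w (p + 1)) ::
      steps (p + 1) (w * adj p * adj (p + 1) * adj p) β ∧
    steps (p + 1) w (p :: (p + 1) :: p :: β) = (w p, w (p + 1 + 1)) ::
      steps (p + 1) (w * adj p * adj (p + 1) * adj p) β := by
  have e : p ≠ p + 1 + 1 := by omega
  refine ⟨?_, by simp [steps, mul_adj_apply, e.symm]⟩
  rw [mul_adj_braid]
  simp [steps, mul_adj_apply, e, e.symm]

theorem levels_eq_of_steps {κ : ℕ} (hκ : κ < n) {H : List (Finset (Fin n))}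
    (hH : IsHypertriangulation (κ + 1) H) {v : List ℕ} (hv : IsPath n 1 v)
    (h : (steps κ 1 v).map (fun s => (({s.1}, {s.2}) : Finset ℕ × Finset ℕ)) = diffs H) :
    levels n κ 1 v = H :=
  eq_of_diffs_eq ((isHypertriangulation_levels hκ hv).2.1.trans hH.2.1.symm)
    ((diffs_levels κ (fixes_one n) hv).trans h)

/-- If a set of the cross-section of a tiling can be left out, then the tiling can be flipped
accordingly, after flips at other levels. -/
theorem exists_flip_of_insertsSet (ha : StrictMono a) (hn : 2 ≤ n) {κ : ℕ} (hκ : κ < n)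
    {T : FineZonotopalTiling a} {H H' : List (Finset (Fin n))}
    (hH : IsHypertriangulation (κ + 1) H) (hH' : IsHypertriangulation (κ + 1) H')
    (hT : IsCrossSection (κ + 1) T H') (h : InsertsSet H H') :
    ∃ T1 T2, ConnectedAvoiding {κ + 1, κ} T T1 ∧ IsCrossSection (κ + 1) T2 H ∧
      (IsFlipAtLevel (κ + 1) T1 T2 ∨ IsFlipAtLevel κ T1 T2) := by
  obtain ⟨u, hu, rfl⟩ := exists_eq_tilingOf ha hn T
  have hu' := crossSection_unique hH' (isHypertriangulation_levels hκ hu) hT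
    (isCrossSection_levels ha hn hu)
  have hirr : ∀ S : Finset (Fin n), ¬ MonotoneStep S S := fun S h => h.weight_lt.false
  obtain ⟨X, Y, S, hX, hY⟩ := h
  -- `S` is neither first nor last: both chains have the same ends, and a step from a set to itself
  -- is impossible.
  obtain ⟨X, P, rfl⟩ : ∃ X' P, X = X' ++ [P] := by
    rcases X.eq_nil_or_concat with rfl | ⟨X', P, rfl⟩
    · have h1 := hH.2.1.trans hH'.2.1.symm
      rw [hX, hY] at h1
      rcases Y with _ | ⟨Q, Y⟩
      · simp at h1
      · obtain rfl : Q = S := by simpa using h1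
        have := hH'.2.2.2
        rw [hY, List.nil_append, List.isChain_cons_cons] at this
        exact absurd this.1 (hirr _)
    · exact ⟨X', P, by simp⟩
  obtain ⟨Q, Y, rfl⟩ : ∃ Q Y', Y = Q :: Y' := by
    rcases Y with _ | ⟨Q, Y⟩
    · have h1 := hH.2.2.1.trans hH'.2.2.1.symm
      rw [hX, hY] at h1
      simp only [List.append_nil, List.getLast?_append, List.getLast?_singleton,
        Option.some_or, Option.some.injEq] at h1
      subst h1
      have := hH'.2.2.2
      rw [hY, List.append_assoc, List.singleton_append, List.isChain_append_cons_cons] at this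
      exact absurd this.2.1 (hirr _)
    · exact ⟨Q, Y, rfl⟩
  rw [List.append_assoc, List.singleton_append] at hX hY
  have hPQ : MonotoneStep P Q := by
    have := hH.2.2.2
    rw [hX, List.isChain_append_cons_cons] at this
    exact this.2.1
  have hPSQ : MonotoneStep P S ∧ MonotoneStep S Q := by
    have := hH'.2.2.2
    rw [hY, List.isChain_append_cons_cons, List.isChain_cons_cons] at this
    exact ⟨this.2.1, this.2.2.1⟩
  obtain ⟨i, j, hij, d1, d2, hiP, hjP, hS⟩ := hPSQ.1.exists_sdiff
  obtain ⟨i', j', hij', d3, d4, hiS, hjS, hQ⟩ := hPSQ.2.exists_sdiff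
  obtain ⟨i'', j'', hij'', d5, d6, -⟩ := hPQ.exists_sdiff
  have hdH : diffs H = diffs (X ++ [P]) ++ (({(i'' : ℕ)}, {(j'' : ℕ)}) :: diffs (Q :: Y)) := by
    rw [hX, diffs_append, d5, d6]
    simp
  have hdH' : diffs H' = diffs (X ++ [P]) ++ (({(i : ℕ)}, {(j : ℕ)}) ::
      ({(i' : ℕ)}, {(j' : ℕ)}) :: diffs (Q :: Y)) := by
    rw [hY, diffs_append, diffs, d1, d2, d3, d4]
    simp
  rw [hu', diffs_levels κ (fixes_one n) hu, List.map_eq_append_iff] at hdH'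
  obtain ⟨s, s', hs, hs1, hs2⟩ := hdH'
  obtain ⟨⟨x1, x2⟩, s', rfl, h1, hs2⟩ := List.map_eq_cons_iff.1 hs2
  obtain ⟨⟨x3, x4⟩, r, rfl, h2, hs3⟩ := List.map_eq_cons_iff.1 hs2
  simp only [Prod.mk.injEq, singleton_inj] at h1 h2
  obtain ⟨rfl, rfl⟩ := h1
  obtain ⟨rfl, rfl⟩ := h2
  have hi'' : ∀ v, v ∈ P ∧ v ∉ Q ↔ v = i'' := by
    intro v
    rw [← mem_sdiff, d5, mem_singleton]
  have hj'' : ∀ v, v ∈ Q ∧ v ∉ P ↔ v = j'' := by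
    intro v
    rw [← mem_sdiff, d6, mem_singleton]
  -- As `P → Q` is a single step, either the value that enters with `S` leaves again, or the value
  -- that left returns. Otherwise `i` and `i'` would be two elements of `P \ Q`.
  by_cases hcase : j = i'
  · subst hcase
    have hne : i ≠ j' := (hij.trans hij').ne
    obtain rfl : i = i'' := (hi'' i).1 ⟨hiP, by
      rw [hQ, hS]
      rintro (h | ⟨h | h, -⟩)
      · exact hne h
      · exact hij.ne h
      · exact h.2 rfl⟩
    obtain rfl : j' = j'' := (hj'' j').1 ⟨(hQ _).2 (Or.inl rfl), fun h =>
      hjS ((hS _).2 (Or.inr ⟨h, hne.symm⟩))⟩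
    obtain ⟨α, β, hαβ, hα⟩ := exists_braid_up' hu hs
    have hp := (hαβ.isPath_iff 1).1 hu
    have hst := hαβ.steps_eq 1
    rw [hs, steps_append, hα, (steps_braid_up _ _).1] at hst
    have hst' := List.append_cancel_left hst
    simp only [List.cons.injEq, Prod.mk.injEq] at hst'
    obtain ⟨⟨e1, e2⟩, ⟨-, e3⟩, e4⟩ := hst'
    have hp' : IsPath n 1 (α ++ (κ + 1) :: κ :: (κ + 1) :: β) := by
      have : ∀ {w} (α : List ℕ), IsPath n w (α ++ κ :: (κ + 1) :: κ :: β) →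
          IsPath n w (α ++ (κ + 1) :: κ :: (κ + 1) :: β) := by
        intro w α h
        induction α generalizing w with
        | nil => exact isPath_braid.1 h
        | cons q α ih => exact ⟨h.1, h.2.1, ih h.2.2⟩
      exact this α hp
    refine ⟨_, tilingOf ha hn _ hp', connectedAvoiding_of_weq ha hn hαβ [] _ _ rfl rfl hu hp, ?_,
      Or.inl (isFlipAtLevel_braid ha hn hp hp')⟩
    have hlev := levels_eq_of_steps hκ hH hp' (by
      rw [hdH, steps_append, hα, (steps_braid_up _ _).2, ← e1, ← e3, ← e4, List.map_append, hs1,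
        List.map_cons, hs3])
    rw [← hlev]
    exact isCrossSection_levels ha hn hp'
  · have hcase' : i = j' := by
      by_contra hne
      have h1 : i = i'' := (hi'' i).1 ⟨hiP, by
        rw [hQ, hS]
        rintro (h | ⟨h | h, -⟩)
        · exact hne h
        · exact hij.ne h
        · exact h.2 rfl⟩
      have hiS' := (hS i').1 hiS
      have h2 : i' = i'' := by
        rcases hiS' with h | ⟨h, h'⟩
        · exact absurd h.symm hcase
        · exact (hi'' i').1 ⟨h, by
            rw [hQ]
            rintro (h | ⟨-, h⟩)
            · exact hij'.ne h
            · exact h rfl⟩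
      rcases hiS' with h | ⟨-, h⟩
      · exact hcase h.symm
      · exact h (h2.trans h1.symm)
    subst hcase'
    obtain rfl : i' = i'' := (hi'' i').1 ⟨by
        rcases (hS i').1 hiS with h | h
        · exact absurd h.symm hcase
        · exact h.1, by
        rw [hQ]
        rintro (h | ⟨-, h⟩)
        · exact hij'.ne h
        · exact h rfl⟩
    obtain rfl : j = j'' := (hj'' j).1 ⟨(hQ _).2 (Or.inr ⟨(hS _).2 (Or.inl rfl), hcase⟩), hjP⟩
    obtain ⟨p, α, β, rfl, hαβ, hα⟩ := exists_braid_down' hu hs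
    have hp := (hαβ.isPath_iff 1).1 hu
    have hst := hαβ.steps_eq 1
    rw [hs, steps_append, hα, (steps_braid_down _ _).1] at hst
    have hst' := List.append_cancel_left hst
    simp only [List.cons.injEq, Prod.mk.injEq] at hst'
    obtain ⟨⟨-, e1⟩, ⟨e2, -⟩, e4⟩ := hst'
    have hp' : IsPath n 1 (α ++ p :: (p + 1) :: p :: β) := by
      have : ∀ {w} (α : List ℕ), IsPath n w (α ++ (p + 1) :: p :: (p + 1) :: β) →
          IsPath n w (α ++ p :: (p + 1) :: p :: β) := by
        intro w α h
        induction α generalizing w with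
        | nil => exact isPath_braid.2 h
        | cons q α ih => exact ⟨h.1, h.2.1, ih h.2.2⟩
      exact this α hp
    refine ⟨_, tilingOf ha hn _ hp', connectedAvoiding_of_weq ha hn hαβ [] _ _ rfl rfl hu hp, ?_,
      Or.inr (isFlipAtLevel_braid ha hn hp' hp).symm⟩
    have hlev := levels_eq_of_steps hκ hH hp' (by
      rw [hdH, steps_append, hα, (steps_braid_down _ _).2, ← e1, ← e2, ← e4, List.map_append, hs1,
        List.map_cons, hs3])
    rw [← hlev]
    exact isCrossSection_levels ha hn hp'

end ZonoHyper
end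
-- Invariants of cross-sections under flips
noncomputable section
namespace ZonoHyper

open Finset

variable {n : ℕ} {a : Fin n → ℝ}

theorem weight_lt_of_pair_infix {β : Type*} {φ : β → ℕ} {l : List β}
    (hl : l.Pairwise fun x y => φ x < φ y) {u v : β} (h : [u, v] <:+: l) : φ u < φ v := by
  simpa using hl.sublist h.sublist

theorem pair_infix_right_unique {β : Type*} {φ : β → ℕ} {l : List β}
    (hl : l.Pairwise fun x y => φ x < φ y) {u v v' : β} (h : [u, v] <:+: l)
    (h' : [u, v'] <:+: l) : v = v' := by
  induction l with
  | nil => simp at h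
  | cons p l ih =>
    rcases l with _ | ⟨q, l⟩
    · exact absurd h not_pair_infix_singleton
    rw [List.pairwise_cons] at hl
    rw [pair_infix_cons_cons] at h h'
    have key : ∀ {v}, [p, v] <:+: q :: l → False := fun h =>
      (hl.1 p (h.subset (by simp))).false
    rcases h with ⟨rfl, rfl⟩ | h <;> rcases h' with ⟨h1, h2⟩ | h'
    · exact h2.symm
    · exact (key h').elim
    · exact (key (h1 ▸ h)).elim
    · exact ih hl.2 h h'

theorem pair_infix_left_unique {β : Type*} {φ : β → ℕ} {l : List β}
    (hl : l.Pairwise fun x y => φ x < φ y) {u u' v : β} (h : [u, v] <:+: l)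
    (h' : [u', v] <:+: l) : u = u' := by
  induction l with
  | nil => simp at h
  | cons p l ih =>
    rcases l with _ | ⟨q, l⟩
    · exact absurd h not_pair_infix_singleton
    rw [List.pairwise_cons] at hl
    rw [pair_infix_cons_cons] at h h'
    have key : ∀ {u}, [u, q] <:+: q :: l → False := fun {u} h => by
      have h1 := weight_lt_of_pair_infix hl.2 h
      have h2 : u ∈ q :: l := h.subset (by simp)
      rcases List.mem_cons.1 h2 with rfl | h2
      · exact h1.false
      · have := (List.pairwise_cons.1 hl.2).1 u h2
        omega
    rcases h with ⟨rfl, rfl⟩ | h <;> rcases h' with ⟨h1, h2⟩ | h'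
    · exact h1.symm
    · exact (key h').elim
    · exact (key (h2 ▸ h)).elim
    · exact ih hl.2 h h'

theorem Edge.monotoneStep {k : ℕ} {T : FineZonotopalTiling a} {S S' : Finset (Fin n)}
    (h : Edge k T S S') : MonotoneStep S S' ∧ S.card = k ∧ S'.card = k := by
  obtain ⟨A, i, j, hij, hmem, hc, rfl, rfl⟩ := h
  have hd := T.disjoint_of_mem _ hmem
  simp only [disjoint_insert_right, disjoint_singleton_right] at hd
  exact ⟨⟨A, i, j, hd.1, hd.2, hij, rfl, rfl⟩, by rw [card_insert_of_notMem hd.1, hc],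
    by rw [card_insert_of_notMem hd.2, hc]⟩

/-- The relation `E'` arises from `E` by replacing the pair `(P, Q)` by `(P, S)` and `(S, Q)`. -/
def Subdivides (E E' : Finset (Fin n) → Finset (Fin n) → Prop) (P S Q : Finset (Fin n)) : Prop :=
  E P Q ∧ ∀ U V, E' U V ↔ (E U V ∧ ¬ (U = P ∧ V = Q)) ∨ (U = P ∧ V = S) ∨ (U = S ∧ V = Q)

theorem insertsSet_of_subdivides {k : ℕ} {T T' : FineZonotopalTiling a}
    {H H' : List (Finset (Fin n))} (hH : IsHypertriangulation k H)
    (hH' : IsHypertriangulation k H') (hT : IsCrossSection k T H) (hT' : IsCrossSection k T' H')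
    {P S Q : Finset (Fin n)} (h : Subdivides (Edge k T) (Edge k T') P S Q) :
    InsertsSet H H' := by
  obtain ⟨hPQ, hE⟩ := h
  obtain ⟨X, Y, hXY⟩ := (hT P Q).2 hPQ
  obtain rfl : H = X ++ P :: Q :: Y := by rw [← hXY]; simp
  have e1 : Edge k T' P S := (hE P S).2 (Or.inr (Or.inl ⟨rfl, rfl⟩))
  have e2 : Edge k T' S Q := (hE S Q).2 (Or.inr (Or.inr ⟨rfl, rfl⟩))
  have hpw := pairwise_weight hH.2.2.2
  have hch := hH.2.2.2
  rw [List.isChain_append_cons_cons] at hch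
  have hch' : (X ++ P :: S :: Q :: Y).IsChain MonotoneStep := by
    rw [List.isChain_append_cons_cons, List.isChain_cons_cons]
    exact ⟨hch.1, e1.monotoneStep.1, e2.monotoneStep.1, hch.2.2⟩
  refine ⟨X ++ [P], Q :: Y, S, by simp, ?_⟩
  rw [List.append_assoc, List.singleton_append]
  symm
  refine eq_of_pair_infix_iff weight (pairwise_weight hch') (pairwise_weight hH'.2.2.2) ?_ ?_
  · rw [hH'.2.1, ← hH.2.1]
    rcases X with _ | ⟨b, X⟩ <;> rfl
  · intro U V
    have h1 : [U, V] <:+: H' ↔ Edge k T' U V := hT' U V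
    have h2 : [U, V] <:+: X ++ P :: Q :: Y ↔ Edge k T U V := hT U V
    rw [h1, hE, ← h2, pair_infix_append, pair_infix_append, pair_infix_cons_cons]
    -- `P` and `Q` occur once each in the chain, so removing this edge removes one consecutive pair
    -- only.
    have hn : ¬ ([P, Q] <:+: X ++ [P] ∨ [P, Q] <:+: Q :: Y) := by
      have hpw' := hpw
      rw [show X ++ P :: Q :: Y = (X ++ [P]) ++ (Q :: Y) by simp, List.pairwise_append] at hpw'
      obtain ⟨-, -, h3⟩ := hpw'
      rintro (h | h)
      · exact (h3 Q (h.subset (by simp)) Q (by simp)).false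
      · exact (h3 P (by simp) P (h.subset (by simp))).false
    constructor
    · rintro (h | h | h | h)
      · by_cases hc : U = P ∧ V = Q
        · obtain ⟨rfl, rfl⟩ := hc
          exact absurd (Or.inl h) hn
        · exact Or.inl ⟨Or.inl h, hc⟩
      · exact Or.inr (Or.inl h)
      · exact Or.inr (Or.inr h)
      · by_cases hc : U = P ∧ V = Q
        · obtain ⟨rfl, rfl⟩ := hc
          exact absurd (Or.inr h) hn
        · exact Or.inl ⟨Or.inr (Or.inr h), hc⟩
    · rintro (⟨h | h | h, hc⟩ | h | h)
      · exact Or.inl h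
      · exact absurd h hc
      · exact Or.inr (Or.inr (Or.inr h))
      · exact Or.inr (Or.inl h)
      · exact Or.inr (Or.inr (Or.inl h))

/-- `A` is the intersection of the two sets, so an edge of the cross-section determines its tile. -/
theorem insert_pair_unique {A B : Finset (Fin n)} {i j x z : Fin n} (hij : i ≠ j) (hxz : x ≠ z)
    (hi : i ∉ B) (hj : j ∉ B) (hx : x ∉ A) (hz : z ∉ A) (h1 : insert i B = insert x A)
    (h2 : insert j B = insert z A) : B = A ∧ i = x ∧ j = z := by
  have hBA : B = A := by
    ext v
    have e1 : v = i ∨ v ∈ B ↔ v = x ∨ v ∈ A := by rw [← mem_insert, h1, mem_insert]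
    have e2 : v = j ∨ v ∈ B ↔ v = z ∨ v ∈ A := by rw [← mem_insert, h2, mem_insert]
    constructor
    · intro hv
      rcases e1.1 (Or.inr hv) with h | h
      · rcases e2.1 (Or.inr hv) with h' | h'
        · exact absurd (h.symm.trans h') hxz
        · exact h'
      · exact h
    · intro hv
      rcases e1.2 (Or.inr hv) with h | h
      · rcases e2.2 (Or.inr hv) with h' | h'
        · exact absurd (h.symm.trans h') hij
        · exact h'
      · exact h
  subst hBA
  refine ⟨rfl, ?_, ?_⟩
  · have : i ∈ insert x B := h1 ▸ mem_insert_self _ _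
    exact (mem_insert.1 this).resolve_right hi
  · have : j ∈ insert z B := h2 ▸ mem_insert_self _ _
    exact (mem_insert.1 this).resolve_right hj

/-- The diagonal at level `k` of a tile. -/
def IsDiagonal (k : ℕ) (t : Finset (Fin n) × Finset (Fin n)) (U V : Finset (Fin n)) : Prop :=
  ∃ A i j, i < j ∧ t = (A, {i, j}) ∧ A.card + 1 = k ∧ U = insert i A ∧ V = insert j A

theorem edge_iff {k : ℕ} {T : FineZonotopalTiling a} {U V : Finset (Fin n)} :
    Edge k T U V ↔ ∃ t ∈ T.tiles, IsDiagonal k t U V := by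
  constructor
  · rintro ⟨A, i, j, h1, h2, h3⟩
    exact ⟨_, h2, A, i, j, h1, rfl, h3⟩
  · rintro ⟨_, h2, A, i, j, h1, rfl, h3⟩
    exact ⟨A, i, j, h1, h2, h3⟩

theorem isDiagonal_mk {k : ℕ} {A : Finset (Fin n)} {i j : Fin n} (hij : i < j)
    {U V : Finset (Fin n)} : IsDiagonal k (A, {i, j}) U V ↔
      A.card + 1 = k ∧ U = insert i A ∧ V = insert j A := by
  constructor
  · rintro ⟨A', i', j', hij', h, h3, h4, h5⟩
    rw [Prod.mk.injEq] at h
    obtain ⟨rfl, h2⟩ := h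
    have hi' : i' = i ∨ i' = j := by
      have : i' ∈ ({i, j} : Finset (Fin n)) := h2 ▸ by simp
      simpa using this
    have hj' : j' = i ∨ j' = j := by
      have : j' ∈ ({i, j} : Finset (Fin n)) := h2 ▸ by simp
      simpa using this
    obtain rfl : i' = i := by omega
    obtain rfl : j' = j := by omega
    exact ⟨h3, h4, h5⟩
  · rintro ⟨h1, h2, h3⟩
    exact ⟨A, i, j, hij, rfl, h1, h2, h3⟩

theorem eq_of_isDiagonal {k : ℕ}
    {s t : Finset (Fin n) × Finset (Fin n)} (hs : Disjoint s.1 s.2) (ht : Disjoint t.1 t.2)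
    {U V : Finset (Fin n)} (h : IsDiagonal k s U V) (h' : IsDiagonal k t U V) : s = t := by
  obtain ⟨A, i, j, hij, rfl, -, rfl, rfl⟩ := h
  obtain ⟨B, x, z, hxz, rfl, -, h1, h2⟩ := h'
  simp only [disjoint_insert_right, disjoint_singleton_right] at hs ht
  obtain ⟨rfl, rfl, rfl⟩ := insert_pair_unique hij.ne hxz.ne hs.1 hs.2 ht.1 ht.2 h1 h2
  rfl

theorem edge_iff_of_exchange {k : ℕ} {T T' : FineZonotopalTiling a}
    {D : Finset (Finset (Fin n) × Finset (Fin n))} (h : T.tiles \ T'.tiles = D)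
    {U V : Finset (Fin n)} : Edge k T U V ↔
      (∃ t ∈ T.tiles ∩ T'.tiles, IsDiagonal k t U V) ∨ ∃ t ∈ D, IsDiagonal k t U V := by
  rw [edge_iff]
  constructor
  · rintro ⟨t, ht, h1⟩
    by_cases ht' : t ∈ T'.tiles
    · exact Or.inl ⟨t, mem_inter.2 ⟨ht, ht'⟩, h1⟩
    · exact Or.inr ⟨t, h ▸ mem_sdiff.2 ⟨ht, ht'⟩, h1⟩
  · rintro (⟨t, ht, h1⟩ | ⟨t, ht, h1⟩)
    · exact ⟨t, (mem_inter.1 ht).1, h1⟩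
    · exact ⟨t, (mem_sdiff.1 (h ▸ ht)).1, h1⟩

/-- The effect of the exchange of the tiles of a hexagon on the cross-sections. -/
theorem edge_of_exchange {T T' : FineZonotopalTiling a} {A : Finset (Fin n)} {x y z : Fin n}
    (hxy : x < y) (hyz : y < z) (hx : x ∉ A) (hy : y ∉ A) (hz : z ∉ A)
    (h1 : T.tiles \ T'.tiles = exchangeTiles A {y} {x, z})
    (h2 : T'.tiles \ T.tiles = exchangeTiles A {x, z} {y}) (k : ℕ) :
    (A.card + 1 ≠ k → A.card + 2 ≠ k → ∀ U V, Edge k T U V ↔ Edge k T' U V) ∧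
    (A.card + 1 = k → Subdivides (Edge k T') (Edge k T) (insert x A) (insert y A) (insert z A)) ∧
    (A.card + 2 = k → Subdivides (Edge k T) (Edge k T') (insert x (insert y A))
      (insert x (insert z A)) (insert y (insert z A))) := by
  have hxz := hxy.trans hyz
  have hcx : (insert x A).card = A.card + 1 := card_insert_of_notMem hx
  have hcy : (insert y A).card = A.card + 1 := card_insert_of_notMem hy
  have hcz : (insert z A).card = A.card + 1 := card_insert_of_notMem hz
  rw [exchangeTiles_left hxy hyz] at h1
  rw [exchangeTiles_right hxy hyz] at h2
  have E1 : ∀ U V, Edge k T U V ↔ (∃ t ∈ T.tiles ∩ T'.tiles, IsDiagonal k t U V) ∨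
      (A.card + 1 = k ∧ U = insert x A ∧ V = insert y A) ∨
      (A.card + 2 = k ∧ U = insert x (insert y A) ∧ V = insert z (insert y A)) ∨
      (A.card + 1 = k ∧ U = insert y A ∧ V = insert z A) := by
    intro U V
    rw [edge_iff_of_exchange h1]
    simp only [mem_insert, mem_singleton, exists_eq_or_imp, exists_eq_left, isDiagonal_mk hxy,
      isDiagonal_mk hyz, isDiagonal_mk hxz, hcy]
  have E2 : ∀ U V, Edge k T' U V ↔ (∃ t ∈ T.tiles ∩ T'.tiles, IsDiagonal k t U V) ∨
      (A.card + 2 = k ∧ U = insert y (insert x A) ∧ V = insert z (insert x A)) ∨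
      (A.card + 1 = k ∧ U = insert x A ∧ V = insert z A) ∨
      (A.card + 2 = k ∧ U = insert x (insert z A) ∧ V = insert y (insert z A)) := by
    intro U V
    rw [edge_iff_of_exchange h2]
    simp only [mem_insert, mem_singleton, exists_eq_or_imp, exists_eq_left, isDiagonal_mk hxy,
      isDiagonal_mk hyz, isDiagonal_mk hxz, hcx, hcz, inter_comm]
  refine ⟨fun k1 k2 U V => ?_, fun hk => ?_, fun hk => ?_⟩
  · rw [E1, E2]
    simp [k1, k2]
  · have hk2 : A.card + 2 ≠ k := by omega
    refine ⟨(E2 _ _).2 (Or.inr (Or.inr (Or.inl ⟨hk, rfl, rfl⟩))), fun U V => ?_⟩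
    rw [E1, E2]
    simp only [hk, hk2, true_and, false_and, false_or, or_false]
    constructor
    · rintro (⟨t, ht, hd⟩ | h)
      · refine Or.inl ⟨Or.inl ⟨t, ht, hd⟩, ?_⟩
        rintro ⟨rfl, rfl⟩
        have hnot : (A, ({x, z} : Finset (Fin n))) ∈ T'.tiles \ T.tiles := by rw [h2]; simp
        have hmem := mem_inter.1 ht
        have := eq_of_isDiagonal (T.disjoint_of_mem t hmem.1)
          (T'.disjoint_of_mem _ (mem_sdiff.1 hnot).1) hd ((isDiagonal_mk hxz).2 ⟨hk, rfl, rfl⟩)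
        exact (mem_sdiff.1 hnot).2 (this ▸ hmem.1)
      · exact Or.inr h
    · rintro (⟨h | h, hne⟩ | h)
      · exact Or.inl h
      · exact absurd h hne
      · exact Or.inr h
  · have hk1 : A.card + 1 ≠ k := by omega
    refine ⟨(E1 _ _).2 (Or.inr (Or.inr (Or.inl ⟨hk, rfl, insert_comm _ _ _⟩))), fun U V => ?_⟩
    rw [E1, E2, insert_comm y x, insert_comm z x, insert_comm z y]
    simp only [hk, hk1, true_and, false_and, false_or, or_false]
    constructor
    · rintro (⟨t, ht, hd⟩ | h)
      · refine Or.inl ⟨Or.inl ⟨t, ht, hd⟩, ?_⟩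
        rintro ⟨rfl, rfl⟩
        have hnot : (insert y A, ({x, z} : Finset (Fin n))) ∈ T.tiles \ T'.tiles := by
          rw [h1]; simp
        have hmem := mem_inter.1 ht
        have := eq_of_isDiagonal (T.disjoint_of_mem t hmem.1)
          (T.disjoint_of_mem _ (mem_sdiff.1 hnot).1) hd
          ((isDiagonal_mk hxz).2 ⟨by omega, rfl, insert_comm _ _ _⟩)
        exact (mem_sdiff.1 hnot).2 (this ▸ hmem.2)
      · exact Or.inr h
    · rintro (⟨h | h, hne⟩ | h)
      · exact Or.inl h
      · exact absurd h hne
      · exact Or.inr h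

/-- The effect of a flip on the cross-section at level `κ + 1`. -/
theorem IsFlipAtLevel.edge (ha : StrictMono a) {l : ℕ} {T T' : FineZonotopalTiling a}
    (h : IsFlipAtLevel l T T') (κ : ℕ) :
    (l ≠ κ + 1 → l ≠ κ → ∀ U V, Edge (κ + 1) T U V ↔ Edge (κ + 1) T' U V) ∧
    (l = κ + 1 → ∃ P S Q, (Subdivides (Edge (κ + 1) T) (Edge (κ + 1) T') P S Q ∨
      Subdivides (Edge (κ + 1) T') (Edge (κ + 1) T) P S Q) ∧ P ∩ S = P ∩ Q ∧ S ∩ Q = P ∩ Q) ∧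
    (l = κ → ∃ P S Q, (Subdivides (Edge (κ + 1) T) (Edge (κ + 1) T') P S Q ∨
      Subdivides (Edge (κ + 1) T') (Edge (κ + 1) T) P S Q) ∧
      P ∪ S = P ∪ Q ∧ S ∪ Q = P ∪ Q) := by
  obtain ⟨P, N, A, ⟨hC, -⟩, hd, h1, h2, rfl⟩ := h
  obtain ⟨x, y, z, hxy, hyz, hPN⟩ := hC.eq_or_eq ha
  have hxz := hxy.trans hyz
  have hmem : x ∉ A ∧ y ∉ A ∧ z ∉ A := by
    rw [disjoint_right] at hd
    rcases hPN with ⟨rfl, rfl⟩ | ⟨rfl, rfl⟩ <;>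
      exact ⟨hd (by simp), hd (by simp), hd (by simp)⟩
  obtain ⟨hx, hy, hz⟩ := hmem
  have hinter : ∀ {i j : Fin n}, i ∉ A → j ∉ A → i ≠ j → insert i A ∩ insert j A = A := by
    intro i j hi hj hij
    ext v
    simp only [mem_inter, mem_insert]
    constructor
    · rintro ⟨h | h, h' | h'⟩
      · exact absurd (h.symm.trans h') hij
      all_goals assumption
    · exact fun h => ⟨Or.inr h, Or.inr h⟩
  -- At level `|A| + 1` the three sets meet pairwise in `A`; at level `|A| + 2` they pairwise join
  -- to `A` with all of `x`, `y`, `z`. These equalities make the turns invariant.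
  have i1 : insert x A ∩ insert y A = insert x A ∩ insert z A := by
    rw [hinter hx hy hxy.ne, hinter hx hz hxz.ne]
  have i2 : insert y A ∩ insert z A = insert x A ∩ insert z A := by
    rw [hinter hy hz hyz.ne, hinter hx hz hxz.ne]
  have j1 : insert x (insert y A) ∪ insert x (insert z A) =
      insert x (insert y A) ∪ insert y (insert z A) := by
    ext v
    simp only [mem_union, mem_insert]
    tauto
  have j2 : insert x (insert z A) ∪ insert y (insert z A) =
      insert x (insert y A) ∪ insert y (insert z A) := by
    ext v
    simp only [mem_union, mem_insert]
    tauto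
  rcases hPN with ⟨rfl, rfl⟩ | ⟨rfl, rfl⟩
  · obtain ⟨f1, f2, f3⟩ := edge_of_exchange hxy hyz hx hy hz h1 h2 (κ + 1)
    exact ⟨fun k1 k2 => f1 k1 (by omega), fun k1 => ⟨_, _, _, Or.inr (f2 k1), i1, i2⟩,
      fun k1 => ⟨_, _, _, Or.inl (f3 (by omega)), j1, j2⟩⟩
  · obtain ⟨f1, f2, f3⟩ := edge_of_exchange hxy hyz hx hy hz h2 h1 (κ + 1)
    exact ⟨fun k1 k2 U V => (f1 k1 (by omega) U V).symm,
      fun k1 => ⟨_, _, _, Or.inl (f2 k1), i1, i2⟩,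
      fun k1 => ⟨_, _, _, Or.inr (f3 (by omega)), j1, j2⟩⟩

/-- `V` is a set of the chain `E` at which the value of `f` on consecutive sets changes. -/
def Turns (f : Finset (Fin n) → Finset (Fin n) → Finset (Fin n))
    (E : Finset (Fin n) → Finset (Fin n) → Prop) (V : Finset (Fin n)) : Prop :=
  ∃ U U', E U V ∧ E V U' ∧ f U V ≠ f V U'

/-- Each set has at most one successor and at most one predecessor, and none is its own
successor. -/
def IsChainRel (E : Finset (Fin n) → Finset (Fin n) → Prop) : Prop :=
  (∀ U V V', E U V → E U V' → V = V') ∧ (∀ U U' V, E U V → E U' V → U = U') ∧ ∀ U, ¬ E U U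

/-- The new set `S` is no turn, since `f P S = f S Q`, and at `P` and `Q` the edge changes its other
end but not its value of `f`. -/
theorem Subdivides.turns_iff {f : Finset (Fin n) → Finset (Fin n) → Finset (Fin n)}
    {E E' : Finset (Fin n) → Finset (Fin n) → Prop} {P S Q : Finset (Fin n)}
    (h : Subdivides E E' P S Q) (hE : IsChainRel E) (hE' : IsChainRel E')
    (h1 : f P S = f P Q) (h2 : f S Q = f P Q) (V : Finset (Fin n)) :
    Turns f E V ↔ Turns f E' V := by
  obtain ⟨hPQ, h⟩ := h
  have ePS : E' P S := (h P S).2 (Or.inr (Or.inl ⟨rfl, rfl⟩))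
  have eSQ : E' S Q := (h S Q).2 (Or.inr (Or.inr ⟨rfl, rfl⟩))
  have hSP : S ≠ P := fun e => hE'.2.2 P (by rwa [e] at ePS)
  have hSQ : S ≠ Q := fun e => hE'.2.2 Q (by rwa [e] at eSQ)
  constructor
  · rintro ⟨U, U', hU, hU', hne⟩
    -- If `S` were already inner in `E`, its successor would be `Q`, whose only predecessor in `E`
    -- is `P`.
    have hVS : V ≠ S := by
      rintro rfl
      have : E' V U' := (h _ _).2 (Or.inl ⟨hU', fun e => hSP e.1⟩)
      obtain rfl := hE'.1 _ _ _ this eSQ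
      exact hSP (hE.2.1 _ _ _ hU' hPQ)
    by_cases c1 : U = P ∧ V = Q <;> by_cases c2 : V = P ∧ U' = Q
    · obtain ⟨rfl, rfl⟩ := c1
      exact absurd (c2.1 ▸ hPQ) (hE.2.2 _)
    · obtain ⟨rfl, rfl⟩ := c1
      exact ⟨S, U', eSQ, (h _ _).2 (Or.inl ⟨hU', c2⟩), by rwa [h2]⟩
    · obtain ⟨rfl, rfl⟩ := c2
      exact ⟨U, S, (h _ _).2 (Or.inl ⟨hU, c1⟩), ePS, by rwa [h1]⟩
    · exact ⟨U, U', (h _ _).2 (Or.inl ⟨hU, c1⟩), (h _ _).2 (Or.inl ⟨hU', c2⟩), hne⟩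
  · rintro ⟨U, U', hU, hU', hne⟩
    have hVS : V ≠ S := by
      rintro rfl
      obtain rfl := hE'.2.1 _ _ _ hU ePS
      obtain rfl := hE'.1 _ _ _ hU' eSQ
      exact hne (h1.trans h2.symm)
    rcases (h _ _).1 hU with ⟨c1, -⟩ | ⟨-, c1⟩ | ⟨rfl, rfl⟩
    · rcases (h _ _).1 hU' with ⟨c2, -⟩ | ⟨rfl, rfl⟩ | ⟨c2, -⟩
      · exact ⟨U, U', c1, c2, hne⟩
      · exact ⟨U, Q, c1, hPQ, by rwa [← h1]⟩
      · exact absurd c2 hVS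
    · exact absurd c1 hVS
    · rcases (h _ _).1 hU' with ⟨c2, -⟩ | ⟨rfl, rfl⟩ | ⟨c2, -⟩
      · exact ⟨P, U', hPQ, c2, by rwa [← h2]⟩
      · exact absurd hPQ (hE.2.2 _)
      · exact absurd c2 hVS

theorem exists_crossSection (ha : StrictMono a) (hn : 2 ≤ n) {κ : ℕ} (hκ : κ < n)
    (T : FineZonotopalTiling a) :
    ∃ H, IsHypertriangulation (κ + 1) H ∧ IsCrossSection (κ + 1) T H := by
  obtain ⟨u, hu, rfl⟩ := exists_eq_tilingOf ha hn T
  exact ⟨_, isHypertriangulation_levels hκ hu, isCrossSection_levels ha hn hu⟩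

theorem isChainRel_edge (ha : StrictMono a) (hn : 2 ≤ n) {κ : ℕ} (hκ : κ < n)
    (T : FineZonotopalTiling a) : IsChainRel (Edge (κ + 1) T) := by
  obtain ⟨H, hH, hT⟩ := exists_crossSection ha hn hκ T
  have hpw := pairwise_weight hH.2.2.2
  refine ⟨fun U V V' h h' => ?_, fun U U' V h h' => ?_, fun U h => ?_⟩
  · exact pair_infix_right_unique hpw ((hT U V).2 h) ((hT U V').2 h')
  · exact pair_infix_left_unique hpw ((hT U V).2 h) ((hT U' V).2 h')
  · exact (weight_lt_of_pair_infix hpw ((hT U U).2 h)).false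

theorem turns_congr {f : Finset (Fin n) → Finset (Fin n) → Finset (Fin n)}
    {E E' : Finset (Fin n) → Finset (Fin n) → Prop} (h : ∀ U V, E U V ↔ E' U V)
    (V : Finset (Fin n)) : Turns f E V ↔ Turns f E' V := by
  simp only [Turns, h]

/-- Flips at level `κ + 1` are excluded; those at level `κ` keep consecutive unions, and all others
keep the whole chain. -/
theorem turns_union_iff (ha : StrictMono a) (hn : 2 ≤ n) {κ : ℕ} (hκ : κ < n)
    {T T' : FineZonotopalTiling a} (h : LevelEquiv (κ + 1) T T') (V : Finset (Fin n)) :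
    Turns (· ∪ ·) (Edge (κ + 1) T) V ↔ Turns (· ∪ ·) (Edge (κ + 1) T') V := by
  induction h with
  | refl => rfl
  | tail _ hf ih =>
    rw [ih]
    obtain ⟨l, hl, hf⟩ := hf
    have hf' := hf.edge ha κ
    by_cases hlκ : l = κ
    · obtain ⟨P, S, Q, h | h, h1, h2⟩ := hf'.2.2 hlκ
      · exact h.turns_iff (isChainRel_edge ha hn hκ _) (isChainRel_edge ha hn hκ _) h1 h2 V
      · exact (h.turns_iff (isChainRel_edge ha hn hκ _) (isChainRel_edge ha hn hκ _) h1 h2 V).symm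
    · exact turns_congr (hf'.1 hl hlκ) V

/-- The dual invariant: now level `κ` is excluded, and flips at level `κ + 1` keep consecutive
intersections. -/
theorem turns_inter_iff (ha : StrictMono a) (hn : 2 ≤ n) {κ : ℕ} (hκ : κ < n)
    {T T' : FineZonotopalTiling a} (h : LevelEquiv κ T T') (V : Finset (Fin n)) :
    Turns (· ∩ ·) (Edge (κ + 1) T) V ↔ Turns (· ∩ ·) (Edge (κ + 1) T') V := by
  induction h with
  | refl => rfl
  | tail _ hf ih =>
    rw [ih]
    obtain ⟨l, hl, hf⟩ := hf
    have hf' := hf.edge ha κ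
    by_cases hlκ : l = κ + 1
    · obtain ⟨P, S, Q, h | h, h1, h2⟩ := hf'.2.1 hlκ
      · exact h.turns_iff (isChainRel_edge ha hn hκ _) (isChainRel_edge ha hn hκ _) h1 h2 V
      · exact (h.turns_iff (isChainRel_edge ha hn hκ _) (isChainRel_edge ha hn hκ _) h1 h2 V).symm
    · exact turns_congr (hf'.1 hlκ hl) V

/-- If union and intersection both stayed the same, the second step would exchange the same two
values backwards, against monotonicity. -/
theorem turns_of_monotoneStep {U V U' : Finset (Fin n)} (h : MonotoneStep U V)
    (h' : MonotoneStep V U') : U ∪ V ≠ V ∪ U' ∨ U ∩ V ≠ V ∩ U' := by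
  obtain ⟨i, j, hij, d1, d2, hi, hj, hV⟩ := h.exists_sdiff
  obtain ⟨i', j', hij', d3, d4, hi', hj', hU'⟩ := h'.exists_sdiff
  by_contra hcon
  rw [not_or, not_not, not_not] at hcon
  obtain ⟨hu, hi2⟩ := hcon
  have hjj : j' = i := by
    have h1 : j' ∈ U ∪ V := by
      rw [hu]
      exact mem_union_right _ ((hU' _).2 (Or.inl rfl))
    have h2 : j' ∈ U := (mem_union.1 h1).resolve_right hj'
    have h3 : j' ∈ U \ V := mem_sdiff.2 ⟨h2, hj'⟩
    rw [d1] at h3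
    exact mem_singleton.1 h3
  have hii : i' = j := by
    have h1 : i' ∉ U := by
      intro h2
      have h3 : i' ∈ U ∩ V := mem_inter.2 ⟨h2, hi'⟩
      rw [hi2] at h3
      rcases (hU' i').1 (mem_inter.1 h3).2 with h | h
      · exact hij'.ne h
      · exact h.2 rfl
    have h3 : i' ∈ V \ U := mem_sdiff.2 ⟨hi', h1⟩
    rw [d2] at h3
    exact mem_singleton.1 h3
  rw [hii, hjj] at hij'
  exact absurd hij' hij.not_gt

theorem mem_iff_of_crossSection {k : ℕ} {T : FineZonotopalTiling a} {H : List (Finset (Fin n))}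
    (hH : IsHypertriangulation k H) (hT : IsCrossSection k T H) (V : Finset (Fin n)) :
    V ∈ H ↔ H.head? = some V ∨ H.getLast? = some V ∨ Turns (· ∪ ·) (Edge k T) V ∨
      Turns (· ∩ ·) (Edge k T) V := by
  constructor
  · intro hV
    obtain ⟨X, Y, rfl⟩ := List.append_of_mem hV
    rcases X.eq_nil_or_concat with rfl | ⟨X, U, rfl⟩
    · exact Or.inl rfl
    rcases Y with _ | ⟨U', Y⟩
    · right; left
      simp
    right; right
    simp only [List.concat_eq_append] at *
    have h1 : Edge k T U V := (hT U V).1 ⟨X, U' :: Y, by simp⟩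
    have h2 : Edge k T V U' := (hT V U').1 ⟨X ++ [U], Y, by simp⟩
    rcases turns_of_monotoneStep h1.monotoneStep.1 h2.monotoneStep.1 with h | h
    · exact Or.inl ⟨U, U', h1, h2, h⟩
    · exact Or.inr ⟨U, U', h1, h2, h⟩
  · have key : ∀ U, Edge k T U V → V ∈ H := fun U h => ((hT U V).2 h).subset (by simp)
    rintro (h | h | ⟨U, -, h, -⟩ | ⟨U, -, h, -⟩)
    · exact List.mem_of_mem_head? h
    · exact List.mem_of_mem_getLast? h
    · exact key U h
    · exact key U h

/-- Each equivalence controls one kind of turn. With the fixed ends, the turns give all members of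
the chain, and the weight gives their order. -/
theorem crossSection_eq_of_levelEquiv (ha : StrictMono a) (hn : 2 ≤ n) {κ : ℕ} (hκ : κ < n)
    {T T' : FineZonotopalTiling a} (h : LevelEquiv (κ + 1) T T') (h' : LevelEquiv κ T T')
    {H H' : List (Finset (Fin n))} (hH : IsHypertriangulation (κ + 1) H)
    (hH' : IsHypertriangulation (κ + 1) H') (hT : IsCrossSection (κ + 1) T H)
    (hT' : IsCrossSection (κ + 1) T' H') : H = H' := by
  have hpw := pairwise_weight hH.2.2.2
  have hpw' := pairwise_weight hH'.2.2.2
  have hnd : ∀ {H : List (Finset (Fin n))}, H.Pairwise (fun S S' => weight S < weight S') →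
      H.Nodup := fun h => h.imp fun h1 h2 => (h2 ▸ h1).false
  refine List.Perm.eq_of_pairwise (fun _ _ _ _ h1 h2 => absurd h1 h2.not_gt) hpw hpw'
    ((List.perm_ext_iff_of_nodup (hnd hpw) (hnd hpw')).2 fun V => ?_)
  rw [mem_iff_of_crossSection hH hT, mem_iff_of_crossSection hH' hT',
    turns_union_iff ha hn hκ h, turns_inter_iff ha hn hκ h', hH.2.1, hH'.2.1, hH.2.2.1, hH'.2.2.1]

theorem ConnectedAvoiding.mono {L L' : Set ℕ} (hL : L' ⊆ L) {T T' : FineZonotopalTiling a}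
    (h : ConnectedAvoiding L T T') : ConnectedAvoiding L' T T' :=
  Relation.ReflTransGen.mono (fun _ _ ⟨l, hl, hf⟩ => ⟨l, fun h => hl (hL h), hf⟩) _ _ h

theorem IsFlipAtLevel.insertsSet (ha : StrictMono a) {κ l : ℕ} (hl : l = κ + 1 ∨ l = κ)
    {T T' : FineZonotopalTiling a} (h : IsFlipAtLevel l T T') {H H' : List (Finset (Fin n))}
    (hH : IsHypertriangulation (κ + 1) H) (hH' : IsHypertriangulation (κ + 1) H')
    (hT : IsCrossSection (κ + 1) T H) (hT' : IsCrossSection (κ + 1) T' H') :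
    InsertsSet H H' ∨ InsertsSet H' H := by
  have hf := h.edge ha κ
  obtain ⟨P, S, Q, hs⟩ : ∃ P S Q, Subdivides (Edge (κ + 1) T) (Edge (κ + 1) T') P S Q ∨
      Subdivides (Edge (κ + 1) T') (Edge (κ + 1) T) P S Q := by
    rcases hl with hl | hl
    · obtain ⟨P, S, Q, hs, -⟩ := hf.2.1 hl
      exact ⟨P, S, Q, hs⟩
    · obtain ⟨P, S, Q, hs, -⟩ := hf.2.2 hl
      exact ⟨P, S, Q, hs⟩
  rcases hs with hs | hs
  · exact Or.inl (insertsSet_of_subdivides hH hH' hT hT' hs)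
  · exact Or.inr (insertsSet_of_subdivides hH' hH hT' hT hs)

end ZonoHyper
end

/-! ### The bijection on classes and the correspondence of flips -/

theorem mainTheorem5 {n : ℕ} (a : Fin n → ℝ) (ha : StrictMono a) (k : ℕ) (hk : 1 ≤ k)
    (hkn : k < n) :
    (∃ Φ : Quotient (ZonoHyper.simulSetoid a k) ≃ ZonoHyper.LiftingHypertriangulation a k,
      (∀ T : ZonoHyper.FineZonotopalTiling a,
        ZonoHyper.IsCrossSection k T (Φ (Quotient.mk _ T)).1) ∧
      ∀ c c' : Quotient (ZonoHyper.simulSetoid a k),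
        (Φ c).IsFlip (Φ c') ↔ ZonoHyper.ClassFlip k c c' ∨ ZonoHyper.ClassFlip (k - 1) c c') ∧
    ∀ T T' : ZonoHyper.FineZonotopalTiling a,
      (ZonoHyper.LevelEquiv k T T' ∧ ZonoHyper.LevelEquiv (k - 1) T T') ↔
        ZonoHyper.ConnectedAvoiding {k, k - 1} T T' := by
  open ZonoHyper in
  obtain ⟨κ, rfl⟩ : ∃ κ, k = κ + 1 := ⟨k - 1, by omega⟩
  have hn : 2 ≤ n := by omega
  have hκ : κ < n := by omega
  rw [Nat.add_sub_cancel]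
  have hboth : ∀ {T T' : FineZonotopalTiling a}, ConnectedAvoiding {κ + 1, κ} T T' →
      LevelEquiv (κ + 1) T T' ∧ LevelEquiv κ T T' := fun h =>
    ⟨h.mono (by simp), h.mono (by simp)⟩
  choose C hC hC' using exists_crossSection ha hn hκ
  have heq : ∀ T T' : FineZonotopalTiling a, LevelEquiv (κ + 1) T T' → LevelEquiv κ T T' →
      C T = C T' := fun T T' h h' =>
    crossSection_eq_of_levelEquiv ha hn hκ h h' (hC T) (hC T') (hC' T) (hC' T')
  have hconn : ∀ (T T' : FineZonotopalTiling a), C T = C T' →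
      ConnectedAvoiding {κ + 1, κ} T T' := fun T T' h =>
    connectedAvoiding_of_crossSection ha hn hκ (hC T) (hC' T) (h ▸ hC' T')
  let F : FineZonotopalTiling a → LiftingHypertriangulation a (κ + 1) :=
    fun T => ⟨C T, hC T, T, hC' T⟩
  let Φ₀ : Quotient (simulSetoid a (κ + 1)) → LiftingHypertriangulation a (κ + 1) :=
    Quotient.lift F fun T T' h => Subtype.ext (heq T T' h.1 h.2)
  have hbij : Function.Bijective Φ₀ := by
    constructor
    · rintro ⟨T⟩ ⟨T'⟩ h
      exact Quotient.sound (hboth (hconn T T' (congrArg Subtype.val h)))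
    · rintro ⟨H, hH, T, hT⟩
      exact ⟨Quotient.mk _ T, Subtype.ext (crossSection_unique (hC T) hH (hC' T) hT)⟩
  have hflip : ∀ T T' : FineZonotopalTiling a, InsertsSet (C T) (C T') →
      ∃ l, (l = κ + 1 ∨ l = κ) ∧ ∃ T1 T1', (Quotient.mk (simulSetoid a (κ + 1)) T1 =
        Quotient.mk _ T) ∧ (Quotient.mk (simulSetoid a (κ + 1)) T1' = Quotient.mk _ T') ∧
        IsFlipAtLevel l T1 T1' := by
    intro T T' h
    -- The flip starts from the class of `T'`, whose chain is longer, and is reversed afterwards.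
    obtain ⟨T1, T2, h1, h2, h3⟩ := exists_flip_of_insertsSet ha hn hκ (hC T) (hC T') (hC' T') h
    have e1 : Quotient.mk (simulSetoid a (κ + 1)) T1 = Quotient.mk _ T' :=
      Quotient.sound (hboth h1.symm)
    have e2 : Quotient.mk (simulSetoid a (κ + 1)) T2 = Quotient.mk _ T :=
      Quotient.sound (hboth (hconn T2 T (crossSection_unique (hC T2) (hC T) (hC' T2) h2)))
    rcases h3 with h3 | h3
    · exact ⟨_, Or.inl rfl, T2, T1, e2, e1, h3.symm⟩
    · exact ⟨_, Or.inr rfl, T2, T1, e2, e1, h3.symm⟩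
  -- For the last claim, two separate flip sequences give equal cross-sections, and these give one
  -- sequence avoiding both levels.
  refine ⟨⟨Equiv.ofBijective Φ₀ hbij, fun T => hC' T, ?_⟩, fun T T' => ⟨fun h =>
    hconn T T' (heq T T' h.1 h.2), hboth⟩⟩
  rintro ⟨T⟩ ⟨T'⟩
  change InsertsSet (C T) (C T') ∨ InsertsSet (C T') (C T) ↔
    ClassFlip (κ + 1) (Quotient.mk _ T) (Quotient.mk _ T') ∨
    ClassFlip κ (Quotient.mk _ T) (Quotient.mk _ T')
  constructor
  · rintro (h | h)
    · obtain ⟨l, rfl | rfl, T1, T1', e1, e2, h1⟩ := hflip T T' h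
      · exact Or.inl ⟨T1, T1', e1, e2, h1⟩
      · exact Or.inr ⟨T1, T1', e1, e2, h1⟩
    · obtain ⟨l, rfl | rfl, T1, T1', e1, e2, h1⟩ := hflip T' T h
      · exact Or.inl ⟨T1', T1, e2, e1, h1.symm⟩
      · exact Or.inr ⟨T1', T1, e2, e1, h1.symm⟩
  · have key : ∀ l, l = κ + 1 ∨ l = κ → ClassFlip (k := κ + 1) l
        (Quotient.mk (simulSetoid a (κ + 1)) T) (Quotient.mk (simulSetoid a (κ + 1)) T') →
        InsertsSet (C T) (C T') ∨ InsertsSet (C T') (C T) := by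
      rintro l hl ⟨T1, T1', e1, e2, h⟩
      have d1 := Quotient.exact e1
      have d2 := Quotient.exact e2
      rw [← heq T1 T d1.1 d1.2, ← heq T1' T' d2.1 d2.2]
      exact h.insertsSet ha hl (hC T1) (hC T1') (hC' T1) (hC' T1')
    rintro (h | h)
    · exact key _ (Or.inl rfl) h
    · exact key _ (Or.inr rfl) h
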